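/- **Setting.** A directed graph on a fixed set of $n$ vertices has initially no arcs; a sequence of $m$ distinct ordered pairs of vertices is added to it as arcs, one at a time, and $n \le \kappa m$ for a constant $\kappa$ (that is, $m=\Omega(n)$). Two vertices are in the same strong component if each is reachable from the other. The algorithm maintains for every vertex $x$ the canonical vertex $f(x)$ of its component, in a disjoint set forest with path compression and union by rank; a list of the canonical vertices, initially all vertices, whose order is written $<$; and for every canonical vertex the list of arcs out of its component and the list of arcs into it. If an added arc $(v,w)$ does not satisfy $f(v)>f(w)$, it is only entered into the lists. Otherwise a search is made, the component structure is updated, and then the arc is entered. **Search.** Start with $F=\{f(w)\}$, $B=\{f(v)\}$, $s=f(v)$. The active sets are $F_A=\{f(w)\}$ (empty if $f(w)$ has no outgoing arc in its list) and $B_A=\{f(v)\}$ (empty if $f(v)$ has no incoming arc in its list); the passive sets $F_P,B_P$ are empty. While $F_A\neq\emptyset$ and $B_A\neq\emptyset$, choose any $u\in F_A$, $z\in B_A$. * If $u<z$, take the first untraversed arc $(q,g)$ out of $u$'s component and the first untraversed arc $(h,r)$ into $z$'s component, and remove $u$ from $F_A$ (respectively $z$ from $B_A$) if that was the last untraversed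 one. An arc with both ends in one component is deleted from the list in which it is met. If $f(g)\notin F$, put $f(g)$ into $F$, and also into $F_A$ if its outgoing list is not empty. If $f(h)\notin B$, put $f(h)$ into $B$, and also into $B_A$ if its incoming list is not empty. * Otherwise move $u$ to $F_P$ if $u>s$ or $u=z=s$, and move $z$ to $B_P$ if $z<s$. * Then, if $F_A=\emptyset$: empty $B_P$, remove $s$ from $B_A$ and, if $F_P\ne\emptyset$, choose a new $s$ from the set of choices $F_P$ and move all $x\in F_P$ with $x\le s$ to $F_A$. Then, if $B_A=\emptyset$: empty $F_P$, remove $s$ from $F_A$ and, if $B_P\neq\emptyset$, choose a new $s$ from the set of choices $B_P$ and move all $x\in B_P$ with $x\ge s$ to $B_A$. **Update.** After the search, let $t$ be the minimum of $f(v)$ and all $x\in F$ that still have an untraversed outgoing arc, $F_<=\{x\in F: x<t\}$, $B_>=\{y\in B: y>t\}$, $X=F_<\cup\{t\}\cup B_>$. Let $Y$ be the set of pairs $(f(a),f(b))$ with $f(a)\ne f(b)$ and both in $X$, where $(a,b)$ is an arc with $f(a)\in F_<$ or $f(b)\in B_>$. If $t=f(v)$, move $F_<$ just after $t$; otherwise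 move $F_<$ just before $t$ and $B_>$ just before $F_<$; within $F_<$ and within $B_>$ use any topological order. The components whose canonical vertices lie on paths from $f(w)$ to $f(v)$ in $(X,Y)$, if there are any, are united into one with canonical vertex $f(v)$, their arc lists are concatenated, and their other canonical vertices are deleted from the list. **Time.** Initialization takes one unit per vertex, and elementary pointer, list and mark operations take constant time. So do order queries, deletions and insertions next to a given element in the (dynamic ordered) list of canonical vertices. A find takes time equal to the number of nodes on the path it compresses. A change of $s$ takes time $1+|F_P|+|B_P|$, including the choice of the new $s$; finding the new component and the topological orders takes time linear in $|X|$ plus the number of arcs in the outgoing lists of $F_<$ and in the incoming lists of $B_>$. **Theorem.** 1. However the choices of $u$, $z$, $s$ and of the topological orders of $F_<$ and $B_>$ are made (deterministically or, for $s$, at random; depending on the past in any way), the computation ends after a bounded number of steps, and after each arc addition: $f(x)=f(y)$ if and only if $x$ and $y$ are in the same strong component; $f(x)$ is in the component of $x$; and the list contains each canonical vertex exactly once, in a topological order of the components ($f(x)<f(y)$ for each arc $(x,y)$ with $f(x)\neq f(y)$). 2. For all $\kappa,\varepsilon>0$ there is a constant $C$ such that, if each new $s$ is an $\varepsilon$-approximate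 median of the set of choices (at least $\varepsilon k$ of the $k$ choices are $\le s$ and at least $\varepsilon k$ are $\ge s$; the medians are the case $\varepsilon=1/2$), then the total time of the $m$ arc additions is always at most $C m^{3/2}$. 3. For every $\kappa>0$ there is a constant $C$ such that, if each new $s$ is chosen uniformly at random from the set of choices, then the expected total time of the $m$ arc additions is at most $C m^{3/2}$. -/

import Mathlib

open scoped ENNReal

namespace StrongComp

/-- Vertices are `0, …, n-1`; an arc is the pair (tail, head). -/
abbrev Arc (n : ℕ) := Fin n × Fin n

/-!  Disjoint sets: a forest with path compression and union by rank.  -/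

/-- A disjoint set forest. `parent` is the parent of a node (a root is its own parent), `rank` is
the rank used for linking, and `name r` is the canonical vertex of the set whose tree has
root `r`. -/
structure Forest (n : ℕ) where
  parent : Fin n → Fin n
  rank : Fin n → ℕ
  name : Fin n → Fin n

namespace Forest

variable {n : ℕ}

/-- The root of the tree containing `x` (a tree on at most `n` nodes has height less than `n`). -/
def root (d : Forest n) (x : Fin n) : Fin n := d.parent^[n] x

/-- The first nodes on the path from `x` to its root, both ends included. The first argument
bounds the number of parent pointers followed. -/
def pathAux (d : Forest n) : ℕ → Fin n → List (Fin n)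
  | 0, x => [x]
  | k + 1, x => if d.parent x = x then [x] else x :: d.pathAux k (d.parent x)

/-- The nodes on the path from `x` to its root, both ends included. -/
def path (d : Forest n) (x : Fin n) : List (Fin n) := d.pathAux n x

/-- The canonical vertex of the set containing `x`. -/
def canon (d : Forest n) (x : Fin n) : Fin n := d.name (d.root x)

/-- Path compression: all nodes on the path from `x` become children of the root. -/
def compress (d : Forest n) (x : Fin n) : Forest n :=
  { d with parent := fun y => if y ∈ d.path x then d.root x else d.parent y }

/-- Link the trees of `x` and `y` by rank; the canonical vertex of the union is `x`. -/
def link (d : Forest n) (x y : Fin n) : Forest n :=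
  let a := d.root x
  let b := d.root y
  if d.rank a < d.rank b then
    { d with
      parent := Function.update d.parent a b
      name := Function.update d.name b x }
  else
    { parent := Function.update d.parent b a
      rank := if d.rank a = d.rank b then Function.update d.rank a (d.rank a + 1) else d.rank
      name := Function.update d.name a x }

end Forest

/-!  The data structure that is maintained, with a clock.  -/

/-- The persistent part of the memory. For a canonical vertex `x`, `out x` is the list of arcs out
of the component of `x` and `inn x` the list of arcs into it. `order` is the dynamic ordered list
of the canonical vertices. `time` is the number of time units used so far; a time unit stands for a
bounded number of elementary operations on pointers, lists, marks, or the dynamic ordered list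
(order query, deletion, insertion next to a given element). -/
structure Store (n : ℕ) where
  sets : Forest n
  out : Fin n → List (Arc n)
  inn : Fin n → List (Arc n)
  order : List (Fin n)
  time : ℕ

namespace Store

variable {n : ℕ}

/-- The memory before any arc is added; one time unit per vertex is charged for it. -/
def init (n : ℕ) : Store n where
  sets := { parent := id, rank := fun _ => 0, name := id }
  out := fun _ => []
  inn := fun _ => []
  order := List.finRange n
  time := n

/-- Let `k` time units pass. -/
def tick (σ : Store n) (k : ℕ) : Store n := { σ with time := σ.time + k }

/-- The canonical vertex of the component of `x`. -/
def f (σ : Store n) (x : Fin n) : Fin n := σ.sets.canon x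

/-- `x` is before `y` in the current list. -/
def lt (σ : Store n) (x y : Fin n) : Prop := σ.order.idxOf x < σ.order.idxOf y

/-- `x` is not after `y` in the current list. -/
def le (σ : Store n) (x y : Fin n) : Prop := σ.order.idxOf x ≤ σ.order.idxOf y

instance (σ : Store n) : DecidableRel σ.lt := fun x y =>
  inferInstanceAs (Decidable (σ.order.idxOf x < σ.order.idxOf y))

instance (σ : Store n) : DecidableRel σ.le := fun x y =>
  inferInstanceAs (Decidable (σ.order.idxOf x ≤ σ.order.idxOf y))

/-- The memory after executing `find(x)`, whose value is `σ.f x`: the path from `x` to its root is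
compressed, and its number of nodes is the time. -/
def find (σ : Store n) (x : Fin n) : Store n :=
  { σ with sets := σ.sets.compress x }.tick (σ.sets.path x).length

/-- Execute a find for each vertex of a list. -/
def findAll (σ : Store n) (l : List (Fin n)) : Store n := l.foldl find σ

/-- Unite the components of the canonical vertices `x` and `y`, keeping `x` canonical, and
concatenate their (circular) arc lists. -/
def unite (σ : Store n) (x y : Fin n) : Store n :=
  let σ := (σ.find x).find y
  { σ with
    sets := σ.sets.link x y
    out := Function.update (Function.update σ.out x (σ.out x ++ σ.out y)) y []
    inn := Function.update (Function.update σ.inn x (σ.inn x ++ σ.inn y)) y [] }.tick 1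

/-- Enter the arc `(v, w)` into the arc lists of the components of its ends. -/
def insertArc (σ : Store n) (v w : Fin n) : Store n :=
  let σ := (σ.find v).find w
  { σ with
    out := Function.update σ.out (σ.f v) ((v, w) :: σ.out (σ.f v))
    inn := Function.update σ.inn (σ.f w) ((v, w) :: σ.inn (σ.f w)) }.tick 1

/-- The list of vertices is in topological order with respect to the arcs leaving its members: no arc
leads from a later to an earlier member. -/
def IsTopological (σ : Store n) (l : List (Fin n)) : Prop :=
  l.Pairwise fun x y => ∀ a ∈ σ.out y, σ.f a.2 ≠ x

end Store

/-!  The search.  -/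

/-- The state of a soft-threshold search started by the addition of `(v, w)`, forward from
`src = f(w)` and backward from `dst = f(v)`. `F` and `B` are the visited vertices (a vertex may be
in both), `outPtr u` and `inPtr z` the still untraversed parts of the outgoing list of `u ∈ F` and
of the incoming list of `z ∈ B`, `FA`, `FP`, `BA`, `BP` the active and passive forward and backward
vertices, and `s` is the soft threshold. -/
structure Search (n : ℕ) where
  v : Fin n
  w : Fin n
  src : Fin n
  dst : Fin n
  F : List (Fin n)
  B : List (Fin n)
  outPtr : Fin n → List (Arc n)
  inPtr : Fin n → List (Arc n)
  FA : List (Fin n)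
  FP : List (Fin n)
  BA : List (Fin n)
  BP : List (Fin n)
  s : Fin n

/-- The state of the whole computation: the arcs added so far, the arcs still to be added, the
memory, the search under way (`none` between two additions), and the list of all thresholds chosen
so far, the last one first (it only serves to let choices depend on the past). -/
structure Config (n : ℕ) where
  added : List (Arc n)
  todo : List (Arc n)
  store : Store n
  search : Option (Search n)
  log : List (Fin n)

/-- All decisions that the algorithm leaves open, as functions of the present state:
`pair` chooses `u ∈ FA` and `z ∈ BA` in an iteration of the search, `threshold` is the probability
distribution of the new `s`, given the list of candidates, and `arrange` lists a set of vertices in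
topological order. -/
structure Policy (n : ℕ) where
  pair : Config n → Fin n × Fin n
  threshold : Config n → List (Fin n) → PMF (Fin n)
  arrange : Config n → List (Fin n) → List (Fin n)

namespace Policy

variable {n : ℕ}

/-- The choices are legal ones. -/
structure Valid (pol : Policy n) : Prop where
  pair_mem : ∀ (c : Config n) (S : Search n), c.search = some S → S.FA ≠ [] → S.BA ≠ [] →
    (pol.pair c).1 ∈ S.FA ∧ (pol.pair c).2 ∈ S.BA
  threshold_mem : ∀ (c : Config n) (P : List (Fin n)), P ≠ [] → ∀ s ∈ (pol.threshold c P).support, s ∈ P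
  arrange_perm : ∀ (c : Config n) (l : List (Fin n)), (pol.arrange c l).Perm l
  arrange_topological : ∀ (c : Config n) (l : List (Fin n)), (∃ l' : List (Fin n), l'.Perm l ∧ c.store.IsTopological l') →
    c.store.IsTopological (pol.arrange c l)

/-- Each new threshold is an `ε`-approximate median of its `k` candidates: at least `ε * k` of them
are not after it and at least `ε * k` are not before it. For `ε = 1/2` these are the medians. -/
def ApproxMedian (pol : Policy n) (ε : ℝ) : Prop :=
  ∀ (c : Config n) (P : List (Fin n)), P ≠ [] → ∀ s ∈ (pol.threshold c P).support,
    s ∈ P ∧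
    ε * P.length ≤ (P.filter fun x => c.store.le x s).length ∧
    ε * P.length ≤ (P.filter fun x => c.store.le s x).length

/-- Each new threshold is chosen uniformly at random from its candidates. -/
def Uniform (pol : Policy n) : Prop :=
  ∀ (c : Config n) (P : List (Fin n)), ∀ h : P.toFinset.Nonempty, pol.threshold c P = PMF.uniformOfFinset P.toFinset h

end Policy

section Steps

variable {n : ℕ}

/-- Start a search for the arc `(v, w)`. -/
def startSearch (σ : Store n) (v w : Fin n) : Search n where
  v := v
  w := w
  src := σ.f w
  dst := σ.f v
  F := [σ.f w]
  B := [σ.f v]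
  outPtr := σ.out
  inPtr := σ.inn
  FA := if σ.out (σ.f w) = [] then [] else [σ.f w]
  FP := []
  BA := if σ.inn (σ.f v) = [] then [] else [σ.f v]
  BP := []
  s := σ.f v

/-- The forward half of a search step, which traverses the next arc `(q, g)` out of `u`. A loop is
deleted from the list in which it is met. -/
def forwardStep (u : Fin n) (σ : Store n) (S : Search n) : Store n × Search n :=
  match S.outPtr u with
  | [] => (σ, S)
  | (q, g) :: rest =>
    let σ := σ.find g
    let x := σ.f g
    let S := { S with
      outPtr := Function.update S.outPtr u rest
      FA := if rest = [] then S.FA.erase u else S.FA }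
    let σ := if u = x then
        { σ with out := Function.update σ.out u ((σ.out u).erase (q, g)) } else σ
    if x ∈ S.F then (σ, S) else
      (σ, { S with
        F := x :: S.F
        outPtr := Function.update S.outPtr x (σ.out x)
        FA := if σ.out x = [] then S.FA else x :: S.FA })

/-- The backward half of a search step, which traverses the next arc `(h, r)` into `z`. -/
def backwardStep (z : Fin n) (σ : Store n) (S : Search n) : Store n × Search n :=
  match S.inPtr z with
  | [] => (σ, S)
  | (h, r) :: rest =>
    let σ := σ.find h
    let y := σ.f h
    let S := { S with
      inPtr := Function.update S.inPtr z rest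
      BA := if rest = [] then S.BA.erase z else S.BA }
    let σ := if y = z then
        { σ with inn := Function.update σ.inn z ((σ.inn z).erase (h, r)) } else σ
    if y ∈ S.B then (σ, S) else
      (σ, { S with
        B := y :: S.B
        inPtr := Function.update S.inPtr y (σ.inn y)
        BA := if σ.inn y = [] then S.BA else y :: S.BA })

/-- The body of the while loop up to the changes of the threshold: a search step if `u < z`;
otherwise `u` becomes passive if `u > s`, and `z` becomes passive if `z < s`. In the only remaining
case `u = z = s`, `u` becomes passive. -/
def advance (u z : Fin n) (σ : Store n) (S : Search n) : Store n × Search n :=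
  if σ.lt u z then
    let p := forwardStep u (σ.tick 1) S
    backwardStep z p.1 p.2
  else
    let S := if σ.lt S.s u ∨ (u = z ∧ u = S.s) then
        { S with FA := S.FA.erase u, FP := u :: S.FP } else S
    let S := if σ.lt z S.s then
        { S with BA := S.BA.erase z, BP := z :: S.BP } else S
    (σ.tick 1, S)

/-- The block executed when `FA` has become empty. Besides the passive vertices that die, one unit
is charged per candidate for choosing the new `s` and for splitting the list of candidates. -/
noncomputable def forwardChange (choose : List (Fin n) → PMF (Fin n))
    (p : Store n × Search n) : PMF (Store n × Search n × List (Fin n)) :=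
  let σ := p.1
  let S := p.2
  if S.FA = [] then
    let σ := σ.tick (1 + S.FP.length + S.BP.length)
    let S := { S with BP := [], BA := S.BA.erase S.s }
    if S.FP = [] then PMF.pure (σ, S, [])
    else (choose S.FP).map fun s =>
      (σ, { S with
            s := s
            FA := S.FP.filter fun x => σ.le x s
            FP := S.FP.filter fun x => ¬ σ.le x s }, [s])
  else PMF.pure (σ, S, [])

/-- The block executed when `BA` has become empty. -/
noncomputable def backwardChange (choose : List (Fin n) → PMF (Fin n))
    (p : Store n × Search n) : PMF (Store n × Search n × List (Fin n)) :=
  let σ := p.1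
  let S := p.2
  if S.BA = [] then
    let σ := σ.tick (1 + S.FP.length + S.BP.length)
    let S := { S with FP := [], FA := S.FA.erase S.s }
    if S.BP = [] then PMF.pure (σ, S, [])
    else (choose S.BP).map fun s =>
      (σ, { S with
            s := s
            BA := S.BP.filter fun x => σ.le s x
            BP := S.BP.filter fun x => ¬ σ.le s x }, [s])
  else PMF.pure (σ, S, [])

/-- One iteration of the while loop of the search. -/
noncomputable def iteration (pol : Policy n) (c : Config n) (S : Search n) : PMF (Config n) :=
  (forwardChange (pol.threshold c) (advance (pol.pair c).1 (pol.pair c).2 c.store S)).bind fun p =>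
    (backwardChange (pol.threshold c) (p.1, p.2.1)).map fun q =>
      { c with store := q.1, search := some q.2.1, log := q.2.2 ++ p.2.2 ++ c.log }

/-- `t = min ({f(v)} ∪ {x ∈ F | x has an untraversed outgoing arc})`. -/
def pivot (σ : Store n) (S : Search n) : Fin n :=
  S.F.foldl (fun t x => if S.outPtr x ≠ [] ∧ σ.lt x t then x else t) S.dst

/-- The forward vertices before `t`. -/
def forwardSet (σ : Store n) (S : Search n) : List (Fin n) :=
  S.F.filter fun x => σ.lt x (pivot σ S)

/-- The backward vertices after `t`. -/
def backwardSet (σ : Store n) (S : Search n) : List (Fin n) :=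
  S.B.filter fun y => σ.lt (pivot σ S) y

/-- The vertex set of the graph in which the new component is sought. -/
def subgraphVertices (σ : Store n) (S : Search n) : List (Fin n) :=
  forwardSet σ S ++ pivot σ S :: backwardSet σ S

/-- The adjacency of the graph in which the new component is sought: its arcs come from the arcs
out of the components in `forwardSet` and into the components in `backwardSet`, without loops. -/
def subgraphAdj (σ : Store n) (S : Search n) (x y : Fin n) : Prop :=
  x ≠ y ∧ x ∈ subgraphVertices σ S ∧ y ∈ subgraphVertices σ S ∧
    ((x ∈ forwardSet σ S ∧ ∃ a ∈ σ.out x, σ.f a.2 = y) ∨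
     (y ∈ backwardSet σ S ∧ ∃ a ∈ σ.inn y, σ.f a.1 = x))

open Classical in
/-- The old components that make up the new component: those on paths from `f(w)` to `f(v)` in the
subgraph. The list is empty if there is no such path. -/
noncomputable def newComponent (σ : Store n) (S : Search n) : List (Fin n) :=
  (subgraphVertices σ S).filter fun x =>
    Relation.ReflTransGen (subgraphAdj σ S) S.src x ∧
    Relation.ReflTransGen (subgraphAdj σ S) x S.dst

/-- All vertices whose canonical vertices are needed to form the subgraph: the heads of the arcs
out of `forwardSet` and the tails of the arcs into `backwardSet`. -/
def subgraphEnds (σ : Store n) (S : Search n) : List (Fin n) :=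
  ((forwardSet σ S).flatMap fun x => (σ.out x).map Prod.snd) ++
  ((backwardSet σ S).flatMap fun y => (σ.inn y).map Prod.fst)

/-- The list after moving the vertices of `Fs` (a listing of `forwardSet`) and `Bs` (a listing of
`backwardSet`): `Fs` goes just after `t` if `t = f(v)`; otherwise `Fs` goes just before `t`
and `Bs` just before `Fs`. -/
def reorder (order Fs Bs : List (Fin n)) (t dst : Fin n) : List (Fin n) :=
  let rest := order.filter fun x => x ∉ Fs ∧ x ∉ Bs
  let before := rest.takeWhile fun x => x ≠ t
  let after := (rest.dropWhile fun x => x ≠ t).tail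
  if t = dst then before ++ t :: (Fs ++ after) else before ++ Bs ++ Fs ++ t :: after

/-- What is done when a search has stopped: form the subgraph and the new component, reorder,
delete from the list the vertices that are no longer canonical, unite the old components, and enter
the arc. The static linear-time algorithms (new component; topological order of `forwardSet` and
`backwardSet`) are charged one unit per vertex and arc of the subgraph. -/
noncomputable def finish (pol : Policy n) (c : Config n) (S : Search n) : Store n :=
  let σ := c.store
  let t := pivot σ S
  let Fl := forwardSet σ S
  let Bg := backwardSet σ S
  let ends := subgraphEnds σ S
  let K := newComponent σ S
  let size := (subgraphVertices σ S).length + ends.length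
  -- computing the pivot and the two sets, and later unmarking
  let σ₁ := σ.tick (1 + S.F.length + S.B.length)
  -- forming the subgraph, finding the new component, sorting topologically
  let σ₂ := (σ₁.findAll ends).tick (size + size + size)
  -- moving vertices, then deleting vertices, in the dynamic ordered list
  let σ₃ := { σ₂ with
    order := (reorder σ.order (pol.arrange c Fl) (pol.arrange c Bg) t S.dst).filter
      fun x => x ∉ K ∨ x = S.dst }.tick (Fl.length + Bg.length + K.length)
  -- uniting the old components, with canonical vertex `f(v)`
  let σ₄ := (K.filter fun x => x ≠ S.dst).foldl (fun σ x => σ.unite S.dst x) σ₃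
  σ₄.insertArc S.v S.w

/-- One step of the computation. Between two additions, take the next arc `(v, w)`: if
`f(w) < f(v)`, start a search, and otherwise just enter the arc. During a search, do an iteration
of the while loop if `FA` and `BA` are not empty, and otherwise finish the addition. -/
noncomputable def step (pol : Policy n) (c : Config n) : PMF (Config n) :=
  match c.search, c.todo with
  | none, [] => PMF.pure c
  | none, (v, w) :: rest =>
    let σ := ((c.store.find v).find w).tick 1
    if σ.lt (σ.f w) (σ.f v) then
      PMF.pure { c with store := σ, search := some (startSearch σ v w) }
    else
      PMF.pure { c with
        added := c.added ++ [(v, w)], todo := rest, store := σ.insertArc v w }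
  | some S, rest =>
    if S.FA = [] ∨ S.BA = [] then
      PMF.pure { c with
        added := c.added ++ [(S.v, S.w)]
        todo := rest.tail
        store := finish pol c S
        search := none }
    else iteration pol c S

/-- The initial state, for a given sequence of arcs to be added. -/
def start (arcs : List (Arc n)) : Config n where
  added := []
  todo := arcs
  store := Store.init n
  search := none
  log := []

/-- The distribution of the state after `N` steps (a final state is never left). -/
noncomputable def run (pol : Policy n) (arcs : List (Arc n)) : ℕ → PMF (Config n)
  | 0 => PMF.pure (start arcs)
  | N + 1 => (run pol arcs N).bind (step pol)

/-- All arcs have been added. -/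
def Config.IsFinal (c : Config n) : Prop := c.todo = [] ∧ c.search = none

/-- `y` is reachable from `x` by arcs of the list. -/
def Reach (arcs : List (Arc n)) : Fin n → Fin n → Prop :=
  Relation.ReflTransGen fun x y => (x, y) ∈ arcs

/-- The memory correctly represents the strong components of the graph with the given arcs:
`f` maps vertices to the same vertex if and only if they are in the same component, its value is a
vertex of that component, and `order` lists every canonical vertex once, in a topological order of
the graph of strong components. -/
structure Store.Correct (σ : Store n) (arcs : List (Arc n)) : Prop where
  component : ∀ x y, σ.f x = σ.f y ↔ Reach arcs x y ∧ Reach arcs y x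
  canonical : ∀ x, Reach arcs x (σ.f x) ∧ Reach arcs (σ.f x) x
  order_nodup : σ.order.Nodup
  mem_order : ∀ x, x ∈ σ.order ↔ ∃ y, σ.f y = x
  topological : ∀ x y, (x, y) ∈ arcs → σ.f x ≠ σ.f y → σ.lt (σ.f x) (σ.f y)

end Steps

end StrongComp

/-!
*Correctness.* During a search the map `f` and the order of the list do not change. Every vertex of
`F` is reachable from `f(w)`, `f(v)` is reachable from every vertex of `B`, and the arcs already
traversed lead to vertices that have been visited. When the search stops, there are no `x ∈ F` with
an untraversed outgoing arc and `y ∈ B` with an untraversed incoming arc such that `x < y`: call a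
vertex alive while it is active or passive. A vertex with untraversed arcs ceases to be alive only
when everything still alive in the other direction is on the wrong side of it (`Cross`,
`SearchAlive.stopped`). Hence all of `F` before the pivot `t` and all of `B` after `t` are fully
explored, so that the subgraph contains all paths from `f(w)` to `f(v)`
(`Stopped.mem_newComponent`), and the reordered list is topological (`Stopped.before_reorder`,
`Stopped.before_reorder_new`).

*Search steps.* A search step traverses an arc out of `u` and an arc into `z` with `u < z`. Let a
search make `k` steps. For any two of them, with arcs `(e₁, e₂)` and `(g₁, g₂)`, the tail of `e₁` is
before the head of `g₂` or the tail of `g₁` is before the head of `e₂`. The new arc makes the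
backward arc lead to the forward arc, and the order shows that it did not do so before. So at least
`k ^ 2 / 2` pairs of arcs become related (`SearchCore.sq_le_card_related`). There are `m ^ 2` pairs,
and `2 * k ≤ k ^ 2 / √m + √m` turns this into `O(m ^ (3 / 2))` search steps
(`reserve_append_search_le`).

*The rest of a search.* The potential `pot` charges `A` units to every active or passive vertex,
less those that are certain to cease to be alive when the threshold changes next. A change of the
threshold takes time linear in the number of candidates, and after it at least the smaller one of
the numbers of candidates not after and not before the new threshold are certain to cease to be
alive at the following change (`pot_change`). If this is, in the worst case or on average, a fixed
fraction of the candidates, a suitable `A` pays for the change (`Fair`, `iteration_drift`).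
Approximate medians satisfy this by definition, and for a random candidate the average is at least
`k / 6` (`sq_le_sum_min`). For an arbitrary choice the threshold itself is such a vertex, so that `A
= 4 * n` suffices, and a time bound follows, though a poor one. It implies termination, since every
step takes time.

*Finds.* With union by rank, a potential that counts `log₂ n` less the rank of the parent for every
vertex makes the amortized time of a find at most `2` (`Forest.Ranked.length_path_add_slack_le`),
after an initial investment of `n * log₂ n = O(m ^ (3 / 2))`.

The total of time and potentials is a supermartingale (`step_drift`). The worst case and the
expectation are treated at once: the supremum over the support and the expected value share the only
properties that are used (`Averaging`).
-/

/-! ### Disjoint set forests -/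

namespace StrongComp

namespace Forest

variable {n : ℕ}

/-- Ranks increase along parent pointers and are at most `log₂ n`. -/
structure Ranked (d : Forest n) : Prop where
  rank_lt : ∀ x, d.parent x ≠ x → d.rank x < d.rank (d.parent x)
  two_pow_rank_le : ∀ x, 2 ^ d.rank x ≤ n

/-- The number of nodes in the tree with root `r`. -/
def treeSize (d : Forest n) (r : Fin n) : ℕ := (Finset.univ.filter fun y => d.root y = r).card

/-- The invariant of a disjoint set forest: in addition to `Ranked`, the tree of a root of rank `k`
has at least `2 ^ k` nodes, and the canonical vertex of a set belongs to the set. -/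
structure WF (d : Forest n) : Prop extends Ranked d where
  two_pow_rank_le_treeSize : ∀ r, d.parent r = r → 2 ^ d.rank r ≤ d.treeSize r
  root_name : ∀ r, d.parent r = r → d.root (d.name r) = r

lemma Ranked.rank_lt_card {d : Forest n} (h : d.Ranked) (x : Fin n) : d.rank x < n :=
  Nat.lt_two_pow_self.trans_le (h.two_pow_rank_le x)

lemma Ranked.parent_root {d : Forest n} (h : d.Ranked) (x : Fin n) :
    d.parent (d.root x) = d.root x := by
  have key : ∀ k, d.parent (d.parent^[k] x) = d.parent^[k] x ∨ k ≤ d.rank (d.parent^[k] x) := by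
    intro k
    induction k with
    | zero => right; exact Nat.zero_le _
    | succ k ih =>
      rw [Function.iterate_succ_apply']
      by_cases hk : d.parent (d.parent^[k] x) = d.parent^[k] x
      · left; rw [hk, hk]
      · right
        have := h.rank_lt _ hk
        rcases ih with h1 | h1
        · exact absurd h1 hk
        · omega
  rcases key n with h1 | h1
  · exact h1
  · exact absurd (h.rank_lt_card (d.parent^[n] x)) (by omega)

lemma root_eq_self {d : Forest n} {x : Fin n} (hx : d.parent x = x) : d.root x = x :=
  Function.iterate_fixed hx n

lemma Ranked.root_parent {d : Forest n} (h : d.Ranked) (x : Fin n) :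
    d.root (d.parent x) = d.root x := by
  have : d.root (d.parent x) = d.parent (d.root x) := by
    unfold root
    rw [← Function.iterate_succ_apply, Function.iterate_succ_apply']
  rw [this, h.parent_root]

lemma Ranked.root_root {d : Forest n} (h : d.Ranked) (x : Fin n) : d.root (d.root x) = d.root x :=
  root_eq_self (h.parent_root x)

/-- A function that is constant along parent pointers and fixes the roots is `root`. -/
lemma Ranked.root_unique {d : Forest n} (h : d.Ranked) (g : Fin n → Fin n)
    (hp : ∀ x, g (d.parent x) = g x) (hr : ∀ x, d.parent x = x → g x = x) (x : Fin n) :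
    d.root x = g x := by
  have key : ∀ k, g (d.parent^[k] x) = g x := by
    intro k
    induction k with
    | zero => rfl
    | succ k ih => rw [Function.iterate_succ_apply', hp, ih]
  rw [← key n]
  exact (hr _ (h.parent_root x)).symm

lemma Ranked.rank_le_rank_root {d : Forest n} (h : d.Ranked) (x : Fin n) :
    d.rank x ≤ d.rank (d.root x) := by
  have key : ∀ k, d.rank x ≤ d.rank (d.parent^[k] x) := by
    intro k
    induction k with
    | zero => exact le_rfl
    | succ k ih =>
      rw [Function.iterate_succ_apply']
      by_cases hk : d.parent (d.parent^[k] x) = d.parent^[k] x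
      · rw [hk]; exact ih
      · exact ih.trans (h.rank_lt _ hk).le
  exact key n

lemma Ranked.rank_parent_le_rank_root {d : Forest n} (h : d.Ranked) (x : Fin n) :
    d.rank (d.parent x) ≤ d.rank (d.root x) := by
  rw [← h.root_parent x]; exact h.rank_le_rank_root _

lemma Ranked.rank_lt_rank_root {d : Forest n} (h : d.Ranked) {x : Fin n} (hx : d.root x ≠ x) :
    d.rank x < d.rank (d.root x) := by
  have hp : d.parent x ≠ x := fun hp => hx (root_eq_self hp)
  exact (h.rank_lt x hp).trans_le (h.rank_parent_le_rank_root x)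

lemma Ranked.root_eq_of_mem_pathAux {d : Forest n} (h : d.Ranked) (k : ℕ) :
    ∀ {x y : Fin n}, y ∈ d.pathAux k x → d.root y = d.root x := by
  induction k with
  | zero => intro x y hy; simp only [pathAux, List.mem_singleton] at hy; rw [hy]
  | succ k ih =>
    intro x y hy
    rw [pathAux] at hy
    split_ifs at hy with hx
    · rw [List.mem_singleton.1 hy]
    · rcases List.mem_cons.1 hy with rfl | hy
      · rfl
      · rw [ih hy, h.root_parent]

lemma Ranked.root_eq_of_mem_path {d : Forest n} (h : d.Ranked) {x y : Fin n} (hy : y ∈ d.path x) :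
    d.root y = d.root x := h.root_eq_of_mem_pathAux n hy

lemma Ranked.rank_le_of_mem_pathAux {d : Forest n} (h : d.Ranked) (k : ℕ) :
    ∀ {x y : Fin n}, y ∈ d.pathAux k x → d.rank x ≤ d.rank y := by
  induction k with
  | zero => intro x y hy; simp only [pathAux, List.mem_singleton] at hy; rw [hy]
  | succ k ih =>
    intro x y hy
    rw [pathAux] at hy
    split_ifs at hy with hx
    · rw [List.mem_singleton.1 hy]
    · rcases List.mem_cons.1 hy with rfl | hy
      · exact le_rfl
      · exact (h.rank_lt x hx).le.trans (ih hy)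

lemma Ranked.nodup_pathAux {d : Forest n} (h : d.Ranked) (k : ℕ) :
    ∀ x : Fin n, (d.pathAux k x).Nodup := by
  induction k with
  | zero => intro x; simp [pathAux]
  | succ k ih =>
    intro x
    rw [pathAux]
    split_ifs with hx
    · simp
    · refine List.nodup_cons.2 ⟨fun hm => ?_, ih _⟩
      exact absurd (h.rank_le_of_mem_pathAux k hm) (not_le.2 (h.rank_lt x hx))

/-- All nodes of a path but the last two have a parent of smaller rank than the root. -/
lemma Ranked.length_pathAux_le {d : Forest n} (h : d.Ranked) (k : ℕ) :
    ∀ x : Fin n, (d.pathAux k x).length ≤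
      2 + ((d.pathAux k x).map fun y => d.rank (d.root x) - d.rank (d.parent y)).sum := by
  induction k with
  | zero => intro x; simp only [pathAux, List.length_singleton]; omega
  | succ k ih =>
    intro x
    rw [pathAux]
    split_ifs with hx
    · simp only [List.length_singleton]; omega
    · by_cases hr : d.parent (d.parent x) = d.parent x
      · have : d.pathAux k (d.parent x) = [d.parent x] := by
          cases k <;> simp [pathAux, hr]
        simp [this]
      · have h1 := ih (d.parent x)
        rw [h.root_parent] at h1
        have h2 := h.rank_lt _ hr
        have h3 := h.rank_parent_le_rank_root (d.parent x)
        rw [h.root_parent] at h3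
        simp only [List.length_cons, List.map_cons, List.sum_cons]
        omega

/-- The potential that pays for long find paths: compressing a path raises the rank of the parent of
each of its nodes but the last two. -/
def slack (d : Forest n) : ℕ := ∑ x, (Nat.log 2 n - d.rank (d.parent x))

lemma Ranked.compress {d : Forest n} (h : d.Ranked) (x : Fin n) : (d.compress x).Ranked where
  rank_lt y hy := by
    simp only [Forest.compress] at hy ⊢
    split_ifs at hy ⊢ with hm
    · rw [← h.root_eq_of_mem_path hm] at hy ⊢
      exact h.rank_lt_rank_root hy
    · exact h.rank_lt y hy
  two_pow_rank_le := h.two_pow_rank_le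

lemma Ranked.root_compress {d : Forest n} (h : d.Ranked) (x y : Fin n) :
    (d.compress x).root y = d.root y := by
  refine (h.compress x).root_unique d.root (fun y => ?_) (fun y hy => ?_) y
  · simp only [Forest.compress]
    split_ifs with hm
    · rw [h.root_root, h.root_eq_of_mem_path hm]
    · exact h.root_parent y
  · simp only [Forest.compress] at hy
    split_ifs at hy with hm
    · rw [← hy]; exact h.root_root x
    · exact root_eq_self hy

lemma Ranked.parent_eq_self_of_compress {d : Forest n} (h : d.Ranked) {x y : Fin n}
    (hy : (d.compress x).parent y = y) : d.parent y = y := by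
  have h1 := root_eq_self hy
  rw [h.root_compress] at h1
  rw [← h1]; exact h.parent_root y

lemma WF.compress {d : Forest n} (h : d.WF) (x : Fin n) : (d.compress x).WF where
  toRanked := h.toRanked.compress x
  two_pow_rank_le_treeSize r hr := by
    have := h.two_pow_rank_le_treeSize r (h.parent_eq_self_of_compress hr)
    simp only [treeSize, h.root_compress]
    exact this
  root_name r hr := by
    rw [h.root_compress]
    exact h.root_name r (h.parent_eq_self_of_compress hr)

lemma Ranked.canon_compress {d : Forest n} (h : d.Ranked) (x y : Fin n) :
    (d.compress x).canon y = d.canon y := by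
  unfold canon
  rw [h.root_compress]
  rfl

lemma Ranked.rank_le_log {d : Forest n} (h : d.Ranked) (x : Fin n) : d.rank x ≤ Nat.log 2 n :=
  Nat.le_log_of_pow_le one_lt_two (h.two_pow_rank_le x)

/-- A find costs two units, apart from what the potential pays. -/
lemma Ranked.length_path_add_slack_le {d : Forest n} (h : d.Ranked) (x : Fin n) :
    (d.path x).length + (d.compress x).slack ≤ 2 + d.slack := by
  have h1 : (d.path x).length ≤
      2 + ((d.path x).map fun y => d.rank (d.root x) - d.rank (d.parent y)).sum :=
    h.length_pathAux_le n x
  have h2 : ((d.path x).map fun y => d.rank (d.root x) - d.rank (d.parent y)).sum =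
      ∑ y, if y ∈ d.path x then d.rank (d.root x) - d.rank (d.parent y) else 0 := by
    rw [path, ← List.sum_toFinset _ (h.nodup_pathAux n x), ← Finset.sum_filter]
    refine Finset.sum_congr ?_ fun _ _ => rfl
    ext y; simp
  have h3 : (∑ y, if y ∈ d.path x then d.rank (d.root x) - d.rank (d.parent y) else 0) +
      (d.compress x).slack ≤ d.slack := by
    unfold slack
    rw [← Finset.sum_add_distrib]
    refine Finset.sum_le_sum fun y _ => ?_
    simp only [Forest.compress]
    split_ifs with hm
    · have := h.rank_le_log (d.root x)
      have := h.rank_parent_le_rank_root y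
      rw [h.root_eq_of_mem_path hm] at this
      omega
    · omega
  omega

lemma treeSize_add_treeSize_le (d : Forest n) {r p : Fin n} (hrp : r ≠ p) :
    d.treeSize r + d.treeSize p ≤ n := by
  unfold treeSize
  rw [← Finset.card_union_of_disjoint]
  · exact (Finset.card_le_univ _).trans (by simp)
  · rw [Finset.disjoint_filter]
    intro y _ h1 h2
    exact hrp (h1.symm.trans h2)

/-- The forest after making the root `r` a child of the root `p`, with new ranks `rk`, where `x`
becomes the canonical vertex of the union. -/
def attach (d : Forest n) (r p x : Fin n) (rk : Fin n → ℕ) : Forest n where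
  parent := Function.update d.parent r p
  rank := rk
  name := Function.update d.name p x

section attach

variable {d : Forest n} {r p x : Fin n} {rk : Fin n → ℕ}

lemma WF.attach_ranked (h : d.WF) (hp : d.parent p = p) (hrp : r ≠ p)
    (hrk : ∀ y, y ≠ p → rk y = d.rank y) (hrp' : d.rank r < rk p) (hle : d.rank p ≤ rk p)
    (hsz : 2 ^ rk p ≤ d.treeSize r + d.treeSize p) : (d.attach r p x rk).Ranked where
  rank_lt y hy := by
    simp only [attach, Function.update_apply] at hy ⊢
    split_ifs at hy ⊢ with hyr
    · rw [hyr, hrk r hrp]; exact hrp'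
    · have h1 := h.rank_lt y hy
      have hyp : y ≠ p := by rintro rfl; exact hy hp
      rw [hrk y hyp]
      by_cases hq : d.parent y = p
      · rw [hq] at h1 ⊢; omega
      · rw [hrk _ hq]; exact h1
  two_pow_rank_le y := by
    simp only [attach]
    by_cases hy : y = p
    · rw [hy]; exact hsz.trans (d.treeSize_add_treeSize_le hrp)
    · rw [hrk y hy]; exact h.two_pow_rank_le y

lemma WF.root_attach (h : d.WF) (hR : (d.attach r p x rk).Ranked) (hr : d.parent r = r)
    (hp : d.parent p = p) (hrp : r ≠ p) (z : Fin n) :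
    (d.attach r p x rk).root z = if d.root z = r then p else d.root z := by
  refine hR.root_unique (fun z => if d.root z = r then p else d.root z) (fun y => ?_)
    (fun y hy => ?_) z
  · simp only [attach, Function.update_apply]
    by_cases hy : y = r
    · subst hy
      simp [root_eq_self hr, root_eq_self hp, hrp.symm]
    · simp only [hy, if_false, h.root_parent]
  · simp only [attach, Function.update_apply] at hy
    split_ifs at hy with hyr
    · exact absurd (hyr.symm.trans hy.symm) hrp
    · simp [root_eq_self hy, hyr]

lemma WF.attach (h : d.WF) (hr : d.parent r = r) (hp : d.parent p = p) (hrp : r ≠ p)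
    (hrk : ∀ y, y ≠ p → rk y = d.rank y) (hrp' : d.rank r < rk p) (hle : d.rank p ≤ rk p)
    (hsz : 2 ^ rk p ≤ d.treeSize r + d.treeSize p) (hx : d.root x = r ∨ d.root x = p) :
    (d.attach r p x rk).WF ∧
    (∀ z, (d.attach r p x rk).canon z = if d.root z = r ∨ d.root z = p then x else d.canon z) ∧
    (d.attach r p x rk).slack ≤ d.slack := by
  have hR : (d.attach r p x rk).Ranked := h.attach_ranked hp hrp hrk hrp' hle hsz
  have hroot := h.root_attach hR hr hp hrp
  have hpar : ∀ y, (d.attach r p x rk).parent y = y → y ≠ r ∧ d.parent y = y := by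
    intro y hy
    simp only [Forest.attach, Function.update_apply] at hy
    split_ifs at hy with hyr
    · exact absurd (hyr.symm.trans hy.symm) hrp
    · exact ⟨hyr, hy⟩
  refine ⟨⟨hR, fun y hy => ?_, fun y hy => ?_⟩, fun z => ?_, ?_⟩
  · obtain ⟨hyr, hy⟩ := hpar y hy
    by_cases hyp : y = p
    · subst hyp
      refine hsz.trans ?_
      unfold treeSize
      rw [← Finset.card_union_of_disjoint]
      · refine Finset.card_le_card fun z hz => ?_
        simp only [Finset.mem_union, Finset.mem_filter, Finset.mem_univ, true_and] at hz ⊢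
        rw [hroot]
        rcases hz with hz | hz <;> simp [hz]
      · rw [Finset.disjoint_filter]
        intro z _ h1 h2
        exact hrp (h1.symm.trans h2)
    · have : (d.attach r p x rk).rank y = d.rank y := hrk y hyp
      rw [this]
      refine (h.two_pow_rank_le_treeSize y hy).trans ?_
      refine Finset.card_le_card fun z hz => ?_
      simp only [Finset.mem_filter, Finset.mem_univ, true_and] at hz ⊢
      rw [hroot, hz, if_neg hyr]
  · obtain ⟨hyr, hy⟩ := hpar y hy
    rw [hroot]
    simp only [Forest.attach, Function.update_apply]
    by_cases h1 : y = p
    · rcases hx with hx | hx <;> simp [h1, hx, hrp.symm]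
    · simp [h1, h.root_name y hy, hyr]
  · simp only [canon, hroot]
    simp only [Forest.attach, Function.update_apply]
    by_cases h1 : d.root z = r <;> simp [h1]
  · unfold slack
    refine Finset.sum_le_sum fun y _ => Nat.sub_le_sub_left ?_ _
    simp only [Forest.attach, Function.update_apply]
    have key : ∀ y, d.rank y ≤ rk y := fun y => by
      by_cases hy : y = p
      · rw [hy]; exact hle
      · rw [hrk y hy]
    split_ifs with hy
    · rw [hy, hr]; exact hrp'.le
    · exact key _

end attach

/-- Linking two different trees. -/
lemma WF.link {d : Forest n} (h : d.WF) {x y : Fin n} (hxy : d.root x ≠ d.root y) :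
    (d.link x y).WF ∧
    (∀ z, (d.link x y).canon z =
      if d.root z = d.root y ∨ d.root z = d.root x then x else d.canon z) ∧
    (d.link x y).slack ≤ d.slack := by
  have hx := h.parent_root x
  have hy := h.parent_root y
  have sx := h.two_pow_rank_le_treeSize _ hx
  have sy := h.two_pow_rank_le_treeSize _ hy
  by_cases hlt : d.rank (d.root x) < d.rank (d.root y)
  · have : d.link x y = d.attach (d.root x) (d.root y) x d.rank := by
      simp [Forest.link, hlt, Forest.attach]
    rw [this]
    have := h.attach (x := x) (rk := d.rank) hx hy hxy (fun _ _ => rfl) hlt le_rfl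
      (sy.trans (Nat.le_add_left _ _)) (Or.inl rfl)
    simpa only [or_comm] using this
  · by_cases heq : d.rank (d.root x) = d.rank (d.root y)
    · have : d.link x y = d.attach (d.root y) (d.root x) x
          (Function.update d.rank (d.root x) (d.rank (d.root x) + 1)) := by
        simp [Forest.link, heq, Forest.attach]
      rw [this]
      refine h.attach hy hx hxy.symm (fun z hz => by simp [hz]) (by simp [heq]) (by simp) ?_
        (Or.inr rfl)
      simp only [Function.update_self, pow_succ]
      rw [← heq] at sy
      omega
    · have : d.link x y = d.attach (d.root y) (d.root x) x d.rank := by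
        simp [Forest.link, hlt, heq, Forest.attach]
      rw [this]
      exact h.attach hy hx hxy.symm (fun _ _ => rfl) (by omega) le_rfl
        (sx.trans (Nat.le_add_left _ _)) (Or.inr rfl)

lemma WF.root_canon {d : Forest n} (h : d.WF) (x : Fin n) : d.root (d.canon x) = d.root x :=
  h.root_name _ (h.parent_root x)

/-- Linking the sets of two different canonical vertices `x` and `y`. -/
lemma WF.canon_link {d : Forest n} (h : d.WF) {x y : Fin n} (hx : d.canon x = x)
    (hy : d.canon y = y) (hxy : x ≠ y) :
    (d.link x y).WF ∧ (∀ z, (d.link x y).canon z = if d.canon z = y then x else d.canon z) ∧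
    (d.link x y).slack ≤ d.slack := by
  have hiff : ∀ z w, d.canon w = w → (d.root z = d.root w ↔ d.canon z = w) := by
    intro z w hw
    constructor
    · intro h1; rw [← hw]; unfold canon; rw [h1]
    · intro h1; rw [← h1, h.root_canon]
  have hne : d.root x ≠ d.root y := fun he => by
    rw [hiff x y hy, hx] at he; exact hxy he
  obtain ⟨h1, h2, h3⟩ := h.link hne
  refine ⟨h1, fun z => ?_, h3⟩
  simp only [h2, hiff z y hy, hiff z x hx]
  by_cases hz : d.canon z = y
  · simp [hz]
  · by_cases hz' : d.canon z = x
    · simp [hz']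
    · simp [hz, hz']

end Forest

end StrongComp

/-! ### The memory -/

namespace StrongComp

/-- The total length of a family of arc lists. -/
def total {n : ℕ} (L : Fin n → List (Arc n)) : ℕ := ∑ x, (L x).length

lemma total_update {n : ℕ} (L : Fin n → List (Arc n)) (u : Fin n) (l : List (Arc n)) :
    total (Function.update L u l) + (L u).length = total L + l.length := by
  unfold total
  rw [← Finset.add_sum_erase _ _ (Finset.mem_univ u),
    ← Finset.add_sum_erase _ (fun x => (L x).length) (Finset.mem_univ u), Function.update_self]
  have : ∑ x ∈ Finset.univ.erase u, (Function.update L u l x).length =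
      ∑ x ∈ Finset.univ.erase u, (L x).length :=
    Finset.sum_congr rfl fun x hx => by rw [Function.update_of_ne (Finset.ne_of_mem_erase hx)]
  omega

namespace Store

variable {n : ℕ}

/-- The time used so far together with the potential of the disjoint set forest. -/
def cost (σ : Store n) : ℕ := σ.time + σ.sets.slack

/-- `σ'` results from `σ` by operations of amortized cost at most `k` that change nothing but the
shape of the disjoint set forest. -/
structure Refresh (σ σ' : Store n) (k : ℕ) : Prop where
  wf : σ'.sets.WF
  f_eq : σ'.f = σ.f
  out_eq : σ'.out = σ.out
  inn_eq : σ'.inn = σ.inn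
  order_eq : σ'.order = σ.order
  cost_le : σ'.cost ≤ σ.cost + k

lemma Refresh.trans {σ σ' σ'' : Store n} {k l : ℕ} (h : Refresh σ σ' k) (h' : Refresh σ' σ'' l) :
    Refresh σ σ'' (k + l) where
  wf := h'.wf
  f_eq := h'.f_eq.trans h.f_eq
  out_eq := h'.out_eq.trans h.out_eq
  inn_eq := h'.inn_eq.trans h.inn_eq
  order_eq := h'.order_eq.trans h.order_eq
  cost_le := by have := h.cost_le; have := h'.cost_le; omega

lemma refresh_tick {σ : Store n} (h : σ.sets.WF) (k : ℕ) : Refresh σ (σ.tick k) k :=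
  ⟨h, rfl, rfl, rfl, rfl, by simp only [cost, tick]; omega⟩

lemma refresh_find {σ : Store n} (h : σ.sets.WF) (x : Fin n) : Refresh σ (σ.find x) 2 where
  wf := h.compress x
  f_eq := funext fun y => h.toRanked.canon_compress x y
  out_eq := rfl
  inn_eq := rfl
  order_eq := rfl
  cost_le := by
    have := h.toRanked.length_path_add_slack_le x
    simp only [cost, find, tick]
    omega

lemma refresh_findAll {σ : Store n} (h : σ.sets.WF) (l : List (Fin n)) :
    Refresh σ (σ.findAll l) (2 * l.length) := by
  induction l generalizing σ with
  | nil => exact ⟨h, rfl, rfl, rfl, rfl, by simp [findAll]⟩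
  | cons x l ih =>
    have h1 := refresh_find h x
    have h2 := h1.trans (ih h1.wf)
    have : 2 + 2 * l.length = 2 * (x :: l).length := by simp only [List.length_cons]; omega
    rw [this] at h2
    exact h2

/-- The arc lists are stored with the right canonical vertices and without repetition. -/
structure Lists (σ : Store n) : Prop where
  wf : σ.sets.WF
  f_of_mem_out : ∀ x, ∀ a ∈ σ.out x, σ.f a.1 = x
  f_of_mem_inn : ∀ x, ∀ a ∈ σ.inn x, σ.f a.2 = x
  nodup_out : ∀ x, (σ.out x).Nodup
  nodup_inn : ∀ x, (σ.inn x).Nodup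

lemma Lists.refresh {σ σ' : Store n} {k : ℕ} (h : σ.Lists) (r : Refresh σ σ' k) : σ'.Lists where
  wf := r.wf
  f_of_mem_out := by rw [r.f_eq, r.out_eq]; exact h.f_of_mem_out
  f_of_mem_inn := by rw [r.f_eq, r.inn_eq]; exact h.f_of_mem_inn
  nodup_out := by rw [r.out_eq]; exact h.nodup_out
  nodup_inn := by rw [r.inn_eq]; exact h.nodup_inn

/-- `σ'` results from `σ` by uniting components, with amortized cost at most `k`; the canonical
vertex `x` is replaced by `ρ x`. -/
structure Merge (σ σ' : Store n) (ρ : Fin n → Fin n) (k : ℕ) : Prop where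
  lists : σ'.Lists
  f_eq : ∀ z, σ'.f z = ρ (σ.f z)
  order_eq : σ'.order = σ.order
  mem_out : ∀ a, a ∈ σ'.out (σ'.f a.1) ↔ a ∈ σ.out (σ.f a.1)
  mem_inn : ∀ a, a ∈ σ'.inn (σ'.f a.2) ↔ a ∈ σ.inn (σ.f a.2)
  total_out : total σ'.out = total σ.out
  total_inn : total σ'.inn = total σ.inn
  cost_le : σ'.cost ≤ σ.cost + k

lemma total_concat (L : Fin n → List (Arc n)) {x y : Fin n} (hxy : x ≠ y) :
    total (Function.update (Function.update L x (L x ++ L y)) y []) = total L := by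
  have h1 := total_update L x (L x ++ L y)
  have h2 := total_update (Function.update L x (L x ++ L y)) y []
  rw [Function.update_of_ne hxy.symm] at h2
  simp only [List.length_append, List.length_nil] at h1 h2
  omega

/-- Concatenating the lists of `y` to those of `x`, for one of the two families of lists. -/
lemma concat_lists (L : Fin n → List (Arc n)) (g : Fin n → Fin n) (e : Arc n → Fin n)
    (hL : ∀ z, ∀ a ∈ L z, g (e a) = z) (hnd : ∀ z, (L z).Nodup) {x y : Fin n} (hxy : x ≠ y) :
    let L' := Function.update (Function.update L x (L x ++ L y)) y []
    let g' := fun z => if g z = y then x else g z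
    (∀ z, ∀ a ∈ L' z, g' (e a) = z) ∧ (∀ z, (L' z).Nodup) ∧
      ∀ a, a ∈ L' (g' (e a)) ↔ a ∈ L (g (e a)) := by
  refine ⟨fun z a ha => ?_, fun z => ?_, fun a => ?_⟩
  · simp only [Function.update_apply] at ha
    split_ifs at ha with h1 h2
    · simp at ha
    · rcases List.mem_append.1 ha with ha | ha
      · have := hL _ _ ha
        simp [this, hxy, h2]
      · have := hL _ _ ha
        simp [this, h2]
    · have := hL _ _ ha
      simp [this, h1]
  · simp only [Function.update_apply]
    split_ifs with h1 h2
    · simp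
    · refine List.Nodup.append (hnd x) (hnd y) fun a ha hb => ?_
      exact hxy ((hL _ _ ha).symm.trans (hL _ _ hb))
    · exact hnd z
  · by_cases h1 : g (e a) = y
    · simp only [h1, if_true, Function.update_of_ne hxy, Function.update_self, List.mem_append]
      refine ⟨fun h => h.resolve_left fun h2 => ?_, Or.inr⟩
      exact hxy ((hL _ _ h2).symm.trans h1)
    · simp only [h1, if_false, Function.update_of_ne h1]
      by_cases h2 : g (e a) = x
      · simp only [h2, Function.update_self, List.mem_append]
        refine ⟨fun h => h.resolve_right fun h3 => h1 (hL _ _ h3), Or.inl⟩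
      · rw [Function.update_of_ne h2]

lemma merge_unite {σ : Store n} (h : σ.Lists) {x y : Fin n} (hx : σ.f x = x) (hy : σ.f y = y)
    (hxy : x ≠ y) : Merge σ (σ.unite x y) (fun z => if z = y then x else z) 5 := by
  have r1 := refresh_find h.wf x
  have r := r1.trans (refresh_find r1.wf y)
  set τ := (σ.find x).find y with hτ
  have hf : ∀ z, τ.f z = σ.f z := fun z => by rw [r.f_eq]
  have hτL := h.refresh r
  obtain ⟨w1, w2, w3⟩ := hτL.wf.canon_link (x := x) (y := y) ((hf x).trans hx) ((hf y).trans hy) hxy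
  have hf' : (σ.unite x y).f = fun z => if σ.f z = y then x else σ.f z := by
    funext z
    have : (σ.unite x y).f z = (τ.sets.link x y).canon z := rfl
    rw [this, w2]
    have : τ.sets.canon z = σ.f z := hf z
    rw [this]
  have ho := concat_lists σ.out σ.f Prod.fst h.f_of_mem_out h.nodup_out hxy
  have hi := concat_lists σ.inn σ.f Prod.snd h.f_of_mem_inn h.nodup_inn hxy
  have eo : (σ.unite x y).out =
      Function.update (Function.update σ.out x (σ.out x ++ σ.out y)) y [] := rfl
  have ei : (σ.unite x y).inn =
      Function.update (Function.update σ.inn x (σ.inn x ++ σ.inn y)) y [] := rfl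
  refine ⟨⟨w1, ?_, ?_, ?_, ?_⟩, fun z => by rw [hf'], r.order_eq, ?_, ?_, ?_, ?_, ?_⟩
  · rw [hf', eo]; exact ho.1
  · rw [hf', ei]; exact hi.1
  · rw [eo]; exact ho.2.1
  · rw [ei]; exact hi.2.1
  · rw [hf', eo]; exact ho.2.2
  · rw [hf', ei]; exact hi.2.2
  · rw [eo]; exact total_concat _ hxy
  · rw [ei]; exact total_concat _ hxy
  · have h1 : (σ.unite x y).cost = τ.time + 1 + (τ.sets.link x y).slack := rfl
    have h2 := r.cost_le
    simp only [cost] at h1 h2 ⊢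
    omega

lemma merge_foldl_unite {x : Fin n} (l : List (Fin n)) : ∀ {σ : Store n}, σ.Lists →
    σ.f x = x → l.Nodup → (∀ y ∈ l, σ.f y = y ∧ y ≠ x) →
    Merge σ (l.foldl (fun σ y => σ.unite x y) σ) (fun z => if z ∈ l then x else z)
      (5 * l.length) := by
  induction l with
  | nil =>
    intro σ h hx _ _
    exact ⟨h, fun z => by simp, rfl, fun a => Iff.rfl, fun a => Iff.rfl, rfl, rfl, by simp⟩
  | cons y l ih =>
    intro σ h hx hnd hl
    obtain ⟨hyl, hnd⟩ := List.nodup_cons.1 hnd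
    have hy := hl y (by simp)
    have m := merge_unite h hx hy.1 hy.2.symm
    have m' := ih m.lists (by rw [m.f_eq, hx]; simp [hy.2.symm]) hnd fun z hz => by
      have hz' := hl z (by simp [hz])
      refine ⟨?_, hz'.2⟩
      rw [m.f_eq, hz'.1, if_neg]
      rintro rfl; exact hyl hz
    refine ⟨m'.lists, fun z => ?_, m'.order_eq.trans m.order_eq,
      fun a => (m'.mem_out a).trans (m.mem_out a), fun a => (m'.mem_inn a).trans (m.mem_inn a),
      m'.total_out.trans m.total_out, m'.total_inn.trans m.total_inn, ?_⟩
    · change (List.foldl _ (σ.unite x y) l).f z = _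
      rw [m'.f_eq, m.f_eq]
      by_cases h1 : σ.f z = y
      · simp [h1]
      · simp [h1]
    · have := m'.cost_le
      have := m.cost_le
      simp only [List.foldl_cons, List.length_cons]
      omega

/-- Entering a new arc into the lists. -/
structure Insert (σ σ' : Store n) (e : Arc n) : Prop where
  lists : σ'.Lists
  f_eq : σ'.f = σ.f
  order_eq : σ'.order = σ.order
  mem_out : ∀ a, a ∈ σ'.out (σ.f a.1) ↔ a = e ∨ a ∈ σ.out (σ.f a.1)
  mem_inn : ∀ a, a ∈ σ'.inn (σ.f a.2) ↔ a = e ∨ a ∈ σ.inn (σ.f a.2)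
  total_out : total σ'.out = total σ.out + 1
  total_inn : total σ'.inn = total σ.inn + 1
  cost_le : σ'.cost ≤ σ.cost + 5

lemma insert_lists (L : Fin n → List (Arc n)) (g : Fin n → Fin n) (p : Arc n → Fin n)
    (hL : ∀ z, ∀ a ∈ L z, g (p a) = z) (hnd : ∀ z, (L z).Nodup) {e : Arc n}
    (he : e ∉ L (g (p e))) :
    let L' := Function.update L (g (p e)) (e :: L (g (p e)))
    (∀ z, ∀ a ∈ L' z, g (p a) = z) ∧ (∀ z, (L' z).Nodup) ∧
      (∀ a, a ∈ L' (g (p a)) ↔ a = e ∨ a ∈ L (g (p a))) ∧ total L' = total L + 1 := by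
  refine ⟨fun z a ha => ?_, fun z => ?_, fun a => ?_, ?_⟩
  · simp only [Function.update_apply] at ha
    split_ifs at ha with h1
    · rcases List.mem_cons.1 ha with rfl | ha
      · exact h1.symm
      · rw [hL _ _ ha, h1]
    · exact hL _ _ ha
  · simp only [Function.update_apply]
    split_ifs with h1
    · exact List.nodup_cons.2 ⟨he, hnd _⟩
    · exact hnd z
  · simp only [Function.update_apply]
    split_ifs with h1
    · rw [List.mem_cons, h1]
    · refine ⟨Or.inr, fun h => h.resolve_left ?_⟩
      rintro rfl; exact h1 rfl
  · have := total_update L (g (p e)) (e :: L (g (p e)))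
    simp only [List.length_cons] at this
    change total (Function.update L (g (p e)) (e :: L (g (p e)))) = _
    omega

lemma insert_insertArc {σ : Store n} (h : σ.Lists) {v w : Fin n} (ho : (v, w) ∉ σ.out (σ.f v))
    (hi : (v, w) ∉ σ.inn (σ.f w)) : Insert σ (σ.insertArc v w) (v, w) := by
  have r1 := refresh_find h.wf v
  have r := r1.trans (refresh_find r1.wf w)
  set τ := (σ.find v).find w with hτ
  have hf : (σ.insertArc v w).f = σ.f := r.f_eq
  have eo : (σ.insertArc v w).out =
      Function.update σ.out (σ.f v) ((v, w) :: σ.out (σ.f v)) := by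
    rw [← r.f_eq]; rfl
  have ei : (σ.insertArc v w).inn =
      Function.update σ.inn (σ.f w) ((v, w) :: σ.inn (σ.f w)) := by
    rw [← r.f_eq]; rfl
  obtain ⟨o1, o2, o3, o4⟩ := insert_lists σ.out σ.f Prod.fst h.f_of_mem_out h.nodup_out ho
  obtain ⟨i1, i2, i3, i4⟩ := insert_lists σ.inn σ.f Prod.snd h.f_of_mem_inn h.nodup_inn hi
  refine ⟨⟨r.wf, ?_, ?_, ?_, ?_⟩, hf, r.order_eq, ?_, ?_, ?_, ?_, ?_⟩
  · rw [hf, eo]; exact o1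
  · rw [hf, ei]; exact i1
  · rw [eo]; exact o2
  · rw [ei]; exact i2
  · rw [eo]; exact o3
  · rw [ei]; exact i3
  · rw [eo]; exact o4
  · rw [ei]; exact i4
  · have h1 : (σ.insertArc v w).cost = τ.time + 1 + τ.sets.slack := rfl
    have h2 := r.cost_le
    simp only [cost] at h1 h2 ⊢
    omega

/-- The memory is in a proper state for the graph with the arcs `E`. An arc whose ends are in
different components is in both of its lists. -/
structure Good (σ : Store n) (E : List (Arc n)) : Prop extends Lists σ where
  correct : σ.Correct E
  mem_of_mem_out : ∀ x, ∀ a ∈ σ.out x, a ∈ E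
  mem_of_mem_inn : ∀ x, ∀ a ∈ σ.inn x, a ∈ E
  mem_out : ∀ a ∈ E, σ.f a.1 ≠ σ.f a.2 → a ∈ σ.out (σ.f a.1)
  mem_inn : ∀ a ∈ E, σ.f a.1 ≠ σ.f a.2 → a ∈ σ.inn (σ.f a.2)

lemma Correct.congr {σ σ' : Store n} {E : List (Arc n)} (h : σ.Correct E) (hf : σ'.f = σ.f)
    (ho : σ'.order = σ.order) : σ'.Correct E := by
  refine ⟨?_, ?_, ?_, ?_, ?_⟩
  · rw [hf]; exact h.component
  · rw [hf]; exact h.canonical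
  · rw [ho]; exact h.order_nodup
  · rw [hf, ho]; exact h.mem_order
  · simp only [lt, hf, ho]; exact h.topological

lemma Good.refresh {σ σ' : Store n} {k : ℕ} {E : List (Arc n)} (h : σ.Good E)
    (r : Refresh σ σ' k) : σ'.Good E where
  toLists := h.toLists.refresh r
  correct := h.correct.congr r.f_eq r.order_eq
  mem_of_mem_out := by rw [r.out_eq]; exact h.mem_of_mem_out
  mem_of_mem_inn := by rw [r.inn_eq]; exact h.mem_of_mem_inn
  mem_out := by rw [r.f_eq, r.out_eq]; exact h.mem_out
  mem_inn := by rw [r.f_eq, r.inn_eq]; exact h.mem_inn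

lemma Correct.f_f {σ : Store n} {E : List (Arc n)} (h : σ.Correct E) (x : Fin n) :
    σ.f (σ.f x) = σ.f x := (h.component _ _).2 (h.canonical x).symm

lemma Correct.mem_order_iff {σ : Store n} {E : List (Arc n)} (h : σ.Correct E) (x : Fin n) :
    x ∈ σ.order ↔ σ.f x = x := by
  rw [h.mem_order]
  constructor
  · rintro ⟨y, rfl⟩; exact h.f_f y
  · intro hx; exact ⟨x, hx⟩

lemma Correct.reach_f {σ : Store n} {E : List (Arc n)} (h : σ.Correct E) {x y : Fin n}
    (hxy : Reach E x y) : Reach E (σ.f x) (σ.f y) :=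
  ((h.canonical x).2.trans hxy).trans (h.canonical y).1

lemma Correct.idxOf_le_of_reach {σ : Store n} {E : List (Arc n)} (h : σ.Correct E) {x y : Fin n}
    (hxy : Reach E x y) : σ.order.idxOf (σ.f x) ≤ σ.order.idxOf (σ.f y) := by
  induction hxy with
  | refl => exact le_rfl
  | tail _ hz ih =>
    refine ih.trans ?_
    rename_i a b _
    by_cases hab : σ.f a = σ.f b
    · rw [hab]
    · exact (h.topological a b hz hab).le

lemma Correct.idxOf_inj {σ : Store n} {E : List (Arc n)} (h : σ.Correct E) {x y : Fin n}
    (hx : σ.f x = x) (hxy : σ.order.idxOf x = σ.order.idxOf y) : x = y :=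
  (List.idxOf_inj ((h.mem_order_iff x).2 hx)).1 hxy

lemma slack_init (n : ℕ) : (init n).sets.slack ≤ n * Nat.log 2 n := by
  simp [Forest.slack, init]

lemma root_init (n : ℕ) (x : Fin n) : (init n).sets.root x = x :=
  Forest.root_eq_self rfl

lemma f_init (n : ℕ) (x : Fin n) : (init n).f x = x := root_init n x

lemma good_init (n : ℕ) : (init n).Good [] := by
  have hreach : ∀ x y : Fin n, Reach ([] : List (Arc n)) x y ↔ x = y := by
    intro x y
    refine ⟨fun h => ?_, fun h => h ▸ Relation.ReflTransGen.refl⟩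
    induction h with
    | refl => rfl
    | tail _ h _ => simp at h
  have hone : ∀ x : Fin n, 2 ^ 0 ≤ n := fun x => by simpa using Nat.succ_le_of_lt x.pos
  have hsize : ∀ r, 2 ^ 0 ≤ (init n).sets.treeSize r := fun r =>
    Finset.card_pos.2 ⟨r, by simpa using root_init n r⟩
  have hmem : ∀ x, ∀ a ∈ ([] : List (Arc n)), (init n).f a.1 = x ∧ (init n).f a.2 = x := by simp
  exact
    { wf := ⟨⟨fun x hx => absurd rfl hx, hone⟩, fun r _ => hsize r, fun r _ => root_init n r⟩
      f_of_mem_out := fun x a ha => (hmem x a ha).1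
      f_of_mem_inn := fun x a ha => (hmem x a ha).2
      nodup_out := fun _ => List.nodup_nil
      nodup_inn := fun _ => List.nodup_nil
      correct :=
        { component := fun x y => by
            rw [f_init, f_init, hreach, hreach]
            exact ⟨fun h => ⟨h, h.symm⟩, fun h => h.1⟩
          canonical := fun x => by rw [f_init]; exact ⟨.refl, .refl⟩
          order_nodup := List.nodup_finRange n
          mem_order := fun x => ⟨fun _ => ⟨x, f_init n x⟩, fun _ => List.mem_finRange x⟩
          topological := fun x y h => absurd h (by simp) }
      mem_of_mem_out := fun _ _ h => h
      mem_of_mem_inn := fun _ _ h => h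
      mem_out := fun a h => absurd h (by simp)
      mem_inn := fun a h => absurd h (by simp) }

end Store

end StrongComp

/-! ### One direction of the search -/

namespace StrongComp

variable {n : ℕ}

/-- The lists `L` after arc `a` was met in the list of `u`, where `x` is the canonical vertex of its
other end: a loop is deleted. -/
def dropLoop (L : Fin n → List (Arc n)) (u x : Fin n) (a : Arc n) : Fin n → List (Arc n) :=
  if u = x then Function.update L u ((L u).erase a) else L

/-- The visited vertices `V` after visiting `x`. -/
def visit (V : List (Fin n)) (x : Fin n) : List (Fin n) := if x ∈ V then V else x :: V

/-- The active vertices after an arc from `u` to `x` was traversed, where `rest` is the untraversed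
part of the list of `u`. -/
def nextActive (V Ac : List (Fin n)) (L : Fin n → List (Arc n)) (rest : List (Arc n))
    (u x : Fin n) : List (Fin n) :=
  let Ac' := if rest = [] then Ac.erase u else Ac
  if x ∈ V then Ac' else if L x = [] then Ac' else x :: Ac'

/-- The part of the search invariant that speaks of one direction and does not depend on which
vertices are active or passive. `tl` and `hd` give the near and the far end of an arc seen in
this direction, `L` the arc lists, `r` the starting vertex, `V` the visited vertices, `ptr` the
untraversed parts of the lists, `T` the traversed arcs, and all visited vertices have property `P`. -/
structure Half (E : List (Arc n)) (f : Fin n → Fin n) (tl hd : Arc n → Fin n)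
    (P : Fin n → Prop) (r : Fin n) (L : Fin n → List (Arc n)) (V : List (Fin n))
    (ptr : Fin n → List (Arc n)) (T : List (Arc n)) : Prop where
  root_mem : r ∈ V
  nodup : V.Nodup
  prop : ∀ x ∈ V, P x
  ptr_sublist : ∀ x, (ptr x).Sublist (L x)
  fresh : ∀ x, x ∉ V → ptr x = L x
  closed : ∀ x ∈ V, ∀ a ∈ L x, a ∈ ptr x ∨ f (hd a) ∈ V
  count : V.length + total ptr ≤ 1 + total L
  nodup_trace : T.Nodup
  of_mem_trace : ∀ a ∈ T, a ∈ E ∧ f (tl a) ∈ V ∧ a ∉ ptr (f (tl a))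
  total_le : total L ≤ total ptr + T.length

section Half

variable {E : List (Arc n)} {f : Fin n → Fin n} {tl hd : Arc n → Fin n} {P : Fin n → Prop}
  {r : Fin n} {L : Fin n → List (Arc n)} {V : List (Fin n)} {ptr : Fin n → List (Arc n)}
  {T : List (Arc n)} {u : Fin n} {a : Arc n} {rest : List (Arc n)}

lemma mem_visit {V : List (Fin n)} {x y : Fin n} : y ∈ visit V x ↔ y = x ∨ y ∈ V := by
  unfold visit
  split_ifs with h
  · exact ⟨Or.inr, fun h' => h'.elim (fun h' => h' ▸ h) id⟩
  · exact List.mem_cons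

lemma dropLoop_subset (L : Fin n → List (Arc n)) (u x : Fin n) (a : Arc n) (y : Fin n) :
    (dropLoop L u x a y).Sublist (L y) := by
  unfold dropLoop
  split_ifs with h
  · rw [Function.update_apply]
    split_ifs with h1
    · rw [h1]; exact List.erase_sublist
    · exact List.Sublist.refl _
  · exact List.Sublist.refl _

lemma dropLoop_of_ne (L : Fin n → List (Arc n)) {u x y : Fin n} (a : Arc n) (h : y ≠ u) :
    dropLoop L u x a y = L y := by
  unfold dropLoop
  split_ifs with h1
  · rw [Function.update_of_ne h]
  · rfl

lemma total_update_tail {ptr : Fin n → List (Arc n)} (h : ptr u = a :: rest) :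
    total (Function.update ptr u rest) + 1 = total ptr := by
  have := total_update ptr u rest
  rw [h, List.length_cons] at this
  omega

/-- The traversal of an arc preserves `Half`. -/
lemma Half.step (h : Half E f tl hd P r L V ptr T) (hE : ∀ x, ∀ a ∈ L x, a ∈ E)
    (hf : ∀ x, ∀ a ∈ L x, f (tl a) = x) (hnd : ∀ x, (L x).Nodup) (hu : u ∈ V)
    (ha : ptr u = a :: rest) (hP : P (f (hd a))) :
    Half E f tl hd P r (dropLoop L u (f (hd a)) a) (visit V (f (hd a)))
      (Function.update ptr u rest) (a :: T) := by
  set x := f (hd a) with hx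
  have haL : a ∈ L u := (h.ptr_sublist u).subset (by rw [ha]; simp)
  have hfa : f (tl a) = u := hf u a haL
  have htot := total_update_tail ha
  have hnda : (a :: rest).Nodup := by rw [← ha]; exact (hnd u).sublist (h.ptr_sublist u)
  have hsub : ∀ y, (Function.update ptr u rest y).Sublist (ptr y) := by
    intro y
    rw [Function.update_apply]
    split_ifs with hy
    · rw [hy, ha]; exact List.sublist_cons_self _ _
    · exact List.Sublist.refl _
  have htotL : total (dropLoop L u x a) = total L ∨
      (x ∈ V ∧ total (dropLoop L u x a) + 1 = total L) := by
    unfold dropLoop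
    split_ifs with hux
    · right
      refine ⟨hux ▸ hu, ?_⟩
      have h1 := total_update L u ((L u).erase a)
      have h2 := List.length_erase_of_mem haL
      have h3 := List.length_pos_of_mem haL
      omega
    · left; rfl
  refine ⟨?_, ?_, ?_, ?_, ?_, ?_, ?_, ?_, ?_, ?_⟩
  · exact mem_visit.2 (Or.inr h.root_mem)
  · unfold visit
    split_ifs with hv
    · exact h.nodup
    · exact List.nodup_cons.2 ⟨hv, h.nodup⟩
  · intro y hy
    rcases mem_visit.1 hy with rfl | hy
    · exact hP
    · exact h.prop y hy
  · intro y
    by_cases hy : y = u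
    · subst hy
      rw [Function.update_self]
      have h1 := h.ptr_sublist y
      rw [ha] at h1
      unfold dropLoop
      split_ifs with hyx
      · rw [Function.update_self]
        have := h1.erase a
        rwa [List.erase_cons_head] at this
      · exact (List.sublist_cons_self _ _).trans h1
    · rw [dropLoop_of_ne _ _ hy, Function.update_of_ne hy]
      exact h.ptr_sublist y
  · intro y hy
    rw [mem_visit, not_or] at hy
    have hyu : y ≠ u := by rintro rfl; exact hy.2 hu
    rw [dropLoop_of_ne _ _ hyu, Function.update_of_ne hyu, h.fresh y hy.2]
  · intro y hy b hb
    have hb' : b ∈ L y := (dropLoop_subset _ _ _ _ _).subset hb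
    by_cases hyu : y = u
    · subst hyu
      rw [Function.update_self]
      rcases h.closed y hu b hb' with h1 | h1
      · rw [ha, List.mem_cons] at h1
        rcases h1 with rfl | h1
        · exact Or.inr (mem_visit.2 (Or.inl rfl))
        · exact Or.inl h1
      · exact Or.inr (mem_visit.2 (Or.inr h1))
    · rw [Function.update_of_ne hyu]
      by_cases hyV : y ∈ V
      · exact (h.closed y hyV b hb').imp_right fun h1 => mem_visit.2 (Or.inr h1)
      · exact Or.inl (by rw [h.fresh y hyV]; exact hb')
  · have := h.count
    unfold visit
    split_ifs with hv
    · omega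
    · have : total (dropLoop L u x a) = total L := htotL.resolve_right fun h1 => hv h1.1
      rw [List.length_cons]
      omega
  · refine List.nodup_cons.2 ⟨fun hT => ?_, h.nodup_trace⟩
    have := (h.of_mem_trace a hT).2.2
    rw [hfa, ha] at this
    simp at this
  · intro b hb
    rcases List.mem_cons.1 hb with rfl | hb
    · refine ⟨hE u b haL, by rw [hfa]; exact mem_visit.2 (Or.inr hu), ?_⟩
      rw [hfa, Function.update_self]
      exact (List.nodup_cons.1 hnda).1
    · obtain ⟨h1, h2, h3⟩ := h.of_mem_trace b hb
      exact ⟨h1, mem_visit.2 (Or.inr h2), fun h4 => h3 ((hsub _).subset h4)⟩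
  · have := h.total_le
    rw [List.length_cons]
    rcases htotL with h1 | h1 <;> omega

/-- The active and the passive vertices of one direction are visited vertices with untraversed
arcs. -/
structure Alive (V : List (Fin n)) (ptr : Fin n → List (Arc n)) (Ac Pa : List (Fin n)) :
    Prop where
  live : ∀ x, x ∈ Ac ∨ x ∈ Pa → x ∈ V ∧ ptr x ≠ []
  nodup_active : Ac.Nodup
  nodup_passive : Pa.Nodup
  disjoint : ∀ x ∈ Ac, x ∉ Pa

variable {Ac Pa : List (Fin n)}

lemma mem_nextActive {x y : Fin n} (hnd : Ac.Nodup) :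
    y ∈ nextActive V Ac L rest u x ↔
      (y ∈ Ac ∧ (y = u → rest ≠ [])) ∨ (y = x ∧ x ∉ V ∧ L x ≠ []) := by
  have h1 : y ∈ (if rest = [] then Ac.erase u else Ac) ↔ (y ∈ Ac ∧ (y = u → rest ≠ [])) := by
    split_ifs with hr
    · rw [hnd.mem_erase_iff]
      simp only [hr, ne_eq, not_true_eq_false, imp_false]
      exact and_comm
    · simp [hr]
  unfold nextActive
  simp only
  generalize (if rest = [] then Ac.erase u else Ac) = A at h1 ⊢
  split_ifs with hV hL
  · rw [h1]; simp [hV]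
  · rw [h1]; simp [hL]
  · rw [List.mem_cons, h1]; simp [hV, hL, or_comm]

lemma Alive.step (h : Alive V ptr Ac Pa) (hu : u ∈ Ac)
    (hfresh : ∀ x, x ∉ V → ptr x = L x) (x : Fin n) :
    Alive (visit V x) (Function.update ptr u rest)
      (nextActive V Ac (dropLoop L u x a) rest u x) Pa := by
  have huV := (h.live u (Or.inl hu)).1
  refine ⟨?_, ?_, h.nodup_passive, ?_⟩
  · intro y hy
    rw [mem_nextActive h.nodup_active] at hy
    have hold : ∀ y, y ∈ Ac ∨ y ∈ Pa → (y = u → rest ≠ []) →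
        y ∈ visit V x ∧ Function.update ptr u rest y ≠ [] := by
      intro y hy hyu
      refine ⟨mem_visit.2 (Or.inr (h.live y hy).1), ?_⟩
      rw [Function.update_apply]
      split_ifs with h1
      · exact hyu h1
      · exact (h.live y hy).2
    rcases hy with (hy | ⟨rfl, hyV, hyL⟩) | hy
    · exact hold y (Or.inl hy.1) hy.2
    · have hyu : y ≠ u := by rintro rfl; exact hyV huV
      rw [dropLoop_of_ne _ _ hyu] at hyL
      refine ⟨mem_visit.2 (Or.inl rfl), ?_⟩
      rw [Function.update_of_ne hyu, hfresh y hyV]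
      exact hyL
    · exact hold y (Or.inr hy) fun hyu => absurd hy (by rw [hyu]; exact h.disjoint u hu)
  · have h1 : (if rest = [] then Ac.erase u else Ac).Nodup := by
      split_ifs
      · exact h.nodup_active.erase u
      · exact h.nodup_active
    have h2 : ∀ y ∈ (if rest = [] then Ac.erase u else Ac), y ∈ V := by
      intro y hy
      split_ifs at hy
      · exact (h.live y (Or.inl (List.mem_of_mem_erase hy))).1
      · exact (h.live y (Or.inl hy)).1
    unfold nextActive
    simp only
    generalize (if rest = [] then Ac.erase u else Ac) = A at h1 h2 ⊢
    split_ifs with hV hL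
    · exact h1
    · exact h1
    · exact List.nodup_cons.2 ⟨fun h3 => hV (h2 x h3), h1⟩
  · intro y hy hy'
    rw [mem_nextActive h.nodup_active] at hy
    rcases hy with hy | ⟨rfl, hyV, _⟩
    · exact h.disjoint y hy.1 hy'
    · exact hyV (h.live y (Or.inr hy')).1

/-- Making an active vertex passive. -/
lemma Alive.retire (h : Alive V ptr Ac Pa) (hu : u ∈ Ac) :
    Alive V ptr (Ac.erase u) (u :: Pa) where
  live x hx := by
    rcases hx with hx | hx
    · exact h.live x (Or.inl (List.mem_of_mem_erase hx))
    · rcases List.mem_cons.1 hx with rfl | hx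
      · exact h.live x (Or.inl hu)
      · exact h.live x (Or.inr hx)
  nodup_active := h.nodup_active.erase u
  nodup_passive := List.nodup_cons.2 ⟨h.disjoint u hu, h.nodup_passive⟩
  disjoint x hx hx' := by
    rw [h.nodup_active.mem_erase_iff] at hx
    rcases List.mem_cons.1 hx' with h1 | h1
    · exact hx.1 h1
    · exact h.disjoint x hx.2 h1

/-- The passive vertices and `s` cease to be alive. -/
lemma Alive.kill (h : Alive V ptr Ac Pa) (s : Fin n) : Alive V ptr (Ac.erase s) [] where
  live x hx := h.live x (Or.inl (List.mem_of_mem_erase (hx.resolve_right (by simp))))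
  nodup_active := h.nodup_active.erase s
  nodup_passive := List.nodup_nil
  disjoint _ _ := by simp

/-- Some of the passive vertices become active. -/
lemma Alive.split (h : Alive V ptr [] Pa) (p : Fin n → Prop) [DecidablePred p] :
    Alive V ptr (Pa.filter fun x => p x) (Pa.filter fun x => ¬ p x) where
  live x hx := h.live x (Or.inr (hx.elim (fun h => List.mem_of_mem_filter h)
    (fun h => List.mem_of_mem_filter h)))
  nodup_active := h.nodup_passive.filter _
  nodup_passive := h.nodup_passive.filter _
  disjoint x hx hx' := by
    simp only [List.mem_filter, decide_eq_true_eq] at hx hx'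
    exact hx'.2 hx.2

/-- Of a visited vertex of the one direction and a visited vertex of the other, both with untraversed
arcs, both are active or passive unless they are in relation `R`. -/
def Cross (R : Fin n → Fin n → Prop) (V : List (Fin n)) (ptr : Fin n → List (Arc n))
    (Ac Pa V₂ : List (Fin n)) (ptr₂ : Fin n → List (Arc n)) (Ac₂ Pa₂ : List (Fin n)) : Prop :=
  ∀ x ∈ V, ptr x ≠ [] → ∀ y ∈ V₂, ptr₂ y ≠ [] →
    ((x ∈ Ac ∨ x ∈ Pa) ∧ (y ∈ Ac₂ ∨ y ∈ Pa₂)) ∨ R x y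

variable {R : Fin n → Fin n → Prop} {V₂ Ac₂ Pa₂ : List (Fin n)} {ptr₂ : Fin n → List (Arc n)}

lemma Cross.symm (h : Cross R V ptr Ac Pa V₂ ptr₂ Ac₂ Pa₂) :
    Cross (fun x y => R y x) V₂ ptr₂ Ac₂ Pa₂ V ptr Ac Pa :=
  fun x hx hx' y hy hy' => (h y hy hy' x hx hx').imp_left And.symm

lemma Cross.step (h : Cross R V ptr Ac Pa V₂ ptr₂ Ac₂ Pa₂) (hal : Alive V ptr Ac Pa)
    (hu : u ∈ Ac) (hfresh : ∀ x, x ∉ V → ptr x = L x) (ha : ptr u = a :: rest) {x : Fin n}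
    (hR : x ∉ V → ∀ y, R u y → R x y) :
    Cross R (visit V x) (Function.update ptr u rest)
      (nextActive V Ac (dropLoop L u x a) rest u x) Pa V₂ ptr₂ Ac₂ Pa₂ := by
  intro z hz hz' y hy hy'
  rw [mem_nextActive hal.nodup_active]
  by_cases hzV : z ∈ V
  · have hzp : ptr z ≠ [] ∧ (z = u → rest ≠ []) := by
      rw [Function.update_apply] at hz'
      split_ifs at hz' with hzu
      · rw [hzu, ha]; exact ⟨by simp, fun _ => hz'⟩
      · exact ⟨hz', fun h => absurd h hzu⟩
    refine (h z hzV hzp.1 y hy hy').imp_left fun h1 => ⟨?_, h1.2⟩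
    exact h1.1.imp_left fun h2 => Or.inl ⟨h2, hzp.2⟩
  · have hzx := (mem_visit.1 hz).resolve_right hzV
    subst hzx
    have huV := (hal.live u (Or.inl hu)).1
    have hzu : z ≠ u := by rintro rfl; exact hzV huV
    rcases h u huV (by rw [ha]; simp) y hy hy' with h1 | h1
    · left
      refine ⟨Or.inl (Or.inr ⟨rfl, hzV, ?_⟩), h1.2⟩
      rw [dropLoop_of_ne _ _ hzu, ← hfresh z hzV]
      rwa [Function.update_of_ne hzu] at hz'
    · exact Or.inr (hR hzV y h1)

end Half

end StrongComp

/-! ### The potential of the active and passive vertices -/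

namespace StrongComp

/-- The smaller one of the numbers of candidates that are not after `s` and not before `s`,
where `r` is the strict order. -/
def balance {α : Type*} (r : α → α → Prop) [DecidableRel r] (P : List α) (s : α) : ℕ :=
  min (P.countP fun x => ¬ r s x) (P.countP fun x => ¬ r x s)

lemma balance_flip {α : Type*} {r : α → α → Prop} [DecidableRel r] (P : List α)
    (s : α) : balance (fun x y => r y x) P s = balance r P s :=
  min_comm _ _

lemma balance_le_length {α : Type*} {r : α → α → Prop} [DecidableRel r] (P : List α)
    (s : α) : balance r P s ≤ P.length :=
  (min_le_left _ _).trans List.countP_le_length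

section Potential

variable {α : Type*} [DecidableEq α] (r : α → α → Prop) [DecidableRel r]

/-- A number of active and passive vertices that are certain to cease to be alive before or when
the threshold `s` changes next, where `r` is the order of the vertices: if `FA` becomes empty, these
are all vertices of `FA` before `s`, those of `BP`, and `s` itself; if `BA` becomes empty, those
of `BA` after `s`, those of `FP`, and `s` itself. -/
def credit (s : α) (FA FP BA BP : List α) : ℕ :=
  min (FA.countP (fun x => r x s) + BP.length + if s ∈ FA ∨ s ∈ BA then 1 else 0)
    (BA.countP (fun y => r s y) + FP.length + if s ∈ FA ∨ s ∈ BA then 1 else 0)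

/-- The number of active and passive vertices. -/
def alive (FA FP BA BP : List α) : ℕ := FA.length + FP.length + BA.length + BP.length

/-- The potential of a search: its main term is `A` per vertex that is alive, less those that are
certain to cease to be alive at the next change of the threshold. The other terms pay for making an
active vertex passive, and for the time of `1 + |FP| + |BP|` of a change of the threshold. -/
def pot (A : ℕ) (s : α) (FA FP BA BP : List α) : ℕ :=
  A * (alive FA FP BA BP - credit r s FA FP BA BP) + 2 * alive FA FP BA BP +
    3 * (FA.length + BA.length)

lemma credit_flip (s : α) (FA FP BA BP : List α) :
    credit (fun x y => r y x) s BA BP FA FP = credit r s FA FP BA BP := by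
  unfold credit
  rw [min_comm]
  simp only [or_comm]

lemma pot_flip (A : ℕ) (s : α) (FA FP BA BP : List α) :
    pot (fun x y => r y x) A s BA BP FA FP = pot r A s FA FP BA BP := by
  unfold pot
  rw [credit_flip]
  have : alive BA BP FA FP = alive FA FP BA BP := by unfold alive; omega
  rw [this, Nat.add_comm BA.length]

variable {r}

lemma credit_le_alive (hr : ∀ x, ¬ r x x) (s : α) (FA FP BA BP : List α) :
    credit r s FA FP BA BP ≤ alive FA FP BA BP := by
  unfold credit alive
  have h1 := List.countP_le_length (p := fun x => decide (r x s)) (l := FA)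
  have h2 : s ∈ FA → FA.countP (fun x => r x s) < FA.length := fun hs => by
    refine lt_of_le_of_ne h1 fun h => ?_
    have := List.countP_eq_length.1 h s hs
    exact hr s (by simpa using this)
  have h3 : s ∈ BA → 0 < BA.length := List.length_pos_of_mem
  refine (min_le_left _ _).trans ?_
  split_ifs with h
  · rcases h with h | h
    · have := h2 h; omega
    · have := h3 h; omega
  · omega

lemma pot_erase (hr : ∀ x, ¬ r x x) (A : ℕ) (s : α) {FA : List α} (FP BA BP : List α) {u : α}
    (hu : u ∈ FA) : pot r A s (FA.erase u) FP BA BP ≤ pot r A s FA FP BA BP := by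
  have hlen := List.length_erase_of_mem hu
  have hpos := List.length_pos_of_mem hu
  have hcnt : (FA.erase u).countP (fun x => r x s) =
      FA.countP (fun x => r x s) - if r u s then 1 else 0 := by
    rw [List.countP_erase]; simp [hu]
  have hs : u ≠ s → (s ∈ FA.erase u ↔ s ∈ FA) := fun h => List.mem_erase_of_ne h.symm
  have hus : u = s → ¬ r u s := fun h => h ▸ hr u
  have hcr : credit r s FA FP BA BP ≤ credit r s (FA.erase u) FP BA BP + 1 := by
    unfold credit
    rw [hcnt]
    by_cases h : u = s
    · simp only [hus h, if_false]
      split_ifs <;> omega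
    · simp only [hs h]
      split_ifs <;> omega
  have hcl := credit_le_alive hr s FA FP BA BP
  have hal : alive (FA.erase u) FP BA BP + 1 = alive FA FP BA BP := by unfold alive; omega
  unfold pot
  have : alive (FA.erase u) FP BA BP - credit r s (FA.erase u) FP BA BP ≤
      alive FA FP BA BP - credit r s FA FP BA BP := by omega
  have := Nat.mul_le_mul_left A this
  omega

lemma pot_cons (A : ℕ) (s : α) (FA FP BA BP : List α) (x : α) :
    pot r A s (x :: FA) FP BA BP ≤ pot r A s FA FP BA BP + (A + 5) := by
  have hcr : credit r s FA FP BA BP ≤ credit r s (x :: FA) FP BA BP := by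
    unfold credit
    have : FA.countP (fun x => r x s) ≤ (x :: FA).countP (fun x => r x s) := by
      rw [List.countP_cons]; omega
    have h2 : s ∈ FA → s ∈ x :: FA := List.mem_cons_of_mem x
    split_ifs with h3 h4 h4
    · omega
    · exact absurd (h3.imp_left h2) h4
    · omega
    · omega
  have hal : alive (x :: FA) FP BA BP = alive FA FP BA BP + 1 := by
    unfold alive; rw [List.length_cons]; omega
  unfold pot
  have : alive (x :: FA) FP BA BP - credit r s (x :: FA) FP BA BP ≤
      alive FA FP BA BP - credit r s FA FP BA BP + 1 := by omega
  have := Nat.mul_le_mul_left A this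
  rw [List.length_cons]
  rw [Nat.mul_add, Nat.mul_one] at this
  omega

lemma pot_retire (A : ℕ) (s : α) {FA : List α} (FP BA BP : List α) {u : α}
    (hu : u ∈ FA) (h1 : ¬ r u s) (h2 : u = s → s ∈ BA) :
    pot r A s (FA.erase u) (u :: FP) BA BP + 3 ≤ pot r A s FA FP BA BP := by
  have hlen := List.length_erase_of_mem hu
  have hpos := List.length_pos_of_mem hu
  have hcnt : (FA.erase u).countP (fun x => r x s) = FA.countP (fun x => r x s) := by
    rw [List.countP_erase]; simp [h1]
  have hs : (s ∈ FA ∨ s ∈ BA) → (s ∈ FA.erase u ∨ s ∈ BA) := by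
    rintro (h | h)
    · by_cases hus : u = s
      · exact Or.inr (h2 hus)
      · exact Or.inl ((List.mem_erase_of_ne (Ne.symm hus)).2 h)
    · exact Or.inr h
  have hcr : credit r s FA FP BA BP ≤ credit r s (FA.erase u) (u :: FP) BA BP := by
    unfold credit
    rw [hcnt, List.length_cons]
    split_ifs with h3 h4 h4
    · omega
    · exact absurd (hs h3) h4
    · omega
    · omega
  have hal : alive (FA.erase u) (u :: FP) BA BP = alive FA FP BA BP := by
    unfold alive; rw [List.length_cons]; omega
  unfold pot
  rw [hal]
  have : alive FA FP BA BP - credit r s (FA.erase u) (u :: FP) BA BP ≤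
      alive FA FP BA BP - credit r s FA FP BA BP := by omega
  have := Nat.mul_le_mul_left A this
  omega

lemma alive_credit_before (s : α) (FP BA BP : List α) :
    alive [] FP (BA.erase s) [] ≤ alive [] FP BA BP - credit r s [] FP BA BP ∧
      BP.length + alive [] FP (BA.erase s) [] ≤ alive [] FP BA BP := by
  have h1 : credit r s [] FP BA BP ≤ BP.length + if s ∈ BA then 1 else 0 := by
    unfold credit
    refine (min_le_left _ _).trans ?_
    simp
  unfold alive
  by_cases hs : s ∈ BA
  · have h2 := List.length_erase_of_mem hs
    have h3 := List.length_pos_of_mem hs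
    simp only [hs, if_true, List.length_nil] at h1 ⊢
    omega
  · rw [List.erase_of_not_mem hs]
    simp only [hs, if_false, List.length_nil] at h1 ⊢
    omega

/-- When `FA` has become empty and there is no candidate for a new threshold. -/
lemma pot_kill (A : ℕ) (s : α) (BA BP : List α) :
    pot r A s [] [] (BA.erase s) [] + BP.length ≤ pot r A s [] [] BA BP := by
  obtain ⟨h1, h2⟩ := alive_credit_before (r := r) s [] BA BP
  have h3 := Nat.mul_le_mul_left A
    ((Nat.sub_le (alive [] [] (BA.erase s) []) (credit r s [] [] (BA.erase s) [])).trans h1)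
  have h4 := (List.erase_sublist (a := s) (l := BA)).length_le
  unfold pot
  omega

/-- When `FA` has become empty and the candidate `s'` becomes the new threshold. -/
lemma pot_change (hr : ∀ x, ¬ r x x) (A : ℕ) (s : α) {FP : List α} (BA BP : List α) {s' : α}
    (hnd : FP.Nodup) (hs' : s' ∈ FP) (htri : ∀ x ∈ FP, ¬ r s' x → ¬ r x s' → x = s') :
    pot r A s' (FP.filter fun x => ¬ r s' x) (FP.filter fun x => ¬ ¬ r s' x) (BA.erase s) [] +
      FP.length + BP.length + A * balance r FP s' ≤ pot r A s [] FP BA BP + 4 * FP.length := by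
  obtain ⟨h1, h2⟩ := alive_credit_before (r := r) s FP BA BP
  have hsplit : (FP.filter fun x => ¬ r s' x).length + (FP.filter fun x => ¬ ¬ r s' x).length =
      FP.length := by
    have := List.length_eq_length_filter_add (l := FP) (fun x => decide (¬ r s' x))
    simpa using this.symm
  have hone : FP.countP (fun x => x = s') ≤ 1 := by
    have := List.nodup_iff_count_le_one.1 hnd s'
    rw [List.count] at this
    refine le_trans (le_of_eq ?_) this
    refine List.countP_congr fun x _ => ?_
    simp
  have hA : FP.countP (fun x => ¬ r s' x) ≤
      (FP.filter fun x => ¬ r s' x).countP (fun x => r x s') + 1 := by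
    rw [List.countP_filter]
    have h3 : FP.countP (fun x => ¬ r s' x) ≤ FP.countP (fun x => r x s' ∧ ¬ r s' x) +
        FP.countP (fun x => x = s') := by
      clear hone hsplit h1 h2 hs' hnd
      induction FP with
      | nil => simp
      | cons y l ih =>
        have := ih fun x hx => htri x (List.mem_cons_of_mem _ hx)
        have hy := htri y (by simp)
        simp only [List.countP_cons, decide_eq_true_eq]
        split_ifs <;> first | omega | (exfalso; tauto)
    refine (h3.trans (Nat.add_le_add_left hone _)).trans (Nat.add_le_add_right ?_ 1)
    refine le_of_eq (List.countP_congr fun x _ => ?_)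
    simp
  have hB : FP.countP (fun x => ¬ r x s') ≤ (FP.filter fun x => ¬ ¬ r s' x).length + 1 := by
    rw [← List.countP_eq_length_filter]
    refine le_trans ?_ (Nat.add_le_add_left hone _)
    clear hone hsplit h1 h2 hs' hnd hA
    induction FP with
    | nil => simp
    | cons y l ih =>
      have := ih fun x hx => htri x (List.mem_cons_of_mem _ hx)
      have hy := htri y (by simp)
      simp only [List.countP_cons, decide_eq_true_eq]
      split_ifs <;> first | omega | (exfalso; tauto)
  have hmem : s' ∈ FP.filter fun x => ¬ r s' x := by simp [hs', hr]
  have hcr : balance r FP s' ≤ credit r s' (FP.filter fun x => ¬ r s' x)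
      (FP.filter fun x => ¬ ¬ r s' x) (BA.erase s) [] := by
    unfold balance credit
    simp only [hmem, true_or, if_true]
    simp only [List.length_nil]
    omega
  have hal : alive (FP.filter fun x => ¬ r s' x) (FP.filter fun x => ¬ ¬ r s' x) (BA.erase s) [] =
      alive [] FP (BA.erase s) [] := by
    unfold alive; simp only [List.length_nil]; omega
  have hbl := balance_le_length (r := r) FP s'
  have hal' : FP.length ≤ alive [] FP (BA.erase s) [] := by unfold alive; omega
  unfold pot
  rw [hal]
  generalize hc : credit r s' (FP.filter fun x => ¬ r s' x) (FP.filter fun x => ¬ ¬ r s' x)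
    (BA.erase s) [] = c at hcr ⊢
  have h3 : alive [] FP (BA.erase s) [] - c + balance r FP s' ≤
      alive [] FP BA BP - credit r s [] FP BA BP := by
    omega
  have h4 := Nat.mul_le_mul_left A h3
  rw [Nat.mul_add] at h4
  have h5 := (List.erase_sublist (a := s) (l := BA)).length_le
  omega

end Potential

end StrongComp

/-! ### Steps of the search -/

namespace StrongComp

variable {n : ℕ}

/-- The part of the search invariant that does not depend on which vertices are active or passive.
The list `T` holds the pairs of a forward and a backward arc that were traversed together. -/
structure SearchCore (E : List (Arc n)) (σ : Store n) (S : Search n) : Prop where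
  good : σ.Good E
  src_eq : S.src = σ.f S.w
  dst_eq : S.dst = σ.f S.v
  src_lt_dst : σ.lt S.src S.dst
  trace : ∃ T : List (Arc n × Arc n),
    Half E σ.f Prod.fst Prod.snd (fun x => σ.f x = x ∧ Reach E S.src x) S.src σ.out S.F S.outPtr
      (T.map Prod.fst) ∧
    Half E σ.f Prod.snd Prod.fst (fun x => σ.f x = x ∧ Reach E x S.dst) S.dst σ.inn S.B S.inPtr
      (T.map Prod.snd) ∧
    ∀ p ∈ T, σ.lt (σ.f p.1.1) (σ.f p.2.2)

/-- The part of the search invariant about active and passive vertices. By `cross`, a forward vertex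
and a backward vertex that both have untraversed arcs are either both alive or in the wrong order for
a search step. -/
structure SearchAlive (σ : Store n) (S : Search n) : Prop where
  fwd : Alive S.F S.outPtr S.FA S.FP
  bwd : Alive S.B S.inPtr S.BA S.BP
  le_of_mem_FP : ∀ x ∈ S.FP, σ.le S.s x
  le_of_mem_BP : ∀ x ∈ S.BP, σ.le x S.s
  s_mem : S.s ∈ σ.order
  cross : Cross (fun x y => σ.le y x) S.F S.outPtr S.FA S.FP S.B S.inPtr S.BA S.BP

/-- The amortized cost of the computation up to a state within a search. An untraversed arc holds
`A + 9`, for its traversal and for the potential of the vertex that it may make active. -/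
def potential (A : ℕ) (σ : Store n) (S : Search n) : ℕ :=
  σ.cost + (A + 9) * (total S.outPtr + total S.inPtr) + pot σ.lt A S.s S.FA S.FP S.BA S.BP

lemma Store.lt_irrefl (σ : Store n) (x : Fin n) : ¬ σ.lt x x := Nat.lt_irrefl _

lemma Store.not_lt {σ : Store n} {x y : Fin n} : ¬ σ.lt x y ↔ σ.le y x := Nat.not_lt

lemma Store.Good.reach_of_mem_out {E : List (Arc n)} {σ : Store n} (h : σ.Good E) {u : Fin n}
    {a : Arc n} (ha : a ∈ σ.out u) : Reach E u (σ.f a.2) := by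
  have h1 := h.correct.reach_f (Relation.ReflTransGen.single (h.mem_of_mem_out u a ha))
  rwa [h.f_of_mem_out u a ha] at h1

lemma Store.Good.reach_of_mem_inn {E : List (Arc n)} {σ : Store n} (h : σ.Good E) {u : Fin n}
    {a : Arc n} (ha : a ∈ σ.inn u) : Reach E (σ.f a.1) u := by
  have h1 := h.correct.reach_f (Relation.ReflTransGen.single (h.mem_of_mem_inn u a ha))
  rwa [h.f_of_mem_inn u a ha] at h1

lemma pot_nextActive {r : Fin n → Fin n → Prop} [DecidableRel r] (hr : ∀ x, ¬ r x x)
    (A : ℕ) (s : Fin n) (V FA FP BA BP : List (Fin n)) (L : Fin n → List (Arc n))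
    (rest : List (Arc n)) {u : Fin n} (x : Fin n) (hu : u ∈ FA) :
    pot r A s (nextActive V FA L rest u x) FP BA BP ≤ pot r A s FA FP BA BP + (A + 5) := by
  have h1 : pot r A s (if rest = [] then FA.erase u else FA) FP BA BP ≤ pot r A s FA FP BA BP := by
    split_ifs
    · exact pot_erase hr A s FP BA BP hu
    · exact le_rfl
  unfold nextActive
  simp only
  generalize (if rest = [] then FA.erase u else FA) = FA' at h1 ⊢
  have h2 := pot_cons (r := r) A s FA' FP BA BP x
  split_ifs <;> omega

/-- The memory after a forward half step. -/
def forwardStore (σ : Store n) (u : Fin n) (a : Arc n) : Store n :=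
  { σ.find a.2 with out := dropLoop σ.out u (σ.f a.2) a }

/-- The search after a forward half step. -/
def forwardSearch (σ : Store n) (S : Search n) (u : Fin n) (a : Arc n) (rest : List (Arc n)) :
    Search n :=
  { S with
    F := visit S.F (σ.f a.2)
    outPtr := Function.update S.outPtr u rest
    FA := nextActive S.F S.FA (dropLoop σ.out u (σ.f a.2) a) rest u (σ.f a.2) }

/-- The memory after a backward half step. -/
def backwardStore (σ : Store n) (z : Fin n) (a : Arc n) : Store n :=
  { σ.find a.1 with inn := dropLoop σ.inn z (σ.f a.1) a }

/-- The search after a backward half step. -/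
def backwardSearch (σ : Store n) (S : Search n) (z : Fin n) (a : Arc n) (rest : List (Arc n)) :
    Search n :=
  { S with
    B := visit S.B (σ.f a.1)
    inPtr := Function.update S.inPtr z rest
    BA := nextActive S.B S.BA (dropLoop σ.inn z (σ.f a.1) a) rest z (σ.f a.1) }

lemma forwardStep_eq {σ : Store n} {S : Search n} (hwf : σ.sets.WF) {u : Fin n} (hu : u ∈ S.F)
    (hfresh : ∀ x, x ∉ S.F → S.outPtr x = σ.out x) {a : Arc n} {rest : List (Arc n)}
    (ha : S.outPtr u = a :: rest) :
    forwardStep u σ S = (forwardStore σ u a, forwardSearch σ S u a rest) := by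
  obtain ⟨q, g⟩ := a
  have hf : (σ.find g).f g = σ.f g := by rw [(Store.refresh_find hwf g).f_eq]
  have hout : (σ.find g).out = σ.out := rfl
  simp only [forwardStep, ha, hf, forwardStore, forwardSearch, visit, nextActive, dropLoop]
  by_cases hx : σ.f g ∈ S.F
  · by_cases hux : u = σ.f g
    · simp only [hx, if_true, if_pos hux]; rfl
    · simp only [hx, if_true, if_neg hux]; rfl
  · have hux : u ≠ σ.f g := by rintro rfl; exact hx hu
    simp only [hx, if_false, if_neg hux, hout]
    have : Function.update (Function.update S.outPtr u rest) (σ.f g) (σ.out (σ.f g)) =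
        Function.update S.outPtr u rest := by
      rw [← hfresh _ hx, ← Function.update_of_ne hux.symm rest S.outPtr, Function.update_eq_self]
    rw [this]
    rfl

lemma backwardStep_eq {σ : Store n} {S : Search n} (hwf : σ.sets.WF) {z : Fin n} (hz : z ∈ S.B)
    (hfresh : ∀ x, x ∉ S.B → S.inPtr x = σ.inn x) {a : Arc n} {rest : List (Arc n)}
    (ha : S.inPtr z = a :: rest) :
    backwardStep z σ S = (backwardStore σ z a, backwardSearch σ S z a rest) := by
  obtain ⟨g, q⟩ := a
  have hf : (σ.find g).f g = σ.f g := by rw [(Store.refresh_find hwf g).f_eq]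
  have hinn : (σ.find g).inn = σ.inn := rfl
  simp only [backwardStep, ha, hf, backwardStore, backwardSearch, visit, nextActive, dropLoop]
  by_cases hx : σ.f g ∈ S.B
  · by_cases hux : z = σ.f g
    · simp only [hx, if_true, if_pos hux, if_pos hux.symm]; rfl
    · simp only [hx, if_true, if_neg hux, if_neg (Ne.symm hux)]; rfl
  · have hux : z ≠ σ.f g := by rintro rfl; exact hx hz
    simp only [hx, if_false, if_neg hux, if_neg hux.symm, hinn]
    have : Function.update (Function.update S.inPtr z rest) (σ.f g) (σ.inn (σ.f g)) =
        Function.update S.inPtr z rest := by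
      rw [← hfresh _ hx, ← Function.update_of_ne hux.symm rest S.inPtr, Function.update_eq_self]
    rw [this]
    rfl

/-- Deleting a loop does not matter. -/
lemma mem_dropLoop {L : Fin n → List (Arc n)} {u x y : Fin n} {a b : Arc n} (h : b ∈ L y)
    (hb : u = x → b ≠ a) : b ∈ dropLoop L u x a y := by
  unfold dropLoop
  split_ifs with hux
  · rw [Function.update_apply]
    split_ifs with hy
    · subst hy
      exact (List.mem_erase_of_ne (hb hux)).2 h
    · exact h
  · exact h

lemma good_forwardStore {E : List (Arc n)} {σ : Store n} (h : σ.Good E) {u : Fin n} {a : Arc n}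
    (ha : a ∈ σ.out u) : (forwardStore σ u a).Good E ∧ (forwardStore σ u a).f = σ.f := by
  have r := Store.refresh_find h.wf a.2
  have g := h.refresh r
  have hf : (forwardStore σ u a).f = σ.f := r.f_eq
  have hsub := fun y => (dropLoop_subset σ.out u (σ.f a.2) a y).subset
  refine ⟨?_, hf⟩
  exact
    { wf := r.wf
      f_of_mem_out := fun x b hb => by rw [hf]; exact h.f_of_mem_out x b (hsub x hb)
      f_of_mem_inn := g.f_of_mem_inn
      nodup_out := fun x => (h.nodup_out x).sublist (dropLoop_subset _ _ _ _ _)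
      nodup_inn := g.nodup_inn
      correct := g.correct.congr (hf.trans r.f_eq.symm) rfl
      mem_of_mem_out := fun x b hb => h.mem_of_mem_out x b (hsub x hb)
      mem_of_mem_inn := g.mem_of_mem_inn
      mem_out := fun b hb hne => by
        rw [hf] at hne ⊢
        refine mem_dropLoop (h.mem_out b hb hne) ?_
        rintro h1 rfl
        exact hne ((h.f_of_mem_out u _ ha).trans h1)
      mem_inn := g.mem_inn }

lemma good_backwardStore {E : List (Arc n)} {σ : Store n} (h : σ.Good E) {u : Fin n} {a : Arc n}
    (ha : a ∈ σ.inn u) : (backwardStore σ u a).Good E ∧ (backwardStore σ u a).f = σ.f := by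
  have r := Store.refresh_find h.wf a.1
  have g := h.refresh r
  have hf : (backwardStore σ u a).f = σ.f := r.f_eq
  have hsub := fun y => (dropLoop_subset σ.inn u (σ.f a.1) a y).subset
  refine ⟨?_, hf⟩
  exact
    { wf := r.wf
      f_of_mem_inn := fun x b hb => by rw [hf]; exact h.f_of_mem_inn x b (hsub x hb)
      f_of_mem_out := g.f_of_mem_out
      nodup_inn := fun x => (h.nodup_inn x).sublist (dropLoop_subset _ _ _ _ _)
      nodup_out := g.nodup_out
      correct := g.correct.congr (hf.trans r.f_eq.symm) rfl
      mem_of_mem_inn := fun x b hb => h.mem_of_mem_inn x b (hsub x hb)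
      mem_of_mem_out := g.mem_of_mem_out
      mem_inn := fun b hb hne => by
        rw [hf] at hne ⊢
        refine mem_dropLoop (h.mem_inn b hb hne) ?_
        rintro h1 rfl
        exact hne ((h.f_of_mem_inn u _ ha).trans h1).symm
      mem_out := g.mem_out }

/-- A search step preserves the invariants, and the amortized cost drops by at least 2. -/
lemma search_step {E : List (Arc n)} {σ : Store n} {S : Search n} (hc : SearchCore E σ S)
    (hal : SearchAlive σ S) (A : ℕ) {u z : Fin n} (hu : u ∈ S.FA) (hz : z ∈ S.BA)
    (huz : σ.lt u z) :
    ∃ σ' S', backwardStep z (forwardStep u (σ.tick 1) S).1 (forwardStep u (σ.tick 1) S).2 =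
        (σ', S') ∧ SearchCore E σ' S' ∧ SearchAlive σ' S' ∧ S'.v = S.v ∧ S'.w = S.w ∧
      σ'.order = σ.order ∧ potential A σ' S' + 2 ≤ potential A σ S := by
  obtain ⟨hg, hsrc, hdst, hlt, T, hF, hB, hT⟩ := hc
  have hF0 : SearchAlive (σ.tick 1) S :=
    ⟨hal.fwd, hal.bwd, hal.le_of_mem_FP, hal.le_of_mem_BP, hal.s_mem, hal.cross⟩
  have r0 := Store.refresh_tick hg.wf 1
  have hg0 := hg.refresh r0
  -- the forward half
  obtain ⟨huF, hup⟩ := hal.fwd.live u (Or.inl hu)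
  obtain ⟨a, rest, ha⟩ := List.exists_cons_of_ne_nil hup
  have haL : a ∈ σ.out u := (hF.ptr_sublist u).subset (by rw [ha]; simp)
  have e1 : forwardStep u (σ.tick 1) S =
      (forwardStore (σ.tick 1) u a, forwardSearch (σ.tick 1) S u a rest) :=
    forwardStep_eq hg0.wf huF hF.fresh ha
  obtain ⟨hg1, hf1⟩ := good_forwardStore hg0 (u := u) (a := a) haL
  have hF1 := hF.step hg.mem_of_mem_out hg.f_of_mem_out hg.nodup_out huF ha
    ⟨hg.correct.f_f _, (hF.prop u huF).2.trans (hg.reach_of_mem_out haL)⟩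
  have hA1 := hal.fwd.step (a := a) (rest := rest) hu hF.fresh (σ.f a.2)
  have hX1 := hal.cross.step hal.fwd hu hF.fresh ha (x := σ.f a.2) (fun _ y (h : σ.le y u) => by
    have := hg.correct.idxOf_le_of_reach (hg.reach_of_mem_out haL)
    rw [(hF.prop u huF).1, hg.correct.f_f] at this
    exact Nat.le_trans h this)
  have p1 := pot_nextActive σ.lt_irrefl A S.s S.F S.FA S.FP S.BA S.BP
    (dropLoop σ.out u (σ.f a.2) a) rest (σ.f a.2) hu
  have t1 := total_update_tail ha
  set σ₁ := forwardStore (σ.tick 1) u a with hσ₁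
  set S₁ := forwardSearch (σ.tick 1) S u a rest with hS₁
  have c1 : σ₁.cost ≤ σ.cost + 3 := by
    have h1 := (r0.trans (Store.refresh_find r0.wf a.2)).cost_le
    exact h1
  -- the backward half
  obtain ⟨hzB, hzp⟩ := hal.bwd.live z (Or.inl hz)
  obtain ⟨b, rest', hb⟩ := List.exists_cons_of_ne_nil hzp
  have hbL : b ∈ σ.inn z := (hB.ptr_sublist z).subset (by rw [hb]; simp)
  have e2 : backwardStep z σ₁ S₁ = (backwardStore σ₁ z b, backwardSearch σ₁ S₁ z b rest') :=
    backwardStep_eq (S := S₁) hg1.wf hzB hB.fresh hb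
  obtain ⟨hg2, hf2⟩ := good_backwardStore hg1 (u := z) (a := b) hbL
  have hfx : σ₁.f = σ.f := hf1
  have hB1 := hB.step hg.mem_of_mem_inn hg.f_of_mem_inn hg.nodup_inn hzB hb
    ⟨hg.correct.f_f _, (hg.reach_of_mem_inn hbL).trans (hB.prop z hzB).2⟩
  have hA2 := hal.bwd.step (a := b) (rest := rest') hz hB.fresh (σ.f b.1)
  have hX2 := hX1.symm.step hal.bwd hz hB.fresh hb (x := σ.f b.1) (fun _ y (h : σ.le z y) => by
    have := hg.correct.idxOf_le_of_reach (hg.reach_of_mem_inn hbL)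
    rw [(hB.prop z hzB).1, hg.correct.f_f] at this
    exact Nat.le_trans this h)
  have p2 := pot_nextActive (r := fun x y => σ.lt y x) σ.lt_irrefl A S.s S.B S.BA S.BP
    S₁.FA S₁.FP (dropLoop σ.inn z (σ.f b.1) b) rest' (σ.f b.1) hz
  rw [pot_flip σ.lt, pot_flip σ.lt] at p2
  have t2 := total_update_tail hb
  have c2 : (backwardStore σ₁ z b).cost ≤ σ₁.cost + 2 := (Store.refresh_find hg1.wf b.1).cost_le
  refine ⟨backwardStore σ₁ z b, backwardSearch σ₁ S₁ z b rest', by rw [e1]; exact e2, ?_, ?_, rfl, rfl, rfl, ?_⟩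
  · refine ⟨hg2, ?_, ?_, hlt, (a, b) :: T, ?_, ?_, ?_⟩
    · rw [hf2, hfx]; exact hsrc
    · rw [hf2, hfx]; exact hdst
    · rw [hf2, hfx]; exact hF1
    · simp only [hf2, hfx]
      unfold backwardSearch backwardStore
      simp only [hfx]
      exact hB1
    · intro p hp
      rw [hf2, hfx]
      rcases List.mem_cons.1 hp with rfl | hp
      · rw [hg.f_of_mem_out u _ haL, hg.f_of_mem_inn z _ hbL]; exact huz
      · exact hT p hp
  · refine ⟨hA1, ?_, hal.le_of_mem_FP, hal.le_of_mem_BP, hal.s_mem, ?_⟩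
    · unfold backwardSearch
      simp only [hfx]
      exact hA2
    · unfold backwardSearch
      simp only [hfx]
      exact hX2.symm
  · unfold backwardSearch potential
    simp only [hfx]
    have q1 : pot σ.lt A S.s S₁.FA S₁.FP S.BA S.BP ≤ pot σ.lt A S.s S.FA S.FP S.BA S.BP + (A + 5) :=
      p1
    have t1' : total S₁.outPtr + 1 = total S.outPtr := t1
    have q2 : pot (backwardStore σ₁ z b).lt A S.s S₁.FA S₁.FP
        (nextActive S.B S.BA (dropLoop σ.inn z (σ.f b.1) b) rest' z (σ.f b.1)) S.BP ≤
        pot σ.lt A S.s S₁.FA S₁.FP S.BA S.BP + (A + 5) := p2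
    have t2' : total (Function.update S.inPtr z rest') + 1 = total S.inPtr := t2
    have e3 : (A + 9) * (total S.outPtr + total S.inPtr) =
        (A + 9) * (total S₁.outPtr + total (Function.update S.inPtr z rest')) + 2 * (A + 9) := by
      rw [← t1', ← t2']; ring
    have q2' : pot (backwardStore σ₁ z b).lt A S₁.s S₁.FA S₁.FP
        (nextActive S₁.B S₁.BA (dropLoop σ₁.inn z (σ.f b.1) b) rest' z (σ.f b.1)) S₁.BP ≤
        pot σ.lt A S.s S₁.FA S₁.FP S.BA S.BP + (A + 5) := q2
    have e4 : total (Function.update S₁.inPtr z rest') = total (Function.update S.inPtr z rest') :=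
      rfl
    rw [e4]
    omega

lemma Cross.retire_left {R : Fin n → Fin n → Prop} {V Ac Pa V₂ Ac₂ Pa₂ : List (Fin n)}
    {ptr ptr₂ : Fin n → List (Arc n)} (h : Cross R V ptr Ac Pa V₂ ptr₂ Ac₂ Pa₂) (u : Fin n) :
    Cross R V ptr (Ac.erase u) (u :: Pa) V₂ ptr₂ Ac₂ Pa₂ := by
  intro x hx hx' y hy hy'
  refine (h x hx hx' y hy hy').imp_left (And.imp_left fun h1 => ?_)
  by_cases hxu : x = u
  · exact Or.inr (by simp [hxu])
  · exact h1.imp (List.mem_erase_of_ne hxu).2 (List.mem_cons_of_mem u)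

/-- The body of the loop before the changes of the threshold. -/
lemma advance_step {E : List (Arc n)} {σ : Store n} {S : Search n} (hc : SearchCore E σ S)
    (hal : SearchAlive σ S) (A : ℕ) {u z : Fin n} (hu : u ∈ S.FA) (hz : z ∈ S.BA) :
    ∃ σ' S', advance u z σ S = (σ', S') ∧ SearchCore E σ' S' ∧ SearchAlive σ' S' ∧
      S'.v = S.v ∧ S'.w = S.w ∧ σ'.order = σ.order ∧ potential A σ' S' + 2 ≤ potential A σ S := by
  by_cases huz : σ.lt u z
  · have := search_step hc hal A hu hz huz
    simpa only [advance, huz, if_true] using this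
  · have hkey : ∀ {x y : Fin n}, x ∈ σ.order → σ.order.idxOf x = σ.order.idxOf y → x = y :=
      fun hx h => (List.idxOf_inj hx).1 h
    -- at least one of the two vertices becomes passive
    have hor : (σ.lt S.s u ∨ (u = z ∧ u = S.s)) ∨ σ.lt z S.s := by
      by_contra hcon
      simp only [not_or] at hcon
      obtain ⟨⟨h1, h2⟩, h3⟩ := hcon
      rw [Store.not_lt] at h1 h3 huz
      unfold Store.le at h1 h3 huz
      exact h2 ⟨(hkey hal.s_mem (by omega)).symm.trans (hkey hal.s_mem (by omega)),
        (hkey hal.s_mem (by omega)).symm⟩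
    set S₁ : Search n := if σ.lt S.s u ∨ (u = z ∧ u = S.s) then
        { S with FA := S.FA.erase u, FP := u :: S.FP } else S with hS₁
    set S₂ : Search n := if σ.lt z S₁.s then
        { S₁ with BA := S₁.BA.erase z, BP := z :: S₁.BP } else S₁ with hS₂
    have h1 : SearchCore E σ S₁ ∧ SearchAlive σ S₁ ∧ S₁.v = S.v ∧ S₁.w = S.w ∧ S₁.s = S.s ∧
        S₁.BA = S.BA ∧ potential A σ S₁ + (if σ.lt S.s u ∨ (u = z ∧ u = S.s) then 3 else 0) ≤
          potential A σ S := by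
      rw [hS₁]
      split_ifs with hif
      · refine ⟨⟨hc.1, hc.2, hc.3, hc.4, hc.5⟩, ⟨hal.fwd.retire hu, hal.bwd, ?_,
          hal.le_of_mem_BP, hal.s_mem, hal.cross.retire_left u⟩, rfl, rfl, rfl, rfl, ?_⟩
        · intro x hx
          rcases List.mem_cons.1 hx with rfl | hx
          · rcases hif with h | h
            · exact Nat.le_of_lt h
            · rw [h.2]; exact Nat.le_refl _
          · exact hal.le_of_mem_FP x hx
        · have := pot_retire (r := σ.lt) A S.s S.FP S.BA S.BP hu
            (by
              rcases hif with h | h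
              · exact Nat.lt_asymm h
              · rw [h.2]; exact σ.lt_irrefl _)
            (by
              intro hus
              rcases hif with h | h
              · rw [hus] at h; exact absurd h (σ.lt_irrefl _)
              · rw [← hus, h.1]; exact hz)
          unfold potential
          simp only
          omega
      · exact ⟨hc, hal, rfl, rfl, rfl, rfl, le_rfl⟩
    obtain ⟨hc1, hal1, hv1, hw1, hs1, hBA1, hp1⟩ := h1
    have h2 : SearchCore E σ S₂ ∧ SearchAlive σ S₂ ∧ S₂.v = S.v ∧ S₂.w = S.w ∧
        potential A σ S₂ + (if σ.lt z S₁.s then 3 else 0) ≤ potential A σ S₁ := by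
      rw [hS₂]
      split_ifs with hif
      · refine ⟨⟨hc1.1, hc1.2, hc1.3, hc1.4, hc1.5⟩, ⟨hal1.fwd, hal1.bwd.retire (hBA1 ▸ hz),
          hal1.le_of_mem_FP, ?_, hal1.s_mem, (hal1.cross.symm.retire_left z).symm⟩, hv1, hw1, ?_⟩
        · intro x hx
          rcases List.mem_cons.1 hx with rfl | hx
          · exact Nat.le_of_lt hif
          · exact hal1.le_of_mem_BP x hx
        · have := pot_retire (r := fun x y => σ.lt y x) A S₁.s S₁.BP S₁.FA S₁.FP (hBA1 ▸ hz)
            (Nat.lt_asymm hif)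
            (by intro hzs; rw [hzs] at hif; exact absurd hif (σ.lt_irrefl _))
          rw [pot_flip σ.lt, pot_flip σ.lt] at this
          unfold potential
          simp only
          omega
      · exact ⟨hc1, hal1, hv1, hw1, le_rfl⟩
    obtain ⟨hc2, hal2, hv2, hw2, hp2⟩ := h2
    have r := Store.refresh_tick hc2.good.wf 1
    refine ⟨σ.tick 1, S₂, ?_, ⟨hc2.good.refresh r, hc2.2, hc2.3, hc2.4, hc2.5⟩,
      ⟨hal2.1, hal2.2, hal2.3, hal2.4, hal2.5, hal2.6⟩, hv2, hw2, rfl, ?_⟩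
    · simp only [advance, huz, if_false]
      rfl
    · have h3 : potential A (σ.tick 1) S₂ ≤ potential A σ S₂ + 1 := by
        have := r.cost_le
        have h4 : pot (σ.tick 1).lt A S₂.s S₂.FA S₂.FP S₂.BA S₂.BP =
          pot σ.lt A S₂.s S₂.FA S₂.FP S₂.BA S₂.BP := rfl
        unfold potential
        omega
      rcases hor with h | h
      · simp only [h, if_true] at hp1
        omega
      · rw [← hs1] at h
        simp only [h, if_true] at hp2
        omega

end StrongComp

/-! ### Changes of the threshold -/

namespace StrongComp

variable {n : ℕ}

/-- What the expectation and the supremum over the support have in common. -/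
structure Averaging (Ev : (α : Type) → PMF α → (α → ℝ≥0∞) → ℝ≥0∞) : Prop where
  pure_eq : ∀ (α : Type) (a : α) (g : α → ℝ≥0∞), Ev α (PMF.pure a) g = g a
  bind_eq : ∀ (α β : Type) (p : PMF α) (q : α → PMF β) (g : β → ℝ≥0∞),
    Ev β (p.bind q) g = Ev α p fun a => Ev β (q a) g
  mono : ∀ (α : Type) (p : PMF α) (g h : α → ℝ≥0∞), (∀ a, g a ≤ h a) → Ev α p g ≤ Ev α p h

lemma Averaging.map_eq {Ev : (α : Type) → PMF α → (α → ℝ≥0∞) → ℝ≥0∞} (hEv : Averaging Ev)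
    {α β : Type} (p : PMF α) (q : α → β) (g : β → ℝ≥0∞) :
    Ev β (p.map q) g = Ev α p fun a => g (q a) := by
  have : p.map q = p.bind (PMF.pure ∘ q) := rfl
  rw [this, hEv.bind_eq]
  simp only [Function.comp, hEv.pure_eq]

/-- The potential `A * balance` released by a threshold pays, on average, four units per
candidate. -/
def Fair (Ev : (α : Type) → PMF α → (α → ℝ≥0∞) → ℝ≥0∞) (A : ℕ) (σ : Store n)
    (choose : List (Fin n) → PMF (Fin n)) : Prop :=
  ∀ P : List (Fin n), P ≠ [] → P.Nodup → (∀ x ∈ P, x ∈ σ.order) →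
    ∀ (b : ℝ) (g : Fin n → ℝ) (G : Fin n → ℝ≥0∞),
      (∀ s ∈ P, 0 ≤ g s ∧ G s ≤ ENNReal.ofReal (g s) ∧
        g s + A * balance σ.lt P s ≤ b + 4 * P.length) →
      Ev (Fin n) (choose P) G ≤ ENNReal.ofReal b

lemma Cross.congr {R : Fin n → Fin n → Prop} {V Ac Pa Ac' Pa' V₂ Ac₂ Pa₂ : List (Fin n)}
    {ptr ptr₂ : Fin n → List (Arc n)} (h : Cross R V ptr Ac Pa V₂ ptr₂ Ac₂ Pa₂)
    (hsub : ∀ x, x ∈ Ac ∨ x ∈ Pa → x ∈ Ac' ∨ x ∈ Pa') : Cross R V ptr Ac' Pa' V₂ ptr₂ Ac₂ Pa₂ :=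
  fun x hx hx' y hy hy' => (h x hx hx' y hy hy').imp_left (And.imp_left (hsub x))

/-- The passive vertices `Pa₂` and the threshold `s` cease to be alive, when all vertices alive in
the other direction are passive. -/
lemma Cross.kill {R : Fin n → Fin n → Prop} {V Pa V₂ Ac₂ Pa₂ : List (Fin n)}
    {ptr ptr₂ : Fin n → List (Arc n)} (h : Cross R V ptr [] Pa V₂ ptr₂ Ac₂ Pa₂) {s : Fin n}
    (h1 : ∀ x ∈ Pa, R x s) (h2 : ∀ x ∈ Pa, ∀ y ∈ Pa₂, R x y) :
    Cross R V ptr [] Pa V₂ ptr₂ (Ac₂.erase s) [] := by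
  intro x hx hx' y hy hy'
  rcases h x hx hx' y hy hy' with ⟨h3, h4⟩ | h3
  · have h3 := h3.resolve_left (by simp)
    rcases h4 with h4 | h4
    · by_cases hys : y = s
      · exact Or.inr (hys ▸ h1 x h3)
      · exact Or.inl ⟨Or.inr h3, Or.inl ((List.mem_erase_of_ne hys).2 h4)⟩
    · exact Or.inr (h2 x h3 y h4)
  · exact Or.inr h3

lemma mem_filter_or_filter_not {P : List (Fin n)} {p : Fin n → Prop} [DecidablePred p] {x : Fin n}
    (hx : x ∈ P) : x ∈ P.filter (fun x => p x) ∨ x ∈ P.filter (fun x => ¬ p x) := by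
  by_cases h : p x <;> simp [hx, h]

lemma Store.Good.eq_of_not_lt {E : List (Arc n)} {σ : Store n} (h : σ.Good E) {x y : Fin n}
    (hx : x ∈ σ.order) (h1 : ¬ σ.lt y x) (h2 : ¬ σ.lt x y) : x = y :=
  h.correct.idxOf_inj ((h.correct.mem_order_iff x).1 hx) (by
    rw [Store.not_lt] at h1 h2; exact Nat.le_antisymm h1 h2)

section Change

variable {Ev : (α : Type) → PMF α → (α → ℝ≥0∞) → ℝ≥0∞} {A : ℕ} {E : List (Arc n)}
  {σ : Store n} {S : Search n} {choose : List (Fin n) → PMF (Fin n)}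

lemma SearchCore.mem_order_of_mem_F (hc : SearchCore E σ S) {x : Fin n} (hx : x ∈ S.F) :
    x ∈ σ.order := by
  obtain ⟨T, hF, -, -⟩ := hc.trace
  exact (hc.good.correct.mem_order_iff x).2 (hF.prop x hx).1

lemma SearchCore.mem_order_of_mem_B (hc : SearchCore E σ S) {x : Fin n} (hx : x ∈ S.B) :
    x ∈ σ.order := by
  obtain ⟨T, -, hB, -⟩ := hc.trace
  exact (hc.good.correct.mem_order_iff x).2 (hB.prop x hx).1

/-- The amortized cost of the block executed when `FA` has become empty. -/
lemma forwardChange_drift (hEv : Averaging Ev) (hch : Fair Ev A σ choose)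
    (hc : SearchCore E σ S) (hal : SearchAlive σ S) {β : ℝ} (hβ : 0 ≤ β)
    {G : Store n × Search n × List (Fin n) → ℝ≥0∞}
    (hG : ∀ σ' S' l, SearchCore E σ' S' → SearchAlive σ' S' → S'.v = S.v → S'.w = S.w →
      σ'.order = σ.order → (S'.FA = [] → S'.FP = []) →
      G (σ', S', l) ≤ ENNReal.ofReal (potential A σ' S' + β)) :
    Ev _ (forwardChange choose (σ, S)) G ≤ ENNReal.ofReal (potential A σ S + 1 + β) := by
  unfold forwardChange
  simp only
  by_cases hFA : S.FA = []
  swap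
  · rw [if_neg hFA, hEv.pure_eq]
    refine (hG σ S [] hc hal rfl rfl rfl fun h => absurd h hFA).trans ?_
    exact ENNReal.ofReal_le_ofReal (by linarith)
  rw [if_pos hFA]
  have hfwd := hal.fwd
  have hcross := hal.cross
  rw [hFA] at hfwd hcross
  have hkill := hcross.kill (s := S.s) hal.le_of_mem_FP
    fun x hx y hy => Nat.le_trans (hal.le_of_mem_BP y hy) (hal.le_of_mem_FP x hx)
  set k := 1 + S.FP.length + S.BP.length with hk
  have r := Store.refresh_tick hc.good.wf k
  have hcost := r.cost_le
  by_cases hFP : S.FP = []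
  · rw [if_pos hFP, hEv.pure_eq]
    refine (hG (σ.tick k) { S with BP := [], BA := S.BA.erase S.s } []
      ⟨hc.good.refresh r, hc.2, hc.3, hc.4, hc.5⟩ ⟨hal.fwd, hal.bwd.kill S.s,
      hal.le_of_mem_FP, fun _ h => absurd h (by simp), hal.s_mem, ?_⟩ rfl rfl rfl
      fun _ => hFP).trans ?_
    · simp only [hFA]; exact hkill
    · refine ENNReal.ofReal_le_ofReal ?_
      have h1 := pot_kill (r := σ.lt) A S.s S.BA S.BP
      have h2 : potential A (σ.tick k) { S with BP := [], BA := S.BA.erase S.s } ≤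
          potential A σ S + 1 := by
        have h3 : pot (σ.tick k).lt A S.s S.FA S.FP (S.BA.erase S.s) [] =
          pot σ.lt A S.s [] [] (S.BA.erase S.s) [] := by rw [hFA, hFP]; rfl
        unfold potential
        simp only
        rw [h3, hFA, hFP]
        rw [hFP, List.length_nil] at hk
        omega
      have h2' : (potential A (σ.tick k) { S with BP := [], BA := S.BA.erase S.s } : ℝ) ≤
        potential A σ S + 1 := by exact_mod_cast h2
      linarith
  rw [if_neg hFP, hEv.map_eq]
  set S' : Fin n → Search n := fun s => { S with
    BP := [], BA := S.BA.erase S.s, s := s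
    FA := S.FP.filter fun x => σ.le x s
    FP := S.FP.filter fun x => ¬ σ.le x s } with hS'
  refine hch S.FP hFP hal.fwd.nodup_passive
    (fun x hx => hc.mem_order_of_mem_F (hal.fwd.live x (Or.inr hx)).1) _
    (fun s => potential A (σ.tick k) (S' s) + β) _ fun s hs => ⟨by positivity, ?_, ?_⟩
  · refine hG _ _ _ ⟨hc.good.refresh r, hc.2, hc.3, hc.4, hc.5⟩
      ⟨hfwd.split fun x => σ.le x s, hal.bwd.kill S.s, ?_,
        fun _ h => absurd h (by simp), ?_, ?_⟩ rfl rfl rfl ?_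
    · intro x hx
      simp only [List.mem_filter, decide_eq_true_eq] at hx
      exact (Nat.le_total _ _).resolve_left hx.2
    · exact hc.mem_order_of_mem_F (hal.fwd.live s (Or.inr hs)).1
    · refine hkill.congr fun x hx => mem_filter_or_filter_not (hx.resolve_left (by simp))
    · intro h
      have : s ∈ S.FP.filter fun x => σ.le x s := by simp [hs, Store.le]
      have h' : S.FP.filter (fun x => σ.le x s) = [] := h
      rw [h'] at this
      simp at this
  · have h1 := pot_change (r := σ.lt) σ.lt_irrefl A S.s S.BA S.BP hal.fwd.nodup_passive hs
      fun x hx h1 h2 => hc.good.eq_of_not_lt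
        (hc.mem_order_of_mem_F (hal.fwd.live x (Or.inr hx)).1) h1 h2
    simp only [Store.not_lt] at h1
    have h2 : potential A (σ.tick k) (S' s) + A * balance σ.lt S.FP s ≤
        potential A σ S + 1 + 4 * S.FP.length := by
      have h3 : pot (σ.tick k).lt A (S' s).s (S' s).FA (S' s).FP (S' s).BA (S' s).BP =
        pot σ.lt A s (S.FP.filter fun x => σ.le x s) (S.FP.filter fun x => ¬ σ.le x s)
          (S.BA.erase S.s) [] := rfl
      unfold potential
      rw [h3, hFA]
      have h4 : total (S' s).outPtr + total (S' s).inPtr = total S.outPtr + total S.inPtr := rfl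
      rw [h4]
      omega
    have h2' : (potential A (σ.tick k) (S' s) : ℝ) + A * balance σ.lt S.FP s ≤
        potential A σ S + 1 + 4 * S.FP.length := by exact_mod_cast h2
    linarith

/-- The amortized cost of the block executed when `BA` has become empty. -/
lemma backwardChange_drift (hEv : Averaging Ev) (hch : Fair Ev A σ choose)
    (hc : SearchCore E σ S) (hal : SearchAlive σ S) (hexit : S.FA = [] → S.FP = []) {β : ℝ}
    (hβ : 0 ≤ β) {G : Store n × Search n × List (Fin n) → ℝ≥0∞}
    (hG : ∀ σ' S' l, SearchCore E σ' S' → SearchAlive σ' S' → S'.v = S.v → S'.w = S.w →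
      σ'.order = σ.order → (S'.FA = [] → S'.FP = []) → (S'.BA = [] → S'.BP = []) →
      G (σ', S', l) ≤ ENNReal.ofReal (potential A σ' S' + β)) :
    Ev _ (backwardChange choose (σ, S)) G ≤ ENNReal.ofReal (potential A σ S + 1 + β) := by
  unfold backwardChange
  simp only
  by_cases hBA : S.BA = []
  swap
  · rw [if_neg hBA, hEv.pure_eq]
    refine (hG σ S [] hc hal rfl rfl rfl hexit fun h => absurd h hBA).trans ?_
    exact ENNReal.ofReal_le_ofReal (by linarith)
  rw [if_pos hBA]
  have hbwd := hal.bwd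
  have hcross := hal.cross.symm
  rw [hBA] at hbwd hcross
  have hkill := hcross.kill (s := S.s) hal.le_of_mem_BP
    fun x hx y hy => Nat.le_trans (hal.le_of_mem_BP x hx) (hal.le_of_mem_FP y hy)
  set k := 1 + S.FP.length + S.BP.length with hk
  have r := Store.refresh_tick hc.good.wf k
  have hcost := r.cost_le
  by_cases hBP : S.BP = []
  · rw [if_pos hBP, hEv.pure_eq]
    refine (hG (σ.tick k) { S with FP := [], FA := S.FA.erase S.s } []
      ⟨hc.good.refresh r, hc.2, hc.3, hc.4, hc.5⟩ ⟨hal.fwd.kill S.s, hal.bwd,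
      fun _ h => absurd h (by simp), hal.le_of_mem_BP, hal.s_mem, ?_⟩ rfl rfl rfl
      (fun _ => rfl) fun _ => hBP).trans ?_
    · simp only [hBA]; exact hkill.symm
    · refine ENNReal.ofReal_le_ofReal ?_
      have h1 := pot_kill (r := fun x y => σ.lt y x) A S.s S.FA S.FP
      rw [pot_flip σ.lt, pot_flip σ.lt] at h1
      have h2 : potential A (σ.tick k) { S with FP := [], FA := S.FA.erase S.s } ≤
          potential A σ S + 1 := by
        have h3 : pot (σ.tick k).lt A S.s (S.FA.erase S.s) [] S.BA S.BP =
          pot σ.lt A S.s (S.FA.erase S.s) [] [] [] := by rw [hBA, hBP]; rfl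
        unfold potential
        simp only
        rw [h3, hBA, hBP]
        rw [hBP, List.length_nil] at hk
        omega
      have h2' : (potential A (σ.tick k) { S with FP := [], FA := S.FA.erase S.s } : ℝ) ≤
        potential A σ S + 1 := by exact_mod_cast h2
      linarith
  rw [if_neg hBP, hEv.map_eq]
  set S' : Fin n → Search n := fun s => { S with
    FP := [], FA := S.FA.erase S.s, s := s
    BA := S.BP.filter fun x => σ.le s x
    BP := S.BP.filter fun x => ¬ σ.le s x } with hS'
  refine hch S.BP hBP hal.bwd.nodup_passive
    (fun x hx => hc.mem_order_of_mem_B (hal.bwd.live x (Or.inr hx)).1) _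
    (fun s => potential A (σ.tick k) (S' s) + β) _ fun s hs => ⟨by positivity, ?_, ?_⟩
  · refine hG _ _ _ ⟨hc.good.refresh r, hc.2, hc.3, hc.4, hc.5⟩
      ⟨hal.fwd.kill S.s, hbwd.split fun x => σ.le s x, fun _ h => absurd h (by simp), ?_, ?_, ?_⟩
      rfl rfl rfl (fun _ => rfl) ?_
    · intro x hx
      simp only [List.mem_filter, decide_eq_true_eq] at hx
      exact (Nat.le_total _ _).resolve_left hx.2
    · exact hc.mem_order_of_mem_B (hal.bwd.live s (Or.inr hs)).1
    · exact (hkill.congr fun x hx => mem_filter_or_filter_not (hx.resolve_left (by simp))).symm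
    · intro h
      have : s ∈ S.BP.filter fun x => σ.le s x := by simp [hs, Store.le]
      have h' : S.BP.filter (fun x => σ.le s x) = [] := h
      rw [h'] at this
      simp at this
  · have h1 := pot_change (r := fun x y => σ.lt y x) σ.lt_irrefl A S.s S.FA S.FP
      hal.bwd.nodup_passive hs
      fun x hx h1 h2 => hc.good.eq_of_not_lt
        (hc.mem_order_of_mem_B (hal.bwd.live x (Or.inr hx)).1) h2 h1
    rw [pot_flip σ.lt, pot_flip σ.lt, balance_flip] at h1
    simp only [Store.not_lt] at h1
    have h2 : potential A (σ.tick k) (S' s) + A * balance σ.lt S.BP s ≤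
        potential A σ S + 1 + 4 * S.BP.length := by
      have h3 : pot (σ.tick k).lt A (S' s).s (S' s).FA (S' s).FP (S' s).BA (S' s).BP =
        pot σ.lt A s (S.FA.erase S.s) [] (S.BP.filter fun x => σ.le s x)
          (S.BP.filter fun x => ¬ σ.le s x) := rfl
      unfold potential
      rw [h3, hBA]
      have h4 : total (S' s).outPtr + total (S' s).inPtr = total S.outPtr + total S.inPtr := rfl
      rw [h4]
      omega
    have h2' : (potential A (σ.tick k) (S' s) : ℝ) + A * balance σ.lt S.BP s ≤
        potential A σ S + 1 + 4 * S.BP.length := by exact_mod_cast h2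
    linarith

/-- An iteration of the loop does not increase the amortized cost. -/
lemma iteration_drift (hEv : Averaging Ev) {pol : Policy n} {c : Config n}
    (hch : Fair Ev A c.store (pol.threshold c)) (hc : SearchCore E c.store S)
    (hal : SearchAlive c.store S) (hpair : (pol.pair c).1 ∈ S.FA ∧ (pol.pair c).2 ∈ S.BA)
    {β : ℝ} (hβ : 0 ≤ β) {G : Config n → ℝ≥0∞}
    (hG : ∀ σ' S' l, SearchCore E σ' S' → SearchAlive σ' S' → S'.v = S.v → S'.w = S.w →
      (S'.FA = [] → S'.FP = []) → (S'.BA = [] → S'.BP = []) →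
      G { c with store := σ', search := some S', log := l } ≤
        ENNReal.ofReal (potential A σ' S' + β)) :
    Ev _ (iteration pol c S) G ≤ ENNReal.ofReal (potential A c.store S + β) := by
  obtain ⟨σ₁, S₁, e, hc1, hal1, hv1, hw1, ho1, hp1⟩ := advance_step hc hal A hpair.1 hpair.2
  have hfair : ∀ σ' : Store n, σ'.order = c.store.order → Fair Ev A σ' (pol.threshold c) := by
    intro σ' ho P h1 h2 h3 b g G hg
    refine hch P h1 h2 (ho ▸ h3) b g G fun s hs => ?_
    refine ⟨(hg s hs).1, (hg s hs).2.1, le_trans (le_of_eq ?_) (hg s hs).2.2⟩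
    congr 3
    unfold balance Store.lt
    simp only [ho]
    rfl
  unfold iteration
  rw [hEv.bind_eq, e]
  -- the two units released here pay the constant term of the two blocks
  have hp1' : (potential A σ₁ S₁ : ℝ) + 2 ≤ potential A c.store S := by exact_mod_cast hp1
  refine (forwardChange_drift (β := 1 + β) hEv (hfair _ ho1) hc1 hal1 (by linarith)
    fun σ₂ S₂ l hc2 hal2 hv2 hw2 ho2 hex2 => ?_).trans
      (ENNReal.ofReal_le_ofReal (by linarith))
  rw [hEv.map_eq]
  have e3 : (potential A σ₂ S₂ : ℝ) + (1 + β) = potential A σ₂ S₂ + 1 + β := by ring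
  rw [e3]
  refine backwardChange_drift hEv (hfair _ (ho2.trans ho1)) hc2 hal2 hex2 hβ
    fun σ₃ S₃ l' hc3 hal3 hv3 hw3 _ hex3 hex3' => ?_
  exact hG σ₃ S₃ _ hc3 hal3 (hv3.trans (hv2.trans hv1)) (hw3.trans (hw2.trans hw1)) hex3 hex3'

end Change

end StrongComp

/-! ### Positions in lists -/

namespace StrongComp

/-- `x` occurs before `y` in the list. -/
def Before {α : Type*} (l : List α) (x y : α) : Prop := [x, y].Sublist l

section Before

variable {α : Type*} {l l' : List α} {x y z : α}

lemma Before.mono (h : Before l x y) (hl : l.Sublist l') : Before l' x y := List.Sublist.trans h hl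

lemma before_append (hx : x ∈ l) (hy : y ∈ l') : Before (l ++ l') x y :=
  List.Sublist.append (List.singleton_sublist.2 hx) (List.singleton_sublist.2 hy)

lemma before_cons (hy : y ∈ l) : Before (x :: l) x y :=
  (List.singleton_sublist.2 hy).cons_cons x

lemma Before.append_left (h : Before l x y) : Before (l ++ l') x y :=
  h.mono (List.sublist_append_left _ _)

lemma Before.append_right (h : Before l' x y) : Before (l ++ l') x y :=
  h.mono (List.sublist_append_right _ _)

lemma Before.cons (h : Before l x y) : Before (z :: l) x y := h.mono (List.sublist_cons_self _ _)

lemma Before.filter (h : Before l x y) {p : α → Bool} (hx : p x) (hy : p y) :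
    Before (l.filter p) x y := by
  unfold Before
  have := List.Sublist.filter p h
  simpa [List.filter_cons, hx, hy] using this

variable [DecidableEq α]

lemma before_of_idxOf_lt (hy : y ∈ l) (h : l.idxOf x < l.idxOf y) : Before l x y := by
  induction l with
  | nil => simp at hy
  | cons c l ih =>
    by_cases hyc : c = y
    · subst hyc; simp at h
    · have hyl : y ∈ l := (List.mem_cons.1 hy).resolve_left (Ne.symm hyc)
      by_cases hxc : c = x
      · subst hxc; exact before_cons hyl
      · rw [List.idxOf_cons_ne _ hxc, List.idxOf_cons_ne _ hyc] at h
        exact (ih hyl (by omega)).cons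

lemma Before.idxOf_lt (h : Before l x y) (hnd : l.Nodup) : l.idxOf x < l.idxOf y := by
  induction l with
  | nil => simp [Before] at h
  | cons c l ih =>
    obtain ⟨hc, hnd⟩ := List.nodup_cons.1 hnd
    rcases List.sublist_cons_iff.1 h with h1 | ⟨r, h1, h2⟩
    · have hx : c ≠ x := by rintro rfl; exact hc (h1.subset (by simp))
      have hy : c ≠ y := by rintro rfl; exact hc (h1.subset (by simp))
      rw [List.idxOf_cons_ne _ hx, List.idxOf_cons_ne _ hy]
      exact Nat.succ_lt_succ (ih h1 hnd)
    · obtain ⟨rfl, rfl⟩ := List.cons.inj h1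
      have hyl : y ∈ l := h2.subset (by simp)
      have hy : x ≠ y := by rintro rfl; exact hc hyl
      rw [List.idxOf_cons_self, List.idxOf_cons_ne _ hy]
      exact Nat.succ_pos _

lemma Before.trans (h : Before l x y) (h' : Before l y z) (hnd : l.Nodup) : Before l x z :=
  before_of_idxOf_lt (h'.subset (by simp)) ((h.idxOf_lt hnd).trans (h'.idxOf_lt hnd))

lemma before_or_before (hx : x ∈ l) (hy : y ∈ l) (hxy : x ≠ y) : Before l x y ∨ Before l y x := by
  rcases lt_trichotomy (l.idxOf x) (l.idxOf y) with h | h | h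
  · exact Or.inl (before_of_idxOf_lt hy h)
  · exact absurd ((List.idxOf_inj hx).1 h) hxy
  · exact Or.inr (before_of_idxOf_lt hx h)

end Before

variable {n : ℕ}

lemma reorder_eq {P Q Fs Bs : List (Fin n)} {t dst : Fin n} (htP : t ∉ P) (htF : t ∉ Fs)
    (htB : t ∉ Bs) : reorder (P ++ t :: Q) Fs Bs t dst =
      if t = dst then (P.filter fun x => x ∉ Fs ∧ x ∉ Bs) ++
        t :: (Fs ++ Q.filter fun x => x ∉ Fs ∧ x ∉ Bs)
      else (P.filter fun x => x ∉ Fs ∧ x ∉ Bs) ++ Bs ++ Fs ++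
        t :: (Q.filter fun x => x ∉ Fs ∧ x ∉ Bs) := by
  have h1 : (P ++ t :: Q).filter (fun x => x ∉ Fs ∧ x ∉ Bs) =
      (P.filter fun x => x ∉ Fs ∧ x ∉ Bs) ++ t :: (Q.filter fun x => x ∉ Fs ∧ x ∉ Bs) := by
    rw [List.filter_append, List.filter_cons_of_pos]
    simp [htF, htB]
  have h2 : ∀ x ∈ P.filter (fun x => x ∉ Fs ∧ x ∉ Bs), decide (x ≠ t) = true := by
    intro x hx
    have hx' := List.mem_of_mem_filter hx
    simp only [decide_eq_true_eq]
    rintro rfl; exact htP hx'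
  unfold reorder
  simp only [h1]
  rw [List.takeWhile_append_of_pos h2, List.dropWhile_append_of_pos h2]
  simp

/-! ### The vertices that a stopped search has found -/

/-- A search that has stopped: each forward vertex with untraversed arcs is not before any
backward vertex with untraversed arcs. -/
structure Stopped (E : List (Arc n)) (σ : Store n) (S : Search n) : Prop
    extends SearchCore E σ S where
  le_of_live : ∀ x ∈ S.F, S.outPtr x ≠ [] → ∀ y ∈ S.B, S.inPtr y ≠ [] → σ.le y x

lemma SearchAlive.stopped {E : List (Arc n)} {σ : Store n} {S : Search n}
    (h : SearchAlive σ S) (hc : SearchCore E σ S) (hdone : S.FA = [] ∨ S.BA = [])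
    (hF : S.FA = [] → S.FP = []) (hB : S.BA = [] → S.BP = []) : Stopped E σ S where
  toSearchCore := hc
  le_of_live x hx hx' y hy hy' := by
    refine (h.cross x hx hx' y hy hy').resolve_left fun h1 => ?_
    rcases hdone with h2 | h2
    · have := h1.1; rw [h2, hF h2] at this; simp at this
    · have := h1.2; rw [h2, hB h2] at this; simp at this

lemma pivot_foldl_spec (σ : Store n) (ptr : Fin n → List (Arc n)) (l : List (Fin n)) (d : Fin n) :
    let t := l.foldl (fun t x => if ptr x ≠ [] ∧ σ.lt x t then x else t) d
    (t = d ∨ (t ∈ l ∧ ptr t ≠ [])) ∧ σ.le t d ∧ ∀ x ∈ l, ptr x ≠ [] → σ.le t x := by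
  induction l generalizing d with
  | nil => exact ⟨Or.inl rfl, Nat.le_refl _, fun x hx => absurd hx (by simp)⟩
  | cons c l ih =>
    obtain ⟨h1, h2, h3⟩ := ih (if ptr c ≠ [] ∧ σ.lt c d then c else d)
    simp only [List.foldl_cons]
    set t := l.foldl (fun t x => if ptr x ≠ [] ∧ σ.lt x t then x else t)
      (if ptr c ≠ [] ∧ σ.lt c d then c else d)
    by_cases hc : ptr c ≠ [] ∧ σ.lt c d
    · rw [if_pos hc] at h1 h2
      refine ⟨Or.inr ?_, Nat.le_trans h2 (Nat.le_of_lt hc.2), fun x hx hx' => ?_⟩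
      · rcases h1 with h1 | h1
        · rw [h1]; exact ⟨by simp, hc.1⟩
        · exact ⟨List.mem_cons_of_mem _ h1.1, h1.2⟩
      · rcases List.mem_cons.1 hx with rfl | hx
        · exact h2
        · exact h3 x hx hx'
    · rw [if_neg hc] at h1 h2
      refine ⟨h1.imp_right fun h => ⟨List.mem_cons_of_mem _ h.1, h.2⟩, h2, fun x hx hx' => ?_⟩
      rcases List.mem_cons.1 hx with rfl | hx
      · have h4 : ¬ σ.lt x d := fun h => hc ⟨hx', h⟩
        exact Nat.le_trans h2 (Store.not_lt.1 h4)
      · exact h3 x hx hx'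

section Stopped

variable {E : List (Arc n)} {σ : Store n} {S : Search n}

lemma pivot_eq_or (σ : Store n) (S : Search n) :
    pivot σ S = S.dst ∨ (pivot σ S ∈ S.F ∧ S.outPtr (pivot σ S) ≠ []) :=
  (pivot_foldl_spec σ S.outPtr S.F S.dst).1

lemma pivot_le_dst (σ : Store n) (S : Search n) : σ.le (pivot σ S) S.dst :=
  (pivot_foldl_spec σ S.outPtr S.F S.dst).2.1

lemma pivot_le (σ : Store n) (S : Search n) {x : Fin n} (hx : x ∈ S.F) (hx' : S.outPtr x ≠ []) :
    σ.le (pivot σ S) x := (pivot_foldl_spec σ S.outPtr S.F S.dst).2.2 x hx hx'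

lemma mem_forwardSet {x : Fin n} : x ∈ forwardSet σ S ↔ x ∈ S.F ∧ σ.lt x (pivot σ S) := by
  simp [forwardSet]

lemma mem_backwardSet {x : Fin n} : x ∈ backwardSet σ S ↔ x ∈ S.B ∧ σ.lt (pivot σ S) x := by
  simp [backwardSet]

lemma mem_subgraphVertices {x : Fin n} : x ∈ subgraphVertices σ S ↔
    x ∈ forwardSet σ S ∨ x = pivot σ S ∨ x ∈ backwardSet σ S := by
  simp [subgraphVertices]

lemma SearchCore.prop_F (h : SearchCore E σ S) {x : Fin n} (hx : x ∈ S.F) :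
    σ.f x = x ∧ Reach E S.src x := by
  obtain ⟨T, hF, -, -⟩ := h.trace; exact hF.prop x hx

lemma SearchCore.prop_B (h : SearchCore E σ S) {x : Fin n} (hx : x ∈ S.B) :
    σ.f x = x ∧ Reach E x S.dst := by
  obtain ⟨T, -, hB, -⟩ := h.trace; exact hB.prop x hx

lemma SearchCore.src_mem (h : SearchCore E σ S) : S.src ∈ S.F := by
  obtain ⟨T, hF, -, -⟩ := h.trace; exact hF.root_mem

lemma SearchCore.dst_mem (h : SearchCore E σ S) : S.dst ∈ S.B := by
  obtain ⟨T, -, hB, -⟩ := h.trace; exact hB.root_mem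

lemma SearchCore.f_dst (h : SearchCore E σ S) : σ.f S.dst = S.dst := (h.prop_B h.dst_mem).1

lemma SearchCore.f_src (h : SearchCore E σ S) : σ.f S.src = S.src := (h.prop_F h.src_mem).1

lemma SearchCore.le_dst (h : SearchCore E σ S) {y : Fin n} (hy : σ.f y = y)
    (hr : Reach E y S.dst) : σ.le y S.dst := by
  have := h.good.correct.idxOf_le_of_reach hr
  rwa [hy, h.f_dst] at this

lemma SearchCore.src_le (h : SearchCore E σ S) {x : Fin n} (hx : x ∈ S.F) : σ.le S.src x := by
  have := h.good.correct.idxOf_le_of_reach (h.prop_F hx).2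
  rwa [(h.prop_F hx).1, h.f_src] at this

lemma SearchCore.f_pivot (h : SearchCore E σ S) : σ.f (pivot σ S) = pivot σ S := by
  rcases pivot_eq_or σ S with h1 | h1
  · rw [h1]; exact h.f_dst
  · exact (h.prop_F h1.1).1

lemma SearchCore.trichotomy (h : SearchCore E σ S) {x y : Fin n} (hx : σ.f x = x) :
    σ.lt x y ∨ x = y ∨ σ.lt y x := by
  rcases lt_trichotomy (σ.order.idxOf x) (σ.order.idxOf y) with h1 | h1 | h1
  · exact Or.inl h1
  · exact Or.inr (Or.inl (h.good.correct.idxOf_inj hx h1))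
  · exact Or.inr (Or.inr h1)

/-- All arcs out of the vertices of `forwardSet` were traversed. -/
lemma outPtr_eq_nil {x : Fin n} (hx : x ∈ forwardSet σ S) : S.outPtr x = [] := by
  obtain ⟨hxF, hxt⟩ := mem_forwardSet.1 hx
  by_contra hp
  exact Store.not_lt.2 (pivot_le σ S hxF hp) hxt

/-- All arcs into the vertices of `backwardSet` were traversed. -/
lemma Stopped.inPtr_eq_nil (h : Stopped E σ S) {y : Fin n} (hy : y ∈ backwardSet σ S) :
    S.inPtr y = [] := by
  obtain ⟨hyB, hty⟩ := mem_backwardSet.1 hy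
  by_contra hp
  have hle : σ.le y (pivot σ S) := by
    rcases pivot_eq_or σ S with h1 | h1
    · rw [h1]; exact h.le_dst (h.prop_B hyB).1 (h.prop_B hyB).2
    · exact h.le_of_live _ h1.1 h1.2 _ hyB hp
  exact Store.not_lt.2 hle hty

/-- The heads of the arcs out of `forwardSet` are forward vertices. -/
lemma Stopped.head_mem (h : Stopped E σ S) {a : Arc n} (ha : a ∈ E)
    (hx : σ.f a.1 ∈ forwardSet σ S) : σ.f a.2 ∈ S.F := by
  have hxF := (mem_forwardSet.1 hx).1
  by_cases hne : σ.f a.1 = σ.f a.2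
  · rw [← hne]; exact hxF
  obtain ⟨T, hF, -, -⟩ := h.trace
  rcases hF.closed _ hxF a (h.good.mem_out a ha hne) with h1 | h1
  · rw [outPtr_eq_nil hx] at h1; simp at h1
  · exact h1

/-- The tails of the arcs into `backwardSet` are backward vertices. -/
lemma Stopped.tail_mem (h : Stopped E σ S) {a : Arc n} (ha : a ∈ E)
    (hy : σ.f a.2 ∈ backwardSet σ S) : σ.f a.1 ∈ S.B := by
  have hyB := (mem_backwardSet.1 hy).1
  by_cases hne : σ.f a.1 = σ.f a.2
  · rw [hne]; exact hyB
  obtain ⟨T, -, hB, -⟩ := h.trace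
  rcases hB.closed _ hyB a (h.good.mem_inn a ha hne) with h1 | h1
  · rw [h.inPtr_eq_nil hy] at h1; simp at h1
  · exact h1

/-- The vertices before the pivot that are reachable from `f(w)` are forward vertices. -/
lemma Stopped.mem_forwardSet_of_reach (h : Stopped E σ S) {z : Fin n} (hz : Reach E S.src z)
    (hlt : σ.lt (σ.f z) (pivot σ S)) : σ.f z ∈ forwardSet σ S := by
  refine mem_forwardSet.2 ⟨?_, hlt⟩
  induction hz with
  | refl => rw [h.f_src]; exact h.src_mem
  | tail hb hbc ih =>
    rename_i b c
    have hle := h.good.correct.idxOf_le_of_reach (Relation.ReflTransGen.single hbc)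
    have hlt' : σ.lt (σ.f b) (pivot σ S) := Nat.lt_of_le_of_lt hle hlt
    exact h.head_mem (a := (b, c)) hbc (mem_forwardSet.2 ⟨ih hlt', hlt'⟩)

/-- The vertices after the pivot that reach `f(v)` are backward vertices. -/
lemma Stopped.mem_backwardSet_of_reach (h : Stopped E σ S) {z : Fin n} (hz : Reach E z S.dst)
    (hlt : σ.lt (pivot σ S) (σ.f z)) : σ.f z ∈ backwardSet σ S := by
  refine mem_backwardSet.2 ⟨?_, hlt⟩
  induction hz using Relation.ReflTransGen.head_induction_on with
  | refl => rw [h.f_dst]; exact h.dst_mem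
  | head hbc hc ih =>
    rename_i b c
    have hle := h.good.correct.idxOf_le_of_reach (Relation.ReflTransGen.single hbc)
    have hlt' : σ.lt (pivot σ S) (σ.f c) := Nat.lt_of_lt_of_le hlt hle
    exact h.tail_mem (a := (b, c)) hbc (mem_backwardSet.2 ⟨ih hlt', hlt'⟩)

lemma Stopped.mem_subgraphVertices_of_reach (h : Stopped E σ S) {z : Fin n}
    (h1 : Reach E S.src z) (h2 : Reach E z S.dst) : σ.f z ∈ subgraphVertices σ S := by
  rw [mem_subgraphVertices]
  rcases h.trichotomy (x := σ.f z) (y := pivot σ S) (h.good.correct.f_f z) with h3 | h3 | h3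
  · exact Or.inl (h.mem_forwardSet_of_reach h1 h3)
  · exact Or.inr (Or.inl h3)
  · exact Or.inr (Or.inr (h.mem_backwardSet_of_reach h2 h3))

lemma Stopped.subgraphAdj_of_arc (h : Stopped E σ S) {b c : Fin n} (hbc : (b, c) ∈ E)
    (h1 : Reach E S.src b) (h2 : Reach E c S.dst) (hne : σ.f b ≠ σ.f c) :
    subgraphAdj σ S (σ.f b) (σ.f c) := by
  have hr : Reach E b c := Relation.ReflTransGen.single hbc
  refine ⟨hne, h.mem_subgraphVertices_of_reach h1 (hr.trans h2),
    h.mem_subgraphVertices_of_reach (h1.trans hr) h2, ?_⟩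
  by_cases hlt : σ.lt (σ.f b) (pivot σ S)
  · exact Or.inl ⟨h.mem_forwardSet_of_reach h1 hlt, (b, c), h.good.mem_out _ hbc hne, rfl⟩
  · refine Or.inr ⟨h.mem_backwardSet_of_reach h2 ?_, (b, c), h.good.mem_inn _ hbc hne, rfl⟩
    exact Nat.lt_of_le_of_lt (Store.not_lt.1 hlt) (h.good.correct.topological b c hbc hne)

lemma SearchCore.reach_of_subgraphAdj (h : SearchCore E σ S) {x y : Fin n}
    (hxy : subgraphAdj σ S x y) : Reach E x y := by
  obtain ⟨-, -, -, ⟨-, a, ha, rfl⟩ | ⟨-, a, ha, rfl⟩⟩ := hxy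
  · exact h.good.reach_of_mem_out ha
  · exact h.good.reach_of_mem_inn ha

lemma SearchCore.f_of_mem_subgraphVertices (h : SearchCore E σ S) {x : Fin n}
    (hx : x ∈ subgraphVertices σ S) : σ.f x = x := by
  rcases mem_subgraphVertices.1 hx with h1 | h1 | h1
  · exact (h.prop_F (mem_forwardSet.1 h1).1).1
  · rw [h1]; exact h.f_pivot
  · exact (h.prop_B (mem_backwardSet.1 h1).1).1

/-- The new component consists of all components on paths from `f(w)` to `f(v)` in the whole
graph. -/
lemma Stopped.mem_newComponent (h : Stopped E σ S) {x : Fin n} : x ∈ newComponent σ S ↔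
    σ.f x = x ∧ Reach E S.src x ∧ Reach E x S.dst := by
  have lift : ∀ {a b : Fin n}, Relation.ReflTransGen (subgraphAdj σ S) a b → Reach E a b := by
    intro a b hab
    induction hab with
    | refl => exact .refl
    | tail _ hbc ih => exact ih.trans (h.reach_of_subgraphAdj hbc)
  have fwd : ∀ z, Reach E S.src z → Reach E z S.dst →
      Relation.ReflTransGen (subgraphAdj σ S) S.src (σ.f z) := by
    intro z h1
    induction h1 with
    | refl => intro _; rw [h.f_src]
    | tail hb hbc ih =>
      rename_i b c
      intro h2
      have ih := ih (h2.head hbc)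
      by_cases hne : σ.f b = σ.f c
      · rw [← hne]; exact ih
      · exact ih.tail (h.subgraphAdj_of_arc hbc hb h2 hne)
  have bwd : ∀ z, Reach E z S.dst → Reach E S.src z →
      Relation.ReflTransGen (subgraphAdj σ S) (σ.f z) S.dst := by
    intro z h1
    induction h1 using Relation.ReflTransGen.head_induction_on with
    | refl => intro _; rw [h.f_dst]
    | head hbc hc ih =>
      rename_i b c
      intro h2
      have ih := ih (h2.tail hbc)
      by_cases hne : σ.f b = σ.f c
      · rw [hne]; exact ih
      · exact ih.head (h.subgraphAdj_of_arc hbc h2 hc hne)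
  simp only [newComponent, List.mem_filter, decide_eq_true_eq]
  constructor
  · rintro ⟨h1, h2, h3⟩
    exact ⟨h.f_of_mem_subgraphVertices h1, lift h2, lift h3⟩
  · rintro ⟨h1, h2, h3⟩
    refine ⟨?_, ?_, ?_⟩
    · rw [← h1]; exact h.mem_subgraphVertices_of_reach h2 h3
    · have := fwd x h2 h3; rwa [h1] at this
    · have := bwd x h3 h2; rwa [h1] at this

end Stopped

end StrongComp

/-! ### The new order -/

namespace StrongComp

variable {n : ℕ} {E : List (Arc n)} {σ : Store n} {S : Search n}

lemma SearchCore.nodup_F (h : SearchCore E σ S) : S.F.Nodup := by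
  obtain ⟨T, hF, -, -⟩ := h.trace; exact hF.nodup

lemma SearchCore.nodup_B (h : SearchCore E σ S) : S.B.Nodup := by
  obtain ⟨T, -, hB, -⟩ := h.trace; exact hB.nodup

/-- Vertices can be arranged in topological order, and the arrangement chosen by a valid policy
respects all arcs between them. -/
lemma arrange_spec {pol : Policy n} (hpol : pol.Valid) {c : Config n} (hg : c.store.Good E)
    {l : List (Fin n)} (hnd : l.Nodup) (hl : ∀ x ∈ l, c.store.f x = x) :
    (pol.arrange c l).Perm l ∧ ∀ a ∈ E, c.store.f a.1 ≠ c.store.f a.2 → c.store.f a.1 ∈ l →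
      c.store.f a.2 ∈ l → Before (pol.arrange c l) (c.store.f a.1) (c.store.f a.2) := by
  have hperm := hpol.arrange_perm c l
  have htop : c.store.IsTopological (pol.arrange c l) := by
    refine hpol.arrange_topological c l ⟨c.store.order.filter fun x => x ∈ l, ?_, ?_⟩
    · rw [List.perm_ext_iff_of_nodup (hg.correct.order_nodup.filter _) hnd]
      intro x
      simp only [List.mem_filter, decide_eq_true_eq, and_iff_right_iff_imp]
      intro hx
      exact (hg.correct.mem_order_iff x).2 (hl x hx)
    · refine List.Pairwise.filter _ ?_
      rw [List.pairwise_iff_forall_sublist]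
      intro x y hxy a ha hax
      have h1 : c.store.order.idxOf x < c.store.order.idxOf y :=
        Before.idxOf_lt hxy hg.correct.order_nodup
      have h2 := hg.correct.idxOf_le_of_reach (hg.reach_of_mem_out ha)
      rw [hg.correct.f_f, hax, ← hg.f_of_mem_out y a ha, hg.correct.f_f] at h2
      rw [← hg.f_of_mem_out y a ha] at h1
      omega
  refine ⟨hperm, fun a ha hne h1 h2 => ?_⟩
  rcases before_or_before (hperm.mem_iff.2 h1) (hperm.mem_iff.2 h2) hne with h | h
  · exact h
  · exact absurd rfl ((List.pairwise_iff_forall_sublist.1 htop) h a (hg.mem_out a ha hne))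

/-- The canonical vertex after the update of the vertex that was canonical before. -/
noncomputable def rename (σ : Store n) (S : Search n) (x : Fin n) : Fin n :=
  if x ∈ newComponent σ S then S.dst else x

lemma Stopped.dst_mem_newComponent (h : Stopped E σ S) {x : Fin n}
    (hx : x ∈ newComponent σ S) : S.dst ∈ newComponent σ S := by
  obtain ⟨-, h1, h2⟩ := h.mem_newComponent.1 hx
  exact h.mem_newComponent.2 ⟨h.f_dst, h1.trans h2, .refl⟩

/-- All vertices of `backwardSet` are before `f(v)` in each topological order of `backwardSet`, since
they have paths to `f(v)` in it. -/
lemma Stopped.before_dst (h : Stopped E σ S) {l : List (Fin n)} (hnd : l.Nodup)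
    (hl : ∀ a ∈ E, σ.f a.1 ≠ σ.f a.2 → σ.f a.1 ∈ backwardSet σ S → σ.f a.2 ∈ backwardSet σ S →
      Before l (σ.f a.1) (σ.f a.2)) {z : Fin n} (hz : Reach E z S.dst)
    (hlt : σ.lt (pivot σ S) (σ.f z)) (hne : σ.f z ≠ S.dst) : Before l (σ.f z) S.dst := by
  induction hz using Relation.ReflTransGen.head_induction_on with
  | refl => exact absurd h.f_dst hne
  | head hbc hc ih =>
    rename_i b c
    by_cases hfe : σ.f b = σ.f c
    · rw [hfe] at hlt hne ⊢; exact ih hlt hne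
    · have hlt' : σ.lt (pivot σ S) (σ.f c) :=
        Nat.lt_trans hlt (h.good.correct.topological b c hbc hfe)
      have h1 : Before l (σ.f b) (σ.f c) := hl (b, c) hbc hfe
        (h.mem_backwardSet_of_reach (hc.head hbc) hlt) (h.mem_backwardSet_of_reach hc hlt')
      by_cases hcd : σ.f c = S.dst
      · rwa [hcd] at h1
      · exact h1.trans (ih hlt' hcd) hnd

section Reorder

variable {Fs Bs : List (Fin n)}

/-- The listings `Fs` and `Bs` of `forwardSet` and `backwardSet` respect all arcs between their
members. -/
structure Arranged (E : List (Arc n)) (σ : Store n) (S : Search n) (Fs Bs : List (Fin n)) :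
    Prop where
  permF : Fs.Perm (forwardSet σ S)
  permB : Bs.Perm (backwardSet σ S)
  beforeF : ∀ a ∈ E, σ.f a.1 ≠ σ.f a.2 → σ.f a.1 ∈ forwardSet σ S → σ.f a.2 ∈ forwardSet σ S →
    Before Fs (σ.f a.1) (σ.f a.2)
  beforeB : ∀ a ∈ E, σ.f a.1 ≠ σ.f a.2 → σ.f a.1 ∈ backwardSet σ S → σ.f a.2 ∈ backwardSet σ S →
    Before Bs (σ.f a.1) (σ.f a.2)

/-- The old order, split at the pivot. -/
lemma Stopped.order_split (h : Stopped E σ S) : ∃ P Q, σ.order = P ++ pivot σ S :: Q ∧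
    (∀ x, σ.f x = x → σ.lt x (pivot σ S) → x ∈ P) ∧
    (∀ x, σ.f x = x → σ.lt (pivot σ S) x → x ∈ Q) ∧
    (∀ x ∈ P, σ.lt x (pivot σ S)) ∧ (∀ x ∈ Q, σ.lt (pivot σ S) x) ∧
    (∀ x ∈ P, ∀ y ∈ P, σ.lt x y → Before P x y) ∧ (∀ x ∈ Q, ∀ y ∈ Q, σ.lt x y → Before Q x y) := by
  have hnd := h.good.correct.order_nodup
  obtain ⟨P, Q, hPQ⟩ := List.append_of_mem ((h.good.correct.mem_order_iff _).2 h.f_pivot)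
  have hP : ∀ x ∈ P, σ.lt x (pivot σ S) := fun x hx => by
    have : Before σ.order x (pivot σ S) := by
      rw [hPQ]; exact before_append hx (by simp)
    exact this.idxOf_lt hnd
  have hQ : ∀ x ∈ Q, σ.lt (pivot σ S) x := fun x hx => by
    have : Before σ.order (pivot σ S) x := by
      rw [hPQ]; exact (before_cons hx).append_right
    exact this.idxOf_lt hnd
  have hmem : ∀ x, σ.f x = x → x ∈ P ∨ x = pivot σ S ∨ x ∈ Q := fun x hx => by
    have := (h.good.correct.mem_order_iff x).2 hx
    rw [hPQ] at this
    simpa using this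
  have hsub : ∀ l : List (Fin n), l.Sublist σ.order → ∀ x ∈ l, ∀ y ∈ l, σ.lt x y →
      Before l x y := by
    intro l hl x hx y hy hxy
    have hne : x ≠ y := by rintro rfl; exact σ.lt_irrefl _ hxy
    refine (before_or_before hx hy hne).resolve_right fun h1 => ?_
    exact Nat.lt_asymm hxy ((h1.mono hl).idxOf_lt hnd)
  refine ⟨P, Q, hPQ, fun x hx hlt => ?_, fun x hx hlt => ?_, hP, hQ, hsub P ?_, hsub Q ?_⟩
  · rcases hmem x hx with h1 | h1 | h1
    · exact h1
    · rw [h1] at hlt; exact absurd hlt (σ.lt_irrefl _)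
    · exact absurd hlt (Nat.lt_asymm (hQ x h1))
  · rcases hmem x hx with h1 | h1 | h1
    · exact absurd hlt (Nat.lt_asymm (hP x h1))
    · rw [h1] at hlt; exact absurd hlt (σ.lt_irrefl _)
    · exact h1
  · rw [hPQ]; exact List.sublist_append_left _ _
  · rw [hPQ]; exact (List.sublist_cons_self _ _).trans (List.sublist_append_right _ _)

/-- If the pivot is `f(v)`, no backward vertex is after it. -/
lemma Stopped.backwardSet_eq_nil (h : Stopped E σ S) (ht : pivot σ S = S.dst) : backwardSet σ S = [] := by
  rw [List.eq_nil_iff_forall_not_mem]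
  intro y hy
  obtain ⟨hyB, hty⟩ := mem_backwardSet.1 hy
  rw [ht] at hty
  exact Store.not_lt.2 (h.le_dst (h.prop_B hyB).1 (h.prop_B hyB).2) hty

/-- In the new order, where the vertices of `forwardSet` and `backwardSet` were moved, the tail of
an old arc between different new components is before its head. -/
lemma Stopped.before_reorder (h : Stopped E σ S) (ha : Arranged E σ S Fs Bs) {a : Arc n} (haE : a ∈ E)
    (hne : rename σ S (σ.f a.1) ≠ rename σ S (σ.f a.2)) :
    Before (reorder σ.order Fs Bs (pivot σ S) S.dst)
      (rename σ S (σ.f a.1)) (rename σ S (σ.f a.2)) := by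
  set t := pivot σ S with ht
  set x := σ.f a.1 with hx
  set y := σ.f a.2 with hy
  have hfx : σ.f x = x := h.good.correct.f_f _
  have hfy : σ.f y = y := h.good.correct.f_f _
  have hxy : x ≠ y := fun he => hne (by rw [he])
  have hlt : σ.lt x y := h.good.correct.topological _ _ haE hxy
  have hr : Reach E x y := h.good.correct.reach_f (Relation.ReflTransGen.single haE)
  have mF : ∀ z, z ∈ Fs ↔ z ∈ S.F ∧ σ.lt z t := fun z => ha.permF.mem_iff.trans mem_forwardSet
  have mB : ∀ z, z ∈ Bs ↔ z ∈ S.B ∧ σ.lt t z := fun z => ha.permB.mem_iff.trans mem_backwardSet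
  have mK : ∀ z, z ∈ newComponent σ S ↔ σ.f z = z ∧ Reach E S.src z ∧ Reach E z S.dst :=
    fun z => h.mem_newComponent
  have hFB : ∀ z ∈ Fs, z ∉ Bs := fun z hz hz' => Nat.lt_asymm ((mF z).1 hz).2 ((mB z).1 hz').2
  obtain ⟨P, Q, hPQ, hP, hQ, hP', hQ', hPP, hQQ⟩ := h.order_split
  rw [← ht] at hP hQ hP' hQ'
  have htF : t ∉ Fs := fun hh => σ.lt_irrefl _ ((mF t).1 hh).2
  have htB : t ∉ Bs := fun hh => σ.lt_irrefl _ ((mB t).1 hh).2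
  have e := reorder_eq (Q := Q) (P := P) (dst := S.dst) (fun hh => σ.lt_irrefl _ (hP' t hh)) htF htB
  rw [hPQ, e]
  set P' := P.filter fun x => x ∉ Fs ∧ x ∉ Bs with hPdef
  set Q' := Q.filter fun x => x ∉ Fs ∧ x ∉ Bs with hQdef
  have mP : ∀ z, σ.f z = z → σ.lt z t → z ∉ Fs → z ∈ P' := fun z h1 h2 h3 => by
    rw [hPdef]
    simp only [List.mem_filter, decide_eq_true_eq]
    exact ⟨hP z h1 h2, h3, fun h4 => Nat.lt_asymm h2 ((mB z).1 h4).2⟩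
  have mQ : ∀ z, σ.f z = z → σ.lt t z → z ∉ Bs → z ∈ Q' := fun z h1 h2 h3 => by
    rw [hQdef]
    simp only [List.mem_filter, decide_eq_true_eq]
    exact ⟨hQ z h1 h2, fun h4 => Nat.lt_asymm h2 ((mF z).1 h4).2, h3⟩
  have bP : ∀ z ∈ P', ∀ w ∈ P', σ.lt z w → Before P' z w := fun z hz w hw hzw =>
    (hPP z (List.mem_of_mem_filter hz) w (List.mem_of_mem_filter hw) hzw).filter
      (List.mem_filter.1 hz).2 (List.mem_filter.1 hw).2
  have bQ : ∀ z ∈ Q', ∀ w ∈ Q', σ.lt z w → Before Q' z w := fun z hz w hw hzw =>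
    (hQQ z (List.mem_of_mem_filter hz) w (List.mem_of_mem_filter hw) hzw).filter
      (List.mem_filter.1 hz).2 (List.mem_filter.1 hw).2
  -- members of the new component other than the pivot are in `Fs` or `Bs`
  have kF : ∀ z ∈ newComponent σ S, σ.lt z t → z ∈ Fs := fun z hz hzt => by
    obtain ⟨h1, h2, -⟩ := (mK z).1 hz
    have := h.mem_forwardSet_of_reach h2 (by rw [h1]; exact hzt)
    rw [h1] at this
    exact ha.permF.mem_iff.2 this
  have kB : ∀ z ∈ newComponent σ S, σ.lt t z → z ∈ Bs := fun z hz hzt => by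
    obtain ⟨h1, -, h2⟩ := (mK z).1 hz
    have := h.mem_backwardSet_of_reach h2 (by rw [h1]; exact hzt)
    rw [h1] at this
    exact ha.permB.mem_iff.2 this
  have xF : x ∈ Fs → y ∈ S.F := fun hh => h.head_mem haE (ha.permF.mem_iff.1 hh)
  have yB : y ∈ Bs → x ∈ S.B := fun hh => h.tail_mem haE (ha.permB.mem_iff.1 hh)
  have FF : x ∈ Fs → y ∈ Fs → Before Fs x y := fun h1 h2 =>
    ha.beforeF a haE hxy (ha.permF.mem_iff.1 h1) (ha.permF.mem_iff.1 h2)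
  have BB : x ∈ Bs → y ∈ Bs → Before Bs x y := fun h1 h2 =>
    ha.beforeB a haE hxy (ha.permB.mem_iff.1 h1) (ha.permB.mem_iff.1 h2)
  -- a vertex between two members of the new component belongs to it
  have xK : x ∈ S.F → y ∈ newComponent σ S → x ∈ newComponent σ S := fun h1 h2 =>
    (mK x).2 ⟨hfx, (h.prop_F h1).2, hr.trans ((mK y).1 h2).2.2⟩
  have yK : x ∈ newComponent σ S → y ∈ S.B → y ∈ newComponent σ S := fun h1 h2 =>
    (mK y).2 ⟨hfy, ((mK x).1 h1).2.1.trans hr, (h.prop_B h2).2⟩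
  have xyK : x ∈ S.F → y ∈ S.B → x ∈ newComponent σ S ∧ y ∈ newComponent σ S := fun h1 h2 =>
    ⟨(mK x).2 ⟨hfx, (h.prop_F h1).2, hr.trans (h.prop_B h2).2⟩,
      (mK y).2 ⟨hfy, (h.prop_F h1).2.trans hr, (h.prop_B h2).2⟩⟩
  have hnot : ¬ (x ∈ newComponent σ S ∧ y ∈ newComponent σ S) := fun hh => by
    simp only [rename, hh.1, hh.2, if_true] at hne
    exact hne rfl
  have ltx : ∀ {z}, x = z → σ.lt z y := fun hh => hh ▸ hlt
  by_cases htd : t = S.dst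
  · rw [if_pos htd]
    have hB0 : ∀ z, z ∉ Bs := fun z hz => by
      have := ha.permB.mem_iff.1 hz
      rw [h.backwardSet_eq_nil htd] at this
      simp at this
    have kt : ∀ z ∈ newComponent σ S, ¬ σ.lt t z := fun z hz hz' => hB0 z (kB z hz hz')
    have tB : t ∈ S.B := htd ▸ h.dst_mem
    by_cases hxK : x ∈ newComponent σ S
    · have hyK : y ∉ newComponent σ S := fun hh => hnot ⟨hxK, hh⟩
      rw [rename, if_pos hxK, rename, if_neg hyK, ← htd]
      refine Before.append_right (before_cons ?_)
      rcases h.trichotomy (y := t) hfy with h1 | h1 | h1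
      · have hxt : σ.lt x t := Nat.lt_trans hlt h1
        exact List.mem_append_left _ ((mF y).2 ⟨xF (kF x hxK hxt), h1⟩)
      · exact absurd (yK hxK (h1 ▸ tB)) hyK
      · exact List.mem_append_right _ (mQ y hfy h1 (hB0 y))
    · rw [rename, if_neg hxK]
      rcases h.trichotomy (y := t) hfx with h1 | h1 | h1
      · by_cases hxF : x ∈ Fs
        · have hyK : y ∉ newComponent σ S := fun hh => hxK (xK ((mF x).1 hxF).1 hh)
          rw [rename, if_neg hyK]
          refine Before.append_right (Before.cons ?_)
          rcases h.trichotomy (y := t) hfy with h2 | h2 | h2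
          · exact (FF hxF ((mF y).2 ⟨xF hxF, h2⟩)).append_left
          · exact absurd (xyK ((mF x).1 hxF).1 (h2 ▸ tB)).1 hxK
          · exact before_append hxF (mQ y hfy h2 (hB0 y))
        · have hxP := mP x hfx h1 hxF
          by_cases hyK : y ∈ newComponent σ S
          · rw [rename, if_pos hyK, ← htd]
            exact before_append hxP (by simp)
          · rw [rename, if_neg hyK]
            rcases h.trichotomy (y := t) hfy with h2 | h2 | h2
            · by_cases hyF : y ∈ Fs
              · exact before_append hxP (by simp [hyF])
              · exact (bP x hxP y (mP y hfy h2 hyF) hlt).append_left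
            · rw [h2]; exact before_append hxP (by simp)
            · exact before_append hxP (by simp [mQ y hfy h2 (hB0 y)])
      · have h2 := ltx h1
        rw [rename, if_neg fun hh => kt y hh h2, h1]
        exact Before.append_right (before_cons (by simp [mQ y hfy h2 (hB0 y)]))
      · have h2 : σ.lt t y := Nat.lt_trans h1 hlt
        rw [rename, if_neg fun hh => kt y hh h2]
        exact ((bQ x (mQ x hfx h1 (hB0 x)) y (mQ y hfy h2 (hB0 y)) hlt).append_right.cons).append_right
  · rw [if_neg htd]
    have htF' : t ∈ S.F := ((pivot_eq_or σ S).resolve_left htd).1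
    have hdB : S.dst ∈ Bs := (mB _).2 ⟨h.dst_mem, (Nat.lt_or_eq_of_le (pivot_le_dst σ S)).resolve_right
      fun hh => htd (h.good.correct.idxOf_inj h.f_pivot hh)⟩
    have hlast : x ∈ Bs → x ≠ S.dst → Before Bs x S.dst := fun h1 h2 => by
      have := h.before_dst (ha.permB.nodup_iff.2 (h.nodup_B.filter _)) ha.beforeB
        (h.prop_B ((mB x).1 h1).1).2 (by rw [hfx]; exact ((mB x).1 h1).2) (by rw [hfx]; exact h2)
      rwa [hfx] at this
    rcases h.trichotomy (y := t) hfx with h1 | h1 | h1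
    · by_cases hxF : x ∈ Fs
      · have hxF' := ((mF x).1 hxF).1
        have hyK : y ∉ newComponent σ S := fun hh => hnot ⟨xK hxF' hh, hh⟩
        rw [rename, rename, if_neg hyK]
        have hyB : y ∉ Bs := fun hh => hyK (xyK hxF' ((mB y).1 hh).1).2
        by_cases hxK : x ∈ newComponent σ S
        · rw [if_pos hxK]
          rcases h.trichotomy (y := t) hfy with h2 | h2 | h2
          · exact (before_append (by simp [hdB]) ((mF y).2 ⟨xF hxF, h2⟩)).append_left
          · rw [h2]; exact before_append (by simp [hdB]) (by simp)
          · exact before_append (by simp [hdB]) (by simp [mQ y hfy h2 hyB])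
        · rw [if_neg hxK]
          rcases h.trichotomy (y := t) hfy with h2 | h2 | h2
          · exact (FF hxF ((mF y).2 ⟨xF hxF, h2⟩)).append_right.append_left
          · rw [h2]; exact before_append (by simp [hxF]) (by simp)
          · exact before_append (by simp [hxF]) (by simp [mQ y hfy h2 hyB])
      · have hxK : x ∉ newComponent σ S := fun hh => hxF (kF x hh h1)
        have hxP := mP x hfx h1 hxF
        rw [rename, if_neg hxK, rename]
        rw [List.append_assoc, List.append_assoc]
        by_cases hyK : y ∈ newComponent σ S
        · rw [if_pos hyK]
          exact before_append hxP (by simp [hdB])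
        · rw [if_neg hyK]
          rcases h.trichotomy (y := t) hfy with h2 | h2 | h2
          · by_cases hyF : y ∈ Fs
            · exact before_append hxP (by simp [hyF])
            · exact (bP x hxP y (mP y hfy h2 hyF) hlt).append_left
          · rw [h2]; exact before_append hxP (by simp)
          · by_cases hyB : y ∈ Bs
            · exact before_append hxP (by simp [hyB])
            · exact before_append hxP (by simp [mQ y hfy h2 hyB])
    · have h2 := ltx h1
      have hyK : y ∉ newComponent σ S := fun hh => hnot ⟨xK (h1 ▸ htF') hh, hh⟩
      have hyB : y ∉ Bs := fun hh => hyK (xyK (h1 ▸ htF') ((mB y).1 hh).1).2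
      have hyQ := mQ y hfy h2 hyB
      rw [rename, rename, if_neg hyK]
      by_cases hxK : x ∈ newComponent σ S
      · rw [if_pos hxK]
        exact before_append (by simp [hdB]) (by simp [hyQ])
      · rw [if_neg hxK, h1]
        exact (before_cons hyQ).append_right
    · have h2 : σ.lt t y := Nat.lt_trans h1 hlt
      by_cases hyB : y ∈ Bs
      · have hxB : x ∈ Bs := (mB x).2 ⟨yB hyB, h1⟩
        have hxK : x ∉ newComponent σ S := fun hh => hnot ⟨hh, yK hh ((mB y).1 hyB).1⟩
        rw [rename, if_neg hxK] at hne ⊢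
        refine Before.append_left (Before.append_left (Before.append_right ?_))
        by_cases hyK : y ∈ newComponent σ S
        · rw [rename, if_pos hyK] at hne ⊢
          exact hlast hxB hne
        · rw [rename, if_neg hyK]
          exact BB hxB hyB
      · have hyK : y ∉ newComponent σ S := fun hh => hyB (kB y hh h2)
        have hyQ := mQ y hfy h2 hyB
        rw [rename, rename, if_neg hyK]
        by_cases hxK : x ∈ newComponent σ S
        · rw [if_pos hxK]
          exact before_append (by simp [hdB]) (by simp [hyQ])
        · rw [if_neg hxK]
          by_cases hxB : x ∈ Bs
          · exact before_append (by simp [hxB]) (by simp [hyQ])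
          · exact (bQ x (mQ x hfx h1 hxB) y hyQ hlt).cons.append_right

/-- In the new order `f(v)` is before `f(w)`. -/
lemma Stopped.before_reorder_new (h : Stopped E σ S) (ha : Arranged E σ S Fs Bs) :
    Before (reorder σ.order Fs Bs (pivot σ S) S.dst) S.dst S.src := by
  obtain ⟨P, Q, hPQ, hP, hQ, hP', hQ', hPP, hQQ⟩ := h.order_split
  have mF : ∀ z, z ∈ Fs ↔ z ∈ S.F ∧ σ.lt z (pivot σ S) :=
    fun z => ha.permF.mem_iff.trans mem_forwardSet
  have mB : ∀ z, z ∈ Bs ↔ z ∈ S.B ∧ σ.lt (pivot σ S) z :=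
    fun z => ha.permB.mem_iff.trans mem_backwardSet
  have e := reorder_eq (Q := Q) (P := P) (dst := S.dst) (Fs := Fs) (Bs := Bs)
    (fun hh => σ.lt_irrefl _ (hP' _ hh)) (fun hh => σ.lt_irrefl _ ((mF _).1 hh).2)
    (fun hh => σ.lt_irrefl _ ((mB _).1 hh).2)
  rw [hPQ, e]
  by_cases htd : pivot σ S = S.dst
  · rw [if_pos htd, htd]
    have : S.src ∈ Fs := (mF _).2 ⟨h.src_mem, by rw [htd]; exact h.src_lt_dst⟩
    exact (before_cons (by simp [this])).append_right
  · rw [if_neg htd]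
    have htF' : pivot σ S ∈ S.F := ((pivot_eq_or σ S).resolve_left htd).1
    have hdB : S.dst ∈ Bs := (mB _).2 ⟨h.dst_mem, (Nat.lt_or_eq_of_le (pivot_le_dst σ S)).resolve_right
      fun hh => htd (h.good.correct.idxOf_inj h.f_pivot hh)⟩
    rcases Nat.lt_or_eq_of_le (h.src_le htF') with h1 | h1
    · have : S.src ∈ Fs := (mF _).2 ⟨h.src_mem, h1⟩
      exact (before_append (by simp [hdB]) this).append_left
    · have : S.src = pivot σ S := h.good.correct.idxOf_inj h.f_src h1
      rw [this]
      exact before_append (by simp [hdB]) (by simp)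

lemma Stopped.reorder_perm (h : Stopped E σ S) (ha : Arranged E σ S Fs Bs) :
    (reorder σ.order Fs Bs (pivot σ S) S.dst).Perm σ.order := by
  obtain ⟨P, Q, hPQ, hP, hQ, hP', hQ', hPP, hQQ⟩ := h.order_split
  have mF : ∀ z, z ∈ Fs ↔ z ∈ S.F ∧ σ.lt z (pivot σ S) :=
    fun z => ha.permF.mem_iff.trans mem_forwardSet
  have mB : ∀ z, z ∈ Bs ↔ z ∈ S.B ∧ σ.lt (pivot σ S) z :=
    fun z => ha.permB.mem_iff.trans mem_backwardSet
  have e := reorder_eq (Q := Q) (P := P) (dst := S.dst) (Fs := Fs) (Bs := Bs)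
    (fun hh => σ.lt_irrefl _ (hP' _ hh)) (fun hh => σ.lt_irrefl _ ((mF _).1 hh).2)
    (fun hh => σ.lt_irrefl _ ((mB _).1 hh).2)
  have hnd := h.good.correct.order_nodup
  have hPF : ((P.filter fun x => x ∉ Fs ∧ x ∉ Bs) ++ Fs).Perm P := by
    have hndP : P.Nodup := hnd.sublist (by rw [hPQ]; exact List.sublist_append_left _ _)
    rw [List.perm_ext_iff_of_nodup _ hndP]
    · intro x
      simp only [List.mem_append, List.mem_filter, decide_eq_true_eq]
      refine ⟨fun hx => hx.elim And.left fun hx => ?_, fun hx => ?_⟩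
      · exact hP x (h.prop_F ((mF x).1 hx).1).1 ((mF x).1 hx).2
      · by_cases hxF : x ∈ Fs
        · exact Or.inr hxF
        · exact Or.inl ⟨hx, hxF, fun hxB => Nat.lt_asymm (hP' x hx) ((mB x).1 hxB).2⟩
    · refine (hndP.filter _).append (ha.permF.nodup_iff.2 (h.nodup_F.filter _)) fun x hx hx' => ?_
      simp only [List.mem_filter, decide_eq_true_eq] at hx
      exact hx.2.1 hx'
  have hQB : (Bs ++ (Q.filter fun x => x ∉ Fs ∧ x ∉ Bs)).Perm Q := by
    have hndQ : Q.Nodup := hnd.sublist (by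
      rw [hPQ]; exact (List.sublist_cons_self _ _).trans (List.sublist_append_right _ _))
    rw [List.perm_ext_iff_of_nodup _ hndQ]
    · intro x
      simp only [List.mem_append, List.mem_filter, decide_eq_true_eq]
      refine ⟨fun hx => hx.elim (fun hx => ?_) And.left, fun hx => ?_⟩
      · exact hQ x (h.prop_B ((mB x).1 hx).1).1 ((mB x).1 hx).2
      · by_cases hxB : x ∈ Bs
        · exact Or.inl hxB
        · exact Or.inr ⟨hx, fun hxF => Nat.lt_asymm (hQ' x hx) ((mF x).1 hxF).2, hxB⟩
    · refine (ha.permB.nodup_iff.2 (h.nodup_B.filter _)).append (hndQ.filter _) fun x hx hx' => ?_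
      simp only [List.mem_filter, decide_eq_true_eq] at hx'
      exact hx'.2.2 hx
  rw [hPQ, e]
  set P' := P.filter fun x => x ∉ Fs ∧ x ∉ Bs
  set Q' := Q.filter fun x => x ∉ Fs ∧ x ∉ Bs
  set t := pivot σ S
  by_cases htd : t = S.dst
  · have hB0 : Bs = [] := by
      have := ha.permB
      rw [h.backwardSet_eq_nil htd] at this
      exact this.eq_nil
    rw [hB0, List.nil_append] at hQB
    rw [if_pos htd]
    have h1 : (P' ++ t :: (Fs ++ Q')).Perm ((P' ++ Fs) ++ t :: Q') := by
      rw [List.append_assoc]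
      exact List.perm_middle.symm.append_left P'
    exact h1.trans (hPF.append (hQB.cons t))
  · rw [if_neg htd]
    have h1 : (P' ++ Bs ++ Fs ++ t :: Q').Perm ((P' ++ Fs) ++ (Bs ++ t :: Q')) := by
      rw [← List.append_assoc (P' ++ Fs)]
      refine List.Perm.append_right _ ?_
      rw [List.append_assoc, List.append_assoc]
      exact List.perm_append_comm.append_left P'
    exact h1.trans (hPF.append (List.perm_middle.trans (hQB.cons t)))

end Reorder

end StrongComp

/-! ### The end of an arc addition -/

namespace StrongComp

variable {n : ℕ} {E : List (Arc n)} {S : Search n}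

lemma Reach.mono {E E' : List (Arc n)} (h : ∀ a ∈ E, a ∈ E') {x y : Fin n} (hr : Reach E x y) :
    Reach E' x y := by
  induction hr with
  | refl => exact .refl
  | tail _ hab ih => exact ih.tail (h _ hab)

lemma reach_append {v w x y : Fin n} : Reach (E ++ [(v, w)]) x y ↔
    Reach E x y ∨ (Reach E x v ∧ Reach E w y) := by
  have hE : ∀ a ∈ E, a ∈ E ++ [(v, w)] := fun a ha => List.mem_append_left _ ha
  constructor
  · intro h
    induction h with
    | refl => exact Or.inl .refl
    | tail _ hbc ih =>
      rcases List.mem_append.1 hbc with h1 | h1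
      · exact ih.imp (fun h2 => h2.tail h1) fun h2 => ⟨h2.1, h2.2.tail h1⟩
      · obtain ⟨rfl, rfl⟩ := Prod.mk.inj (List.mem_singleton.1 h1)
        exact Or.inr ⟨ih.elim id And.left, .refl⟩
  · rintro (h | ⟨h1, h2⟩)
    · exact h.mono hE
    · exact ((h1.mono hE).tail (by simp)).trans (h2.mono hE)

/-- The clauses of `Correct` and `Good` after an addition that started a search, for a memory `σ'`
in which the vertices of the new component were merged and the list was updated. -/
lemma Stopped.good_of_update {σ σ' : Store n} (h : Stopped E σ S) {Fs Bs : List (Fin n)}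
    (ha : Arranged E σ S Fs Bs) (hl : σ'.Lists) (hf : ∀ x, σ'.f x = rename σ S (σ.f x))
    (ho : σ'.order = (reorder σ.order Fs Bs (pivot σ S) S.dst).filter
      fun x => x ∉ newComponent σ S ∨ x = S.dst)
    (hout : ∀ a, a ∈ σ'.out (σ'.f a.1) ↔ a = (S.v, S.w) ∨ a ∈ σ.out (σ.f a.1))
    (hinn : ∀ a, a ∈ σ'.inn (σ'.f a.2) ↔ a = (S.v, S.w) ∨ a ∈ σ.inn (σ.f a.2)) :
    σ'.Good (E ++ [(S.v, S.w)]) := by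
  have hc := h.good.correct
  have hw := hc.canonical S.w
  have hv := hc.canonical S.v
  rw [← h.src_eq] at hw
  rw [← h.dst_eq] at hv
  have mK : ∀ x, σ.f x ∈ newComponent σ S ↔ Reach E S.w x ∧ Reach E x S.v := by
    intro x
    rw [h.mem_newComponent]
    have hx := hc.canonical x
    constructor
    · rintro ⟨-, h1, h2⟩
      exact ⟨(hw.1.trans h1).trans hx.2, (hx.1.trans h2).trans hv.2⟩
    · rintro ⟨h1, h2⟩
      exact ⟨hc.f_f x, (hw.2.trans h1).trans hx.1, (hx.2.trans h2).trans hv.1⟩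
  have hE : ∀ a ∈ E, a ∈ E ++ [(S.v, S.w)] := fun a ha => List.mem_append_left _ ha
  have hkeep : ∀ x, decide (rename σ S x ∉ newComponent σ S ∨ rename σ S x = S.dst) = true := by
    intro x
    rw [decide_eq_true_eq]
    unfold rename
    split_ifs with hx
    · exact Or.inr rfl
    · exact Or.inl hx
  have hperm := h.reorder_perm ha
  have hnd := hperm.nodup_iff.2 hc.order_nodup
  have hlt : ∀ x y, Before (reorder σ.order Fs Bs (pivot σ S) S.dst) (rename σ S x)
      (rename σ S y) → σ'.lt (rename σ S x) (rename σ S y) := by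
    intro x y hxy
    unfold Store.lt
    rw [ho]
    exact (hxy.filter (hkeep x) (hkeep y)).idxOf_lt (hnd.filter _)
  have hdst : rename σ S S.dst = S.dst := by unfold rename; split_ifs <;> rfl
  exact
    { toLists := hl
      correct :=
        { component := fun x y => by
            rw [hf, hf, reach_append, reach_append]
            constructor
            · intro he
              unfold rename at he
              split_ifs at he with h1 h2 h2
              · rw [mK] at h1 h2
                exact ⟨Or.inr ⟨h1.2, h2.1⟩, Or.inr ⟨h2.2, h1.1⟩⟩
              · exact absurd (he ▸ h.dst_mem_newComponent h1) h2
              · exact absurd (he ▸ h.dst_mem_newComponent h2) h1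
              · obtain ⟨h3, h4⟩ := (hc.component x y).1 he
                exact ⟨Or.inl h3, Or.inl h4⟩
            · have both : Reach E S.w x → Reach E x S.v → Reach E S.w y → Reach E y S.v →
                  rename σ S (σ.f x) = rename σ S (σ.f y) := fun h1 h2 h3 h4 => by
                unfold rename
                rw [if_pos ((mK x).2 ⟨h1, h2⟩), if_pos ((mK y).2 ⟨h3, h4⟩)]
              rintro ⟨h1 | ⟨h1, h2⟩, h3 | ⟨h3, h4⟩⟩
              · rw [(hc.component x y).2 ⟨h1, h3⟩]
              · exact both h4 (h1.trans h3) (h4.trans h1) h3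
              · exact both (h2.trans h3) h1 h2 (h3.trans h1)
              · exact both h4 h1 h2 h3
          canonical := fun x => by
            rw [hf, reach_append, reach_append]
            unfold rename
            split_ifs with h1
            · rw [mK] at h1
              exact ⟨Or.inl (h1.2.trans hv.1), Or.inr ⟨hv.2, h1.1⟩⟩
            · exact ⟨Or.inl (hc.canonical x).1, Or.inl (hc.canonical x).2⟩
          order_nodup := by rw [ho]; exact hnd.filter _
          mem_order := fun x => by
            rw [ho, List.mem_filter, hperm.mem_iff, hc.mem_order_iff, decide_eq_true_eq]
            constructor
            · rintro ⟨h1, h2⟩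
              refine ⟨x, ?_⟩
              rw [hf, h1]
              unfold rename
              split_ifs with h3
              · exact (h2.resolve_left fun h4 => h4 h3).symm
              · rfl
            · rintro ⟨y, rfl⟩
              rw [hf]
              refine ⟨?_, of_decide_eq_true (hkeep _)⟩
              unfold rename
              split_ifs
              · exact h.f_dst
              · exact hc.f_f y
          topological := fun x y hxy hne => by
            rw [hf, hf] at hne ⊢
            rcases List.mem_append.1 hxy with h1 | h1
            · exact hlt _ _ (h.before_reorder ha h1 hne)
            · obtain ⟨rfl, rfl⟩ := Prod.mk.inj (List.mem_singleton.1 h1)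
              rw [← h.dst_eq, ← h.src_eq] at hne ⊢
              have hsrc : rename σ S S.src = S.src := by
                unfold rename
                rw [if_neg]
                intro h2
                rw [rename, rename, if_pos h2, if_pos (h.dst_mem_newComponent h2)] at hne
                exact hne rfl
              refine hlt _ _ ?_
              rw [hdst, hsrc]
              exact h.before_reorder_new ha }
      mem_of_mem_out := fun x a hax => by
        rw [← hl.f_of_mem_out x a hax, hout] at hax
        rcases hax with h1 | h1
        · simp [h1]
        · exact hE a (h.good.mem_of_mem_out _ a h1)
      mem_of_mem_inn := fun x a hax => by
        rw [← hl.f_of_mem_inn x a hax, hinn] at hax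
        rcases hax with h1 | h1
        · simp [h1]
        · exact hE a (h.good.mem_of_mem_inn _ a h1)
      mem_out := fun a haE hne => by
        rw [hout]
        rcases List.mem_append.1 haE with h1 | h1
        · refine Or.inr (h.good.mem_out a h1 fun he => hne ?_)
          rw [hf, hf, he]
        · exact Or.inl (List.mem_singleton.1 h1)
      mem_inn := fun a haE hne => by
        rw [hinn]
        rcases List.mem_append.1 haE with h1 | h1
        · refine Or.inr (h.good.mem_inn a h1 fun he => hne ?_)
          rw [hf, hf, he]
        · exact Or.inl (List.mem_singleton.1 h1) }

/-- The lists of vertices without untraversed arcs contain no more arcs than were traversed. -/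
lemma length_flatMap_add_total_le {L ptr : Fin n → List (Arc n)} {l : List (Fin n)}
    (hnd : l.Nodup) (hsub : ∀ x, (ptr x).Sublist (L x)) (hl : ∀ x ∈ l, ptr x = [])
    (g : Arc n → Fin n) :
    (l.flatMap fun x => (L x).map g).length + total ptr ≤ total L := by
  have h1 : (l.flatMap fun x => (L x).map g).length = ∑ x, if x ∈ l then (L x).length else 0 := by
    rw [List.length_flatMap]
    simp only [List.length_map]
    rw [← List.sum_toFinset _ hnd, ← Finset.sum_filter]
    refine Finset.sum_congr ?_ fun _ _ => rfl
    ext x; simp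
  rw [h1]
  unfold total
  rw [← Finset.sum_add_distrib]
  refine Finset.sum_le_sum fun x _ => ?_
  split_ifs with hx
  · rw [hl x hx]; simp
  · rw [Nat.zero_add]; exact (hsub x).length_le

/-- The memory after a search: it is proper again, and the amortized cost of the update is bounded
in terms of the number of traversed arcs. -/
lemma Stopped.finish_spec {c : Config n} (h : Stopped E c.store S) {pol : Policy n}
    (hpol : pol.Valid) (hnew : (S.v, S.w) ∉ E) :
    (finish pol c S).Good (E ++ [(S.v, S.w)]) ∧
    total (finish pol c S).out = total c.store.out + 1 ∧
    total (finish pol c S).inn = total c.store.inn + 1 ∧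
    (finish pol c S).cost + 16 * (total S.outPtr + total S.inPtr) ≤
      c.store.cost + 16 * (total c.store.out + total c.store.inn) + 37 := by
  set σ := c.store with hσ
  set t := pivot σ S with ht
  set Fl := forwardSet σ S with hFl
  set Bg := backwardSet σ S with hBg
  set ends := subgraphEnds σ S with hends
  set K := newComponent σ S with hK
  set size := (subgraphVertices σ S).length + ends.length with hsize
  set σ₁ := σ.tick (1 + S.F.length + S.B.length) with hσ₁
  set σ₂ := (σ₁.findAll ends).tick (size + size + size) with hσ₂
  set O := (reorder σ.order (pol.arrange c Fl) (pol.arrange c Bg) t S.dst).filter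
      fun x => x ∉ K ∨ x = S.dst with hO
  set σ₃ := ({ σ₂ with order := O } : Store n).tick (Fl.length + Bg.length + K.length) with hσ₃
  set K' := K.filter fun x => x ≠ S.dst with hK'
  set σ₄ := K'.foldl (fun σ x => σ.unite S.dst x) σ₃ with hσ₄
  have hfin : finish pol c S = σ₄.insertArc S.v S.w := rfl
  have hFnd : Fl.Nodup := h.nodup_F.filter _
  have hBnd : Bg.Nodup := h.nodup_B.filter _
  obtain ⟨pF, bF⟩ := arrange_spec (c := c) hpol h.good (l := Fl) hFnd
    fun x hx => (h.prop_F (mem_forwardSet.1 hx).1).1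
  obtain ⟨pB, bB⟩ := arrange_spec (c := c) hpol h.good (l := Bg) hBnd
    fun x hx => (h.prop_B (mem_backwardSet.1 hx).1).1
  have harr : Arranged E σ S (pol.arrange c Fl) (pol.arrange c Bg) := ⟨pF, pB, bF, bB⟩
  have hXnd : (subgraphVertices σ S).Nodup := by
    unfold subgraphVertices
    rw [List.nodup_append, List.nodup_cons]
    refine ⟨hFnd, ⟨fun hh => σ.lt_irrefl _ (mem_backwardSet.1 hh).2, hBnd⟩, ?_⟩
    rintro x hx y hy rfl
    have h1 := (mem_forwardSet.1 hx).2
    rcases List.mem_cons.1 hy with h2 | h2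
    · rw [h2] at h1; exact σ.lt_irrefl _ h1
    · exact Nat.lt_asymm h1 (mem_backwardSet.1 h2).2
  have hKnd : K.Nodup := hXnd.filter _
  have r1 := Store.refresh_tick h.good.wf (1 + S.F.length + S.B.length)
  have r2 := r1.trans (Store.refresh_findAll r1.wf ends)
  have r3 := r2.trans (Store.refresh_tick r2.wf (size + size + size))
  have l2 := h.good.toLists.refresh r3
  have l3 : σ₃.Lists := ⟨l2.1, l2.2, l2.3, l2.4, l2.5⟩
  have hf3 : σ₃.f = σ.f := r3.f_eq
  have hKmem : ∀ y ∈ K', σ₃.f y = y ∧ y ≠ S.dst := fun y hy => by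
    simp only [hK', List.mem_filter, decide_eq_true_eq] at hy
    rw [hf3]
    exact ⟨(h.mem_newComponent.1 hy.1).1, hy.2⟩
  have m := Store.merge_foldl_unite K' l3 (by rw [hf3]; exact h.f_dst) (hKnd.filter _) hKmem
  have hf4 : ∀ x, σ₄.f x = rename σ S (σ.f x) := fun x => by
    rw [m.f_eq, hf3]
    unfold rename
    simp only [hK', List.mem_filter, decide_eq_true_eq]
    by_cases h1 : σ.f x ∈ K
    · by_cases h2 : σ.f x = S.dst
      · simp [h2]
      · rw [if_pos ⟨h1, h2⟩, if_pos h1]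
    · rw [if_neg fun hh => h1 hh.1, if_neg h1]
  have o4 : ∀ a, a ∈ σ₄.out (σ₄.f a.1) ↔ a ∈ σ.out (σ.f a.1) := fun a => by
    rw [m.mem_out, hf3]
    have : σ₃.out = σ.out := r3.out_eq
    rw [this]
  have i4 : ∀ a, a ∈ σ₄.inn (σ₄.f a.2) ↔ a ∈ σ.inn (σ.f a.2) := fun a => by
    rw [m.mem_inn, hf3]
    have : σ₃.inn = σ.inn := r3.inn_eq
    rw [this]
  have ins := Store.insert_insertArc m.lists (v := S.v) (w := S.w)
    (fun hh => hnew (h.good.mem_of_mem_out _ _ ((o4 (S.v, S.w)).1 hh)))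
    (fun hh => hnew (h.good.mem_of_mem_inn _ _ ((i4 (S.v, S.w)).1 hh)))
  rw [← hσ₄, ← hfin] at ins
  refine ⟨?_, ?_, ?_, ?_⟩
  · refine h.good_of_update harr ins.lists (fun x => by rw [ins.f_eq, hf4])
      (ins.order_eq.trans m.order_eq) (fun a => ?_) fun a => ?_
    · rw [ins.f_eq, ins.mem_out, o4]
    · rw [ins.f_eq, ins.mem_inn, i4]
  · have h1 : total σ₃.out = total σ.out := by
      have : σ₃.out = σ.out := r3.out_eq
      rw [this]
    rw [ins.total_out, m.total_out, h1]
  · have h1 : total σ₃.inn = total σ.inn := by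
      have : σ₃.inn = σ.inn := r3.inn_eq
      rw [this]
    rw [ins.total_inn, m.total_inn, h1]
  · obtain ⟨T, hF, hB, -⟩ := h.trace
    have c1 := r3.cost_le
    have c2 : σ₃.cost = σ₂.cost + (Fl.length + Bg.length + K.length) := by
      simp only [hσ₃, Store.cost, Store.tick]
      omega
    have c3 := m.cost_le
    have c4 := ins.cost_le
    have e1 := hF.count
    have e2 := hB.count
    have e3 : ends.length + (total S.outPtr + total S.inPtr) ≤ total σ.out + total σ.inn := by
      have h1 := length_flatMap_add_total_le hFnd hF.ptr_sublist (fun x hx => outPtr_eq_nil hx)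
        Prod.snd
      have h2 := length_flatMap_add_total_le hBnd hB.ptr_sublist (fun x hx => h.inPtr_eq_nil hx)
        Prod.fst
      have h3 : ends.length = (Fl.flatMap fun x => (σ.out x).map Prod.snd).length +
          (Bg.flatMap fun x => (σ.inn x).map Prod.fst).length := List.length_append
      omega
    have e4 : (subgraphVertices σ S).length = Fl.length + Bg.length + 1 := by
      have h1 : (subgraphVertices σ S).length = Fl.length + (Bg.length + 1) := List.length_append
      omega
    have e5 : Fl.length ≤ S.F.length := List.length_filter_le _ _
    have e6 : Bg.length ≤ S.B.length := List.length_filter_le _ _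
    have e7 : K.length ≤ (subgraphVertices σ S).length := List.length_filter_le _ _
    have e8 : K'.length ≤ K.length := List.length_filter_le _ _
    rw [← hσ₄] at c3
    change σ₂.cost ≤ _ at c1
    omega

open Classical in
/-- The pairs of arcs of which the first one leads to the second one. -/
noncomputable def related (arcs E : List (Arc n)) : Finset (Arc n × Arc n) :=
  (arcs.toFinset ×ˢ arcs.toFinset).filter fun p => Reach E p.1.2 p.2.1

lemma card_related_le (arcs E : List (Arc n)) :
    (related arcs E).card ≤ arcs.length ^ 2 := by
  classical
  refine (Finset.card_le_card (Finset.filter_subset _ _)).trans ?_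
  rw [Finset.card_product, sq]
  exact Nat.mul_le_mul (List.toFinset_card_le _) (List.toFinset_card_le _)

lemma related_mono (arcs : List (Arc n)) {E E' : List (Arc n)} (h : ∀ a ∈ E, a ∈ E') :
    related arcs E ⊆ related arcs E' := by
  classical
  intro p hp
  simp only [related, Finset.mem_filter] at hp ⊢
  exact ⟨hp.1, hp.2.mono h⟩

/-- If two arcs were traversed in each of `k` search steps, then the addition relates at least
`k ^ 2 / 2` pairs of arcs: for any two steps, the tail of the forward arc of one of them is before the
head of the backward arc of the other one, and the addition makes this backward arc lead to that
forward arc. -/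
lemma SearchCore.sq_le_card_related {σ : Store n} (h : SearchCore E σ S) {arcs : List (Arc n)}
    (hE : ∀ a ∈ E, a ∈ arcs) : ∃ k : ℕ,
    total σ.out + total σ.inn ≤ total S.outPtr + total S.inPtr + 2 * k ∧
    k ^ 2 + 2 * (related arcs E).card ≤ 2 * (related arcs (E ++ [(S.v, S.w)])).card := by
  classical
  have hc := h.good.correct
  have hw := hc.canonical S.w
  have hv := hc.canonical S.v
  rw [← h.src_eq] at hw
  rw [← h.dst_eq] at hv
  obtain ⟨T, hF, hB, hT⟩ := h.trace
  refine ⟨T.length, ?_, ?_⟩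
  · have h1 := hF.total_le
    have h2 := hB.total_le
    rw [List.length_map] at h1 h2
    omega
  set key : Fin n → ℕ := fun x => σ.order.idxOf (σ.f x) with hkey
  set G : Finset (Fin T.length × Fin T.length) :=
    Finset.univ.filter fun p => key (T.get p.2).1.1 < key (T.get p.1).2.2 with hG
  have hTl : ∀ i : Fin T.length, key (T.get i).1.1 < key (T.get i).2.2 := fun i =>
    hT _ (List.get_mem T i)
  -- of two steps `i` and `j`, `(i, j)` or `(j, i)` is in `G`
  have hcover : (Finset.univ : Finset (Fin T.length × Fin T.length)) ⊆ G ∪ G.image Prod.swap := by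
    rintro ⟨i, j⟩ -
    simp only [hG, Finset.mem_union, Finset.mem_filter, Finset.mem_univ, true_and,
      Finset.mem_image, Prod.exists, Prod.swap_prod_mk, Prod.mk.injEq]
    by_cases h1 : key (T.get j).1.1 < key (T.get i).2.2
    · exact Or.inl h1
    · refine Or.inr ⟨j, i, ?_, rfl, rfl⟩
      have := hTl i
      have := hTl j
      omega
  have hcard : T.length ^ 2 ≤ 2 * G.card := by
    have h1 := Finset.card_le_card hcover
    have h2 := Finset.card_union_le G (G.image Prod.swap)
    have h3 := Finset.card_image_le (s := G) (f := Prod.swap)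
    rw [Finset.card_univ, Fintype.card_prod, Fintype.card_fin] at h1
    rw [sq]
    omega
  have hndT : T.Nodup := hF.nodup_trace.of_map
  have inj1 : ∀ i j : Fin T.length, (T.get i).1 = (T.get j).1 → i = j := fun i j hij =>
    List.nodup_iff_injective_get.1 hndT
      (List.inj_on_of_nodup_map hF.nodup_trace (List.get_mem T i) (List.get_mem T j) hij)
  have inj2 : ∀ i j : Fin T.length, (T.get i).2 = (T.get j).2 → i = j := fun i j hij =>
    List.nodup_iff_injective_get.1 hndT
      (List.inj_on_of_nodup_map hB.nodup_trace (List.get_mem T i) (List.get_mem T j) hij)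
  set φ : Fin T.length × Fin T.length → Arc n × Arc n := fun p => ((T.get p.1).2, (T.get p.2).1)
    with hφ
  have hφinj : Function.Injective φ := by
    rintro ⟨i, j⟩ ⟨i', j'⟩ he
    simp only [hφ, Prod.mk.injEq] at he
    rw [inj2 _ _ he.1, inj1 _ _ he.2]
  -- an old path would contradict the topological order
  have hdisj : Disjoint (G.image φ) (related arcs E) := by
    rw [Finset.disjoint_left]
    intro p hp hp'
    obtain ⟨⟨i, j⟩, hij, rfl⟩ := Finset.mem_image.1 hp
    simp only [hG, Finset.mem_filter] at hij
    simp only [related, Finset.mem_filter, hφ] at hp'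
    have := hc.idxOf_le_of_reach hp'.2
    exact absurd hij.2 (not_lt.2 this)
  have hsub : G.image φ ∪ related arcs E ⊆ related arcs (E ++ [(S.v, S.w)]) := by
    refine Finset.union_subset ?_ (related_mono arcs fun a ha => List.mem_append_left _ ha)
    intro p hp
    obtain ⟨⟨i, j⟩, -, rfl⟩ := Finset.mem_image.1 hp
    obtain ⟨f1, f2, -⟩ := hF.of_mem_trace (T.get j).1 (List.mem_map_of_mem (List.get_mem T j))
    obtain ⟨b1, b2, -⟩ := hB.of_mem_trace (T.get i).2 (List.mem_map_of_mem (List.get_mem T i))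
    simp only [related, Finset.mem_filter, Finset.mem_product, List.mem_toFinset, hφ]
    refine ⟨⟨hE _ b1, hE _ f1⟩, reach_append.2 (Or.inr ⟨?_, ?_⟩)⟩
    · exact ((hc.canonical _).1.trans (hB.prop _ b2).2).trans hv.2
    · exact (hw.1.trans (hF.prop _ f2).2).trans (hc.canonical _).2
  have h1 := Finset.card_le_card hsub
  rw [Finset.card_union_of_disjoint hdisj, Finset.card_image_of_injective _ hφinj] at h1
  omega

end StrongComp

/-! ### The amortized cost of the whole computation -/

namespace StrongComp

variable {n : ℕ} {E : List (Arc n)} {S : Search n} {σ : Store n}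

/-- Entering an arc that agrees with the order of the list does not change the components. -/
lemma Store.Good.insertArc (h : σ.Good E) {v w : Fin n} (hnew : (v, w) ∉ E)
    (hlt : ¬ σ.lt (σ.f w) (σ.f v)) : (σ.insertArc v w).Good (E ++ [(v, w)]) := by
  have ins := Store.insert_insertArc h.toLists (v := v) (w := w)
    (fun hh => hnew (h.mem_of_mem_out _ _ hh)) (fun hh => hnew (h.mem_of_mem_inn _ _ hh))
  have hc := h.correct
  have hE : ∀ a ∈ E, a ∈ E ++ [(v, w)] := fun a ha => List.mem_append_left _ ha
  have hkey : ∀ x y, Reach (E ++ [(v, w)]) x y →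
      σ.order.idxOf (σ.f x) ≤ σ.order.idxOf (σ.f y) := by
    intro x y hxy
    rcases reach_append.1 hxy with h1 | ⟨h1, h2⟩
    · exact hc.idxOf_le_of_reach h1
    · exact ((hc.idxOf_le_of_reach h1).trans (Store.not_lt.1 hlt)).trans
        (hc.idxOf_le_of_reach h2)
  refine
    { toLists := ins.lists
      correct := ⟨fun x y => ?_, fun x => ?_, ?_, ?_, fun x y hxy hne => ?_⟩
      mem_of_mem_out := fun x a hax => ?_
      mem_of_mem_inn := fun x a hax => ?_
      mem_out := fun a ha hne => ?_
      mem_inn := fun a ha hne => ?_ }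
  · rw [ins.f_eq]
    constructor
    · intro he
      exact ((hc.component x y).1 he).imp (Reach.mono hE) (Reach.mono hE)
    · rintro ⟨h1, h2⟩
      exact hc.idxOf_inj (hc.f_f x) (le_antisymm (hkey _ _ h1) (hkey _ _ h2))
  · rw [ins.f_eq]
    exact (hc.canonical x).imp (Reach.mono hE) (Reach.mono hE)
  · rw [ins.order_eq]; exact hc.order_nodup
  · rw [ins.order_eq, ins.f_eq]; exact hc.mem_order
  · rw [ins.f_eq] at hne ⊢
    unfold Store.lt
    rw [ins.order_eq]
    refine lt_of_le_of_ne (hkey _ _ (.single hxy)) fun he => hne ?_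
    exact hc.idxOf_inj (hc.f_f x) he
  · rw [← ins.lists.f_of_mem_out x a hax, ins.f_eq, ins.mem_out] at hax
    rcases hax with h1 | h1
    · simp [h1]
    · exact hE a (h.mem_of_mem_out _ a h1)
  · rw [← ins.lists.f_of_mem_inn x a hax, ins.f_eq, ins.mem_inn] at hax
    rcases hax with h1 | h1
    · simp [h1]
    · exact hE a (h.mem_of_mem_inn _ a h1)
  · rw [ins.f_eq] at hne ⊢
    rw [ins.mem_out]
    rcases List.mem_append.1 ha with h1 | h1
    · exact Or.inr (h.mem_out a h1 hne)
    · exact Or.inl (List.mem_singleton.1 h1)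
  · rw [ins.f_eq] at hne ⊢
    rw [ins.mem_inn]
    rcases List.mem_append.1 ha with h1 | h1
    · exact Or.inr (h.mem_inn a h1 hne)
    · exact Or.inl (List.mem_singleton.1 h1)

/-- The state of a search that has just been started. -/
lemma Store.Good.searchCore_startSearch (h : σ.Good E) {v w : Fin n}
    (hlt : σ.lt (σ.f w) (σ.f v)) : SearchCore E σ (startSearch σ v w) where
  good := h
  src_eq := rfl
  dst_eq := rfl
  src_lt_dst := hlt
  trace := by
    have half : ∀ (tl hd : Arc n → Fin n) (P : Fin n → Prop) (r : Fin n)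
        (L : Fin n → List (Arc n)), P r → Half E σ.f tl hd P r L [r] L [] := by
      intro tl hd P r L hP
      exact ⟨by simp, by simp, by simpa using hP, fun _ => List.Sublist.refl _, fun _ _ => rfl,
        fun _ _ _ ha => Or.inl ha, by simp, by simp, by simp, by simp⟩
    exact ⟨[], half _ _ _ _ _ ⟨h.correct.f_f w, .refl⟩, half _ _ _ _ _ ⟨h.correct.f_f v, .refl⟩,
      by simp⟩

lemma Store.Good.searchAlive_startSearch (h : σ.Good E) (v w : Fin n) :
    SearchAlive σ (startSearch σ v w) := by
  have alive : ∀ (r : Fin n) (L : Fin n → List (Arc n)),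
      Alive [r] L (if L r = [] then [] else [r]) [] := by
    intro r L
    refine ⟨fun x hx => ?_, ?_, by simp, by simp⟩
    · split_ifs at hx with h1 <;> simp at hx
      subst hx
      exact ⟨by simp, h1⟩
    · split_ifs <;> simp
  refine ⟨alive _ _, alive _ _, by simp [startSearch], by simp [startSearch],
    (h.correct.mem_order_iff _).2 (h.correct.f_f v), fun x hx hx' y hy hy' => Or.inl ?_⟩
  simp only [startSearch, List.mem_singleton] at hx hy hx' hy' ⊢
  subst hx hy
  simp [hx', hy']

lemma pot_startSearch_le (A : ℕ) (v w : Fin n) :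
    pot σ.lt A (startSearch σ v w).s (startSearch σ v w).FA (startSearch σ v w).FP
      (startSearch σ v w).BA (startSearch σ v w).BP ≤ 2 * A + 10 := by
  have len : ∀ (r : Fin n) (L : List (Arc n)),
      (if L = [] then [] else [r]).length ≤ 1 := by
    intro r L; split_ifs <;> simp
  have h1 : (startSearch σ v w).FA.length ≤ 1 := len _ _
  have h2 : (startSearch σ v w).BA.length ≤ 1 := len _ _
  have h3 : alive (startSearch σ v w).FA (startSearch σ v w).FP (startSearch σ v w).BA
      (startSearch σ v w).BP ≤ 2 := by
    unfold alive
    have : (startSearch σ v w).FP = [] := rfl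
    have : (startSearch σ v w).BP = [] := rfl
    simp_all
    omega
  unfold pot
  have h4 := Nat.mul_le_mul_left A ((Nat.sub_le _ (credit σ.lt (startSearch σ v w).s
    (startSearch σ v w).FA (startSearch σ v w).FP (startSearch σ v w).BA
    (startSearch σ v w).BP)).trans h3)
  omega

/-- The invariant of the computation. -/
structure Config.Consistent (arcs : List (Arc n)) (c : Config n) : Prop where
  arcs_eq : arcs = c.added ++ c.todo
  good : c.search = none → c.store.Good c.added
  search : ∀ S, c.search = some S → (∃ rest, c.todo = (S.v, S.w) :: rest) ∧
    SearchCore c.added c.store S ∧ SearchAlive c.store S ∧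
    (S.FA = [] → S.FP = []) ∧ (S.BA = [] → S.BP = [])

/-- The part of the amortized cost that is set aside for the future: an amount of order `√m` for
each arc to be added, and an amount of order `1 / √m` for each pair of arcs that may still become
related. By the inequality of the means these pay for the `k` steps of any search, which relates
at least `k ^ 2 / 2` pairs. -/
noncomputable def reserve (A : ℕ) (arcs added todo : List (Arc n)) : ℝ :=
  (5 * A + 95) * (√arcs.length + 1) * todo.length +
    2 * (A + 25) / √arcs.length * ((arcs.length : ℝ) ^ 2 - (related arcs added).card)

/-- The amortized cost of the current phase, a search or the time between two searches. The
constant subtracted during a search covers its start, including the potential of `f(w)` and `f(v)`;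
it is paid back when the search ends. -/
noncomputable def phaseCost (A : ℕ) (σ : Store n) : Option (Search n) → ℝ
  | none => (σ.cost + (A + 9) * (total σ.out + total σ.inn) : ℕ)
  | some S => (potential A σ S : ℕ) - (2 * A + 15)

/-- The amortized cost of the computation up to a state. -/
noncomputable def Config.amortized (A : ℕ) (arcs : List (Arc n)) (c : Config n) : ℝ :=
  phaseCost A c.store c.search + reserve A arcs c.added c.todo

open Classical in
/-- The amortized cost, and infinity for states that violate the invariant. -/
noncomputable def Config.value (A : ℕ) (arcs : List (Arc n)) (c : Config n) : ℝ≥0∞ :=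
  if c.Consistent arcs then ENNReal.ofReal (c.amortized A arcs) else ⊤

lemma Config.Consistent.value_eq {A : ℕ} {arcs : List (Arc n)} {c : Config n}
    (h : c.Consistent arcs) : c.value A arcs = ENNReal.ofReal (c.amortized A arcs) := if_pos h

lemma reserve_nonneg_add (A : ℕ) (arcs added todo : List (Arc n)) :
    (5 * A + 95) * (√arcs.length + 1) * (todo.length : ℝ) ≤ reserve A arcs added todo := by
  unfold reserve
  have h : ((related arcs added).card : ℝ) ≤ (arcs.length : ℝ) ^ 2 := by
    exact_mod_cast card_related_le arcs added
  have h' : 0 ≤ 2 * ((A : ℝ) + 25) / √arcs.length *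
      ((arcs.length : ℝ) ^ 2 - (related arcs added).card) :=
    mul_nonneg (by positivity) (sub_nonneg.2 h)
  linarith

lemma le_reserve_cons (A : ℕ) (arcs added : List (Arc n)) (e : Arc n) (todo : List (Arc n)) :
    (5 * A + 95 : ℝ) ≤ reserve A arcs added (e :: todo) := by
  refine le_trans ?_ (reserve_nonneg_add _ _ _ _)
  have h1 : (1 : ℝ) ≤ √arcs.length + 1 := by linarith [Real.sqrt_nonneg (arcs.length : ℝ)]
  have h2 : (1 : ℝ) ≤ ((e :: todo).length : ℝ) := by simp
  have h3 : (1 : ℝ) ≤ (√arcs.length + 1) * ((e :: todo).length : ℝ) := by nlinarith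
  rw [mul_assoc]
  exact le_mul_of_one_le_right (by positivity) h3

/-- An addition without search releases at least `5 A + 95`. -/
lemma reserve_append_le (A : ℕ) (arcs added : List (Arc n)) (e : Arc n) (rest : List (Arc n)) :
    reserve A arcs (added ++ [e]) rest + (5 * A + 95) ≤ reserve A arcs added (e :: rest) := by
  unfold reserve
  have h1 : ((related arcs added).card : ℝ) ≤ (related arcs (added ++ [e])).card := by
    exact_mod_cast Finset.card_le_card (related_mono arcs fun a ha => List.mem_append_left _ ha)
  have h2 := mul_le_mul_of_nonneg_left (sub_le_sub_left h1 ((arcs.length : ℝ) ^ 2))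
    (show (0 : ℝ) ≤ 2 * (A + 25) / √arcs.length by positivity)
  rw [List.length_cons]
  push_cast
  nlinarith [mul_nonneg (show (0 : ℝ) ≤ 5 * A + 95 by positivity)
    (Real.sqrt_nonneg (arcs.length : ℝ))]

/-- An addition with a search of `k` steps releases enough to pay for them. -/
lemma reserve_append_search_le (A : ℕ) {arcs added : List (Arc n)} {e : Arc n}
    {rest : List (Arc n)} (harcs : arcs ≠ []) {k : ℕ}
    (hk : k ^ 2 + 2 * (related arcs added).card ≤ 2 * (related arcs (added ++ [e])).card) :
    reserve A arcs (added ++ [e]) rest + 2 * (A + 25) * k + (4 * A + 70) ≤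
      reserve A arcs added (e :: rest) := by
  unfold reserve
  have hm : 0 < √(arcs.length : ℝ) :=
    Real.sqrt_pos.2 (by exact_mod_cast List.length_pos_iff.2 harcs)
  set lam := √(arcs.length : ℝ) with hlam
  have h1 : (k : ℝ) ^ 2 + 2 * (related arcs added).card ≤ 2 * (related arcs (added ++ [e])).card := by
    exact_mod_cast hk
  have h2 : 2 * (A + 25) / lam * ((arcs.length : ℝ) ^ 2 - (related arcs (added ++ [e])).card) +
      (A + 25) / lam * k ^ 2 ≤
      2 * (A + 25) / lam * ((arcs.length : ℝ) ^ 2 - (related arcs added).card) := by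
    have h3 := mul_le_mul_of_nonneg_left h1 (show (0 : ℝ) ≤ (A + 25) / lam by positivity)
    have h4 : 2 * ((A : ℝ) + 25) / lam = 2 * ((A + 25) / lam) := by ring
    rw [h4]
    linarith
  -- the inequality of the means, from `0 ≤ (k - √m) ^ 2`
  have h5 : 2 * ((A : ℝ) + 25) * k ≤ (A + 25) / lam * k ^ 2 + (A + 25) * lam := by
    have h6 : (A + 25) / lam * k ^ 2 + (A + 25) * lam - 2 * ((A : ℝ) + 25) * k =
      (A + 25) / lam * (k - lam) ^ 2 := by field_simp; ring
    have h7 : 0 ≤ ((A : ℝ) + 25) / lam * (k - lam) ^ 2 := by positivity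
    linarith
  rw [List.length_cons]
  push_cast
  have h8 : 0 ≤ (A : ℝ) * lam := by positivity
  nlinarith

lemma Config.Consistent.time_le {A : ℕ} {arcs : List (Arc n)} {c : Config n}
    (h : c.Consistent arcs) : (c.store.time : ℝ) ≤ c.amortized A arcs := by
  unfold Config.amortized
  have h0 := reserve_nonneg_add A arcs c.added c.todo
  have h0' : 0 ≤ (5 * (A : ℝ) + 95) * (√arcs.length + 1) * (c.todo.length : ℝ) := by positivity
  cases hs : c.search with
  | none =>
    have h1 : c.store.time ≤ c.store.cost + (A + 9) * (total c.store.out + total c.store.inn) := by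
      unfold Store.cost; omega
    have h2 : (c.store.time : ℝ) ≤
      (c.store.cost + (A + 9) * (total c.store.out + total c.store.inn) : ℕ) := by exact_mod_cast h1
    simp only [phaseCost]
    linarith
  | some S =>
    obtain ⟨⟨rest, hr⟩, -⟩ := h.search S hs
    have h1 : c.store.time ≤ potential A c.store S := by
      unfold potential Store.cost; omega
    have h2 : (c.store.time : ℝ) ≤ (potential A c.store S : ℕ) := by exact_mod_cast h1
    have h3 := le_reserve_cons A arcs c.added (S.v, S.w) rest
    rw [hr]
    simp only [phaseCost]
    linarith

/-- The amortized cost is a supermartingale: it does not increase, in the sense of `Ev`. -/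
lemma step_drift {Ev : (α : Type) → PMF α → (α → ℝ≥0∞) → ℝ≥0∞} (hEv : Averaging Ev) {A : ℕ}
    {pol : Policy n} (hpol : pol.Valid) {arcs : List (Arc n)} (harcs : arcs.Nodup) (c : Config n)
    (hfair : c.Consistent arcs → ∀ E, c.store.Good E → Fair Ev A c.store (pol.threshold c)) :
    Ev _ (step pol c) (Config.value A arcs) ≤ c.value A arcs := by
  by_cases hcon : c.Consistent arcs
  swap
  · unfold Config.value; rw [if_neg hcon]; exact le_top
  have hnew : ∀ {v w rest}, c.todo = (v, w) :: rest →
      (v, w) ∉ c.added ∧ arcs = (c.added ++ [(v, w)]) ++ rest := by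
    intro v w rest hr
    have h1 := hcon.arcs_eq
    rw [hr] at h1
    refine ⟨fun hm => ?_, by rw [h1]; simp⟩
    rw [h1, List.nodup_append] at harcs
    exact harcs.2.2 _ hm _ (by simp) rfl
  cases hs : c.search with
  | none =>
    have hg := hcon.good hs
    cases ht : c.todo with
    | nil =>
      have e : step pol c = PMF.pure c := by unfold step; rw [hs, ht]
      rw [e, hEv.pure_eq]
    | cons a rest =>
      obtain ⟨v, w⟩ := a
      obtain ⟨hvw, harcs'⟩ := hnew ht
      set τ := ((c.store.find v).find w).tick 1 with hτ
      have r1 := Store.refresh_find hg.wf v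
      have r2 := r1.trans (Store.refresh_find r1.wf w)
      have r := r2.trans (Store.refresh_tick r2.wf 1)
      rw [← hτ] at r
      have hgτ := hg.refresh r
      have hcost := r.cost_le
      by_cases hlt : τ.lt (τ.f w) (τ.f v)
      · have e : step pol c =
            PMF.pure { c with store := τ, search := some (startSearch τ v w) } := by
          unfold step; rw [hs, ht]; simp only; rw [if_pos hlt]
        have hcon' : Config.Consistent arcs
            { c with store := τ, search := some (startSearch τ v w) } :=
          ⟨hcon.arcs_eq, fun h => absurd h (by simp), fun S hS => by
            obtain rfl := Option.some.inj hS
            exact ⟨⟨rest, ht⟩, hgτ.searchCore_startSearch hlt, hgτ.searchAlive_startSearch v w,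
              fun _ => rfl, fun _ => rfl⟩⟩
        rw [e, hEv.pure_eq, hcon'.value_eq, hcon.value_eq]
        refine ENNReal.ofReal_le_ofReal ?_
        have h1 := pot_startSearch_le (σ := τ) A v w
        have h2 : potential A τ (startSearch τ v w) ≤
            c.store.cost + (A + 9) * (total c.store.out + total c.store.inn) + (2 * A + 15) := by
          have e1 : (startSearch τ v w).outPtr = c.store.out := r.out_eq
          have e2 : (startSearch τ v w).inPtr = c.store.inn := r.inn_eq
          unfold potential
          rw [e1, e2]
          omega
        have h3 : ((potential A τ (startSearch τ v w) : ℕ) : ℝ) ≤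
            (c.store.cost + (A + 9) * (total c.store.out + total c.store.inn) : ℕ) +
              (2 * A + 15) := by exact_mod_cast h2
        unfold Config.amortized
        rw [hs]
        simp only [phaseCost]
        linarith
      · have e : step pol c = PMF.pure { c with
            added := c.added ++ [(v, w)], todo := rest, store := τ.insertArc v w } := by
          unfold step; rw [hs, ht]; simp only; rw [if_neg hlt]
        have hg' := hgτ.insertArc hvw hlt
        have ins := Store.insert_insertArc hgτ.toLists (v := v) (w := w)
          (fun hh => hvw (hgτ.mem_of_mem_out _ _ hh)) (fun hh => hvw (hgτ.mem_of_mem_inn _ _ hh))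
        have hcon' : Config.Consistent arcs { c with
            added := c.added ++ [(v, w)], todo := rest, store := τ.insertArc v w } :=
          ⟨harcs', fun _ => hg', fun S hS => by
            have : c.search = some S := hS
            rw [hs] at this; simp at this⟩
        rw [e, hEv.pure_eq, hcon'.value_eq, hcon.value_eq]
        refine ENNReal.ofReal_le_ofReal ?_
        have h1 := reserve_append_le A arcs c.added (v, w) rest
        have h2 : (τ.insertArc v w).cost +
            (A + 9) * (total (τ.insertArc v w).out + total (τ.insertArc v w).inn) ≤
            c.store.cost + (A + 9) * (total c.store.out + total c.store.inn) + (2 * A + 28) := by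
          have h3 := ins.cost_le
          rw [ins.total_out, ins.total_inn, r.out_eq, r.inn_eq]
          have h4 : (A + 9) * (total c.store.out + 1 + (total c.store.inn + 1)) =
            (A + 9) * (total c.store.out + total c.store.inn) + 2 * (A + 9) := by ring
          omega
        have h3 : (((τ.insertArc v w).cost +
            (A + 9) * (total (τ.insertArc v w).out + total (τ.insertArc v w).inn) : ℕ) : ℝ) ≤
            (c.store.cost + (A + 9) * (total c.store.out + total c.store.inn) : ℕ) +
              (2 * A + 28) := by exact_mod_cast h2
        unfold Config.amortized
        simp only [hs, ht, phaseCost]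
        have h4 : (0 : ℝ) ≤ A := by positivity
        linarith
  | some S =>
    obtain ⟨⟨rest, ht⟩, hcore, hal, hF, hB⟩ := hcon.search S hs
    obtain ⟨hvw, harcs'⟩ := hnew ht
    by_cases hdone : S.FA = [] ∨ S.BA = []
    · have e : step pol c = PMF.pure { c with
          added := c.added ++ [(S.v, S.w)]
          todo := rest
          store := finish pol c S
          search := none } := by
        unfold step; rw [hs, ht]; simp only; rw [if_pos hdone]; rfl
      obtain ⟨f1, f2, f3, f4⟩ := (hal.stopped hcore hdone hF hB).finish_spec hpol hvw
      have hcon' : Config.Consistent arcs { c with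
          added := c.added ++ [(S.v, S.w)]
          todo := rest
          store := finish pol c S
          search := none } := ⟨harcs', fun _ => f1, fun S hS => absurd hS (by simp)⟩
      rw [e, hEv.pure_eq, hcon'.value_eq, hcon.value_eq]
      refine ENNReal.ofReal_le_ofReal ?_
      obtain ⟨k, k1, k2⟩ := hcore.sq_le_card_related (arcs := arcs)
        fun a ha => by rw [harcs']; simp [ha]
      have h1 := reserve_append_search_le A (rest := rest)
        (fun h => by rw [h] at harcs'; simp at harcs') k2
      have h2 : (finish pol c S).cost +
          (A + 9) * (total (finish pol c S).out + total (finish pol c S).inn) ≤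
          potential A c.store S + (2 * (A + 25) * k + (2 * A + 55)) := by
        rw [f2, f3]
        have h3 := Nat.mul_le_mul_left (A + 9) k1
        unfold potential
        have h4 : (A + 9) * (total c.store.out + 1 + (total c.store.inn + 1)) =
          (A + 9) * (total c.store.out + total c.store.inn) + 2 * (A + 9) := by ring
        have h5 : (A + 9) * (total S.outPtr + total S.inPtr + 2 * k) =
          (A + 9) * (total S.outPtr + total S.inPtr) + (2 * (A + 25) * k - 32 * k) := by
          have : 2 * (A + 25) * k = 2 * (A + 9) * k + 32 * k := by ring
          rw [this, Nat.add_sub_cancel]; ring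
        have h6 : 32 * k ≤ 2 * (A + 25) * k := Nat.mul_le_mul_right k (by omega)
        omega
      have h3 : (((finish pol c S).cost +
          (A + 9) * (total (finish pol c S).out + total (finish pol c S).inn) : ℕ) : ℝ) ≤
          (potential A c.store S : ℕ) + (2 * (A + 25) * k + (2 * A + 55)) := by exact_mod_cast h2
      unfold Config.amortized
      simp only [hs, ht, phaseCost]
      linarith
    · have e : step pol c = iteration pol c S := by
        unfold step; rw [hs]; simp only; rw [if_neg hdone]
      rw [not_or] at hdone
      rw [e, hcon.value_eq]
      have hres := le_reserve_cons A arcs c.added (S.v, S.w) rest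
      rw [← ht] at hres
      have h4 : (0 : ℝ) ≤ A := by positivity
      have hβ : 0 ≤ reserve A arcs c.added c.todo - (2 * A + 15) := by linarith
      have hd := iteration_drift hEv (hfair hcon _ hcore.good) hcore hal
        (hpol.pair_mem c S hs hdone.1 hdone.2) hβ (G := Config.value A arcs)
        fun σ' S' l hcore' hal' hv hw hF' hB' => by
          have hcon' : Config.Consistent arcs
              { c with store := σ', search := some S', log := l } :=
            ⟨hcon.arcs_eq, fun h => absurd h (by simp), fun S'' hS => by
              obtain rfl := Option.some.inj hS
              exact ⟨⟨rest, by rw [hv, hw]; exact ht⟩, hcore', hal', hF', hB'⟩⟩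
          rw [hcon'.value_eq]
          refine ENNReal.ofReal_le_ofReal (le_of_eq ?_)
          unfold Config.amortized
          simp only [phaseCost]
          ring
      refine hd.trans (ENNReal.ofReal_le_ofReal (le_of_eq ?_))
      unfold Config.amortized
      simp only [hs, phaseCost]
      ring

lemma consistent_start (arcs : List (Arc n)) : (start arcs).Consistent arcs :=
  ⟨rfl, fun _ => Store.good_init n, fun S hS => absurd hS (by simp [start])⟩

lemma run_drift {Ev : (α : Type) → PMF α → (α → ℝ≥0∞) → ℝ≥0∞} (hEv : Averaging Ev) {A : ℕ}
    {pol : Policy n} (hpol : pol.Valid) {arcs : List (Arc n)} (harcs : arcs.Nodup)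
    (hfair : ∀ (c : Config n) (E : List (Arc n)), c.store.Good E →
      Fair Ev A c.store (pol.threshold c)) (N : ℕ) :
    Ev _ (run pol arcs N) (Config.value A arcs) ≤
      ENNReal.ofReal ((start arcs).amortized A arcs) := by
  induction N with
  | zero =>
    have : run pol arcs 0 = PMF.pure (start arcs) := rfl
    rw [this, hEv.pure_eq, (consistent_start arcs).value_eq]
  | succ N ih =>
    have : run pol arcs (N + 1) = (run pol arcs N).bind (step pol) := rfl
    rw [this, hEv.bind_eq]
    exact (hEv.mono _ _ _ _ fun c => step_drift hEv hpol harcs c fun _ => hfair c).trans ih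

end StrongComp

/-! ### Fair choices of the threshold -/

namespace StrongComp

variable {n : ℕ}

/-- The supremum of a function on the support of a distribution. -/
noncomputable def worst (α : Type) (p : PMF α) (g : α → ℝ≥0∞) : ℝ≥0∞ := ⨆ a ∈ p.support, g a

/-- The expectation of a function. -/
noncomputable def expected (α : Type) (p : PMF α) (g : α → ℝ≥0∞) : ℝ≥0∞ := ∑' a, p a * g a

lemma averaging_worst : Averaging worst where
  pure_eq α a g := by simp [worst]
  bind_eq α β p q g := by
    unfold worst
    refine le_antisymm (iSup₂_le fun b hb => ?_) (iSup₂_le fun a ha => iSup₂_le fun b hb => ?_)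
    · obtain ⟨a, ha, hab⟩ := (PMF.mem_support_bind_iff _ _ _).1 hb
      exact (le_iSup₂ (f := fun b _ => g b) b hab).trans
        (le_iSup₂ (f := fun a _ => ⨆ b ∈ (q a).support, g b) a ha)
    · exact le_iSup₂ (f := fun b _ => g b) b ((PMF.mem_support_bind_iff _ _ _).2 ⟨a, ha, hb⟩)
  mono α p g h hgh := iSup₂_mono fun a _ => hgh a

lemma averaging_expected : Averaging expected where
  pure_eq α a g := by
    unfold expected
    rw [tsum_eq_single a fun b hb => by rw [PMF.pure_apply_of_ne _ _ hb, zero_mul],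
      PMF.pure_apply_self, one_mul]
  bind_eq α β p q g := by
    unfold expected
    simp only [PMF.bind_apply, ← ENNReal.tsum_mul_right, ← ENNReal.tsum_mul_left]
    rw [ENNReal.tsum_comm]
    simp only [mul_assoc]
  mono α p g h hgh := ENNReal.tsum_le_tsum fun a => mul_le_mul_right (hgh a) _

lemma fair_worst {A : ℕ} {σ : Store n} {choose : List (Fin n) → PMF (Fin n)}
    (h : ∀ P : List (Fin n), P ≠ [] → P.Nodup → ∀ s ∈ (choose P).support,
      s ∈ P ∧ 4 * P.length ≤ A * balance σ.lt P s) : Fair worst A σ choose := by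
  intro P hP hnd _ b g G hg
  refine iSup₂_le fun s hs => ?_
  obtain ⟨hsP, hA⟩ := h P hP hnd s hs
  obtain ⟨-, h1, h2⟩ := hg s hsP
  have hA' : (4 * P.length : ℝ) ≤ A * balance σ.lt P s := by exact_mod_cast hA
  exact h1.trans (ENNReal.ofReal_le_ofReal (by linarith))

lemma balance_pos (σ : Store n) {P : List (Fin n)} {s : Fin n} (hs : s ∈ P) :
    0 < balance σ.lt P s := by
  unfold balance
  rw [lt_min_iff, List.countP_pos_iff, List.countP_pos_iff]
  exact ⟨⟨s, hs, by simpa using σ.lt_irrefl s⟩, ⟨s, hs, by simpa using σ.lt_irrefl s⟩⟩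

/-- The new threshold counts in its own balance, which is therefore positive, and there are at most
`n` candidates. -/
lemma Policy.Valid.fair_worst {pol : Policy n} (hpol : pol.Valid) (c : Config n) :
    Fair worst (4 * n) c.store (pol.threshold c) := by
  refine StrongComp.fair_worst fun P hP hnd s hs => ?_
  have hsP := hpol.threshold_mem c P hP s hs
  refine ⟨hsP, ?_⟩
  have h1 : P.length ≤ n := by simpa using hnd.length_le_card
  have h2 := Nat.mul_le_mul_left (4 * n) (balance_pos c.store hsP)
  omega

lemma Policy.ApproxMedian.fair_worst {pol : Policy n} {ε : ℝ} (hε : 0 < ε)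
    (hpol : pol.ApproxMedian ε) (c : Config n) :
    Fair worst ⌈4 / ε⌉₊ c.store (pol.threshold c) := by
  refine StrongComp.fair_worst fun P hP hnd s hs => ?_
  obtain ⟨h1, h2, h3⟩ := hpol c P hP s hs
  refine ⟨h1, ?_⟩
  have h4 : ε * P.length ≤ (balance c.store.lt P s : ℝ) := by
    unfold balance
    rw [List.countP_eq_length_filter, List.countP_eq_length_filter]
    simp only [Store.not_lt]
    push_cast
    exact le_min h2 h3
  have h5 : (4 * P.length : ℝ) ≤ ⌈4 / ε⌉₊ * balance c.store.lt P s := by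
    calc (4 * P.length : ℝ) = 4 / ε * (ε * P.length) := by field_simp
      _ ≤ ⌈4 / ε⌉₊ * balance c.store.lt P s :=
        mul_le_mul (Nat.le_ceil _) h4 (by positivity) (by positivity)
  exact_mod_cast h5

lemma sum_range_mul_sub (c : ℝ) (m : ℕ) :
    6 * ∑ r ∈ Finset.range m, ((r : ℝ) + 1) * (c - (r + 1)) =
      3 * c * m * (m + 1) - m * (m + 1) * (2 * m + 1) := by
  induction m with
  | zero => simp
  | succ m ih => rw [Finset.sum_range_succ, mul_add, ih]; push_cast; ring

/-- The average over a totally ordered set of `k` elements of the smaller one of the numbers of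
elements that are not after and not before an element is at least `k / 6`. -/
lemma sq_le_sum_min {α : Type*} [DecidableEq α] (s : Finset α) (key : α → ℕ)
    (hkey : Set.InjOn key s) :
    (s.card : ℝ) ^ 2 ≤ 6 * ∑ x ∈ s, ((min (s.filter fun y => key y ≤ key x).card
      (s.filter fun y => key x ≤ key y).card : ℕ) : ℝ) := by
  set k := s.card with hk
  set a : α → ℕ := fun x => (s.filter fun y => key y ≤ key x).card with ha
  set b : α → ℕ := fun x => (s.filter fun y => key x ≤ key y).card with hb
  have hab : ∀ x ∈ s, a x + b x = k + 1 := by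
    intro x hx
    rw [ha, hb, hk]
    simp only
    rw [← Finset.card_union_add_card_inter]
    congr 1
    · congr 1
      ext y
      simp only [Finset.mem_union, Finset.mem_filter]
      have := le_total (key y) (key x)
      tauto
    · rw [Finset.card_eq_one]
      refine ⟨x, ?_⟩
      ext y
      simp only [Finset.mem_inter, Finset.mem_filter, Finset.mem_singleton]
      constructor
      · rintro ⟨⟨h1, h2⟩, -, h3⟩
        exact hkey h1 hx (le_antisymm h2 h3)
      · rintro rfl
        exact ⟨⟨hx, le_rfl⟩, hx, le_rfl⟩
  have hpos : ∀ x ∈ s, 1 ≤ a x ∧ 1 ≤ b x := fun x hx =>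
    ⟨Finset.card_pos.2 ⟨x, by simp [hx]⟩, Finset.card_pos.2 ⟨x, by simp [hx]⟩⟩
  have hmono : ∀ x ∈ s, ∀ y ∈ s, key x < key y → a x < a y := by
    intro x _ y hy hxy
    refine Finset.card_lt_card (Finset.ssubset_iff_of_subset ?_ |>.2 ⟨y, by simp [hy], ?_⟩)
    · intro z hz
      simp only [Finset.mem_filter] at hz ⊢
      exact ⟨hz.1, hz.2.trans hxy.le⟩
    · simp only [Finset.mem_filter, not_and, not_le]
      exact fun _ => hxy
  have hinj : Set.InjOn (fun x => a x - 1) s := by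
    intro x hx y hy hxy
    have h1 := (hpos x hx).1
    have h2 := (hpos y hy).1
    simp only at hxy
    rcases lt_trichotomy (key x) (key y) with h | h | h
    · have := hmono x hx y hy h; omega
    · exact hkey hx hy h
    · have := hmono y hy x hx h; omega
  have himage : s.image (fun x => a x - 1) = Finset.range k := by
    refine Finset.eq_of_subset_of_card_le (fun r hr => ?_) ?_
    · obtain ⟨x, hx, rfl⟩ := Finset.mem_image.1 hr
      have := hab x hx
      have := hpos x hx
      rw [Finset.mem_range]
      omega
    · rw [Finset.card_image_of_injOn hinj, Finset.card_range]
  have hsum : ∑ x ∈ s, (a x : ℝ) * b x =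
      ∑ r ∈ Finset.range k, ((r : ℝ) + 1) * ((k + 1 : ℝ) - (r + 1)) := by
    rw [← himage, Finset.sum_image hinj]
    refine Finset.sum_congr rfl fun x hx => ?_
    have h1 := hab x hx
    have h2 := (hpos x hx).1
    have h3 : (a x : ℝ) + b x = k + 1 := by exact_mod_cast h1
    have h4 : ((a x - 1 : ℕ) : ℝ) + 1 = a x := by
      rw [Nat.cast_sub h2]; push_cast; ring
    rw [h4, ← h3]
    ring
  -- half the harmonic mean of two positive numbers is at most the smaller one
  have hmin : ∀ x ∈ s, (a x : ℝ) * b x ≤ (k + 1) * (min (a x) (b x) : ℕ) := by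
    intro x hx
    have h1 := hab x hx
    have h2 : a x * b x ≤ (k + 1) * min (a x) (b x) := by
      rw [← min_mul_max, mul_comm]
      refine Nat.mul_le_mul_right _ (max_le ?_ ?_) <;> omega
    exact_mod_cast h2
  have h1 := Finset.sum_le_sum hmin
  rw [hsum, ← Finset.mul_sum] at h1
  have h2 := sum_range_mul_sub (k + 1) k
  have h3 : 0 < (k : ℝ) + 1 := by positivity
  refine le_of_mul_le_mul_left ?_ h3
  have h4 : (0 : ℝ) ≤ k * (k + 1) := by positivity
  nlinarith

lemma Policy.Uniform.fair_expected {pol : Policy n} (hpol : pol.Uniform) {c : Config n}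
    {E : List (Arc n)} (hc : c.store.Good E) : Fair expected 24 c.store (pol.threshold c) := by
  intro P hP hnd hord b g G hg
  obtain ⟨x₀, hx₀⟩ := List.exists_mem_of_ne_nil P hP
  have hne : P.toFinset.Nonempty := ⟨x₀, by simpa using hx₀⟩
  rw [hpol c P hne]
  set k := P.length with hk
  have hcard : P.toFinset.card = k := List.toFinset_card_of_nodup hnd
  have hk0 : 0 < (k : ℝ) := by exact_mod_cast List.length_pos_iff.2 hP
  have hbal : (k : ℝ) ^ 2 ≤ 6 * ∑ s ∈ P.toFinset, (balance c.store.lt P s : ℝ) := by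
    have h1 := sq_le_sum_min P.toFinset (fun x => c.store.order.idxOf x) fun x hx y hy hxy => by
      rw [Finset.mem_coe, List.mem_toFinset] at hx
      exact hc.correct.idxOf_inj ((hc.correct.mem_order_iff x).1 (hord x hx)) hxy
    rw [hcard] at h1
    refine h1.trans (le_of_eq ?_)
    congr 1
    refine Finset.sum_congr rfl fun s _ => ?_
    have count : ∀ p : Fin n → Prop, ∀ [DecidablePred p],
        (P.toFinset.filter p).card = P.countP fun x => p x := by
      intro p _
      rw [List.countP_eq_length_filter, ← List.toFinset_card_of_nodup (hnd.filter _),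
        List.toFinset_filter]
      simp
    unfold balance
    simp only [Store.not_lt]
    rw [count, count]
    rfl
  have hsum : ∑ s ∈ P.toFinset, g s ≤ k * b := by
    have h1 : ∑ s ∈ P.toFinset, (g s + 24 * (balance c.store.lt P s : ℝ)) ≤
        ∑ _s ∈ P.toFinset, (b + 4 * k) :=
      Finset.sum_le_sum fun s hs => by exact_mod_cast (hg s (by simpa using hs)).2.2
    rw [Finset.sum_add_distrib, ← Finset.mul_sum, Finset.sum_const, hcard, nsmul_eq_mul] at h1
    nlinarith
  unfold expected
  rw [tsum_eq_sum (s := P.toFinset) fun x hx => by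
    rw [PMF.uniformOfFinset_apply_of_notMem _ hx, zero_mul]]
  calc ∑ s ∈ P.toFinset, PMF.uniformOfFinset P.toFinset hne s * G s
      ≤ ∑ s ∈ P.toFinset, (k : ℝ≥0∞)⁻¹ * ENNReal.ofReal (g s) := by
        refine Finset.sum_le_sum fun s hs => ?_
        rw [PMF.uniformOfFinset_apply_of_mem _ hs, hcard]
        exact mul_le_mul_right (hg s (by simpa using hs)).2.1 _
    _ = (k : ℝ≥0∞)⁻¹ * ENNReal.ofReal (∑ s ∈ P.toFinset, g s) := by
        rw [← Finset.mul_sum, ENNReal.ofReal_sum_of_nonneg fun s hs =>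
          (hg s (by simpa using hs)).1]
    _ ≤ (k : ℝ≥0∞)⁻¹ * ENNReal.ofReal (k * b) :=
        mul_le_mul_right (ENNReal.ofReal_le_ofReal hsum) _
    _ = ENNReal.ofReal b := by
        rw [ENNReal.ofReal_mul hk0.le, ENNReal.ofReal_natCast, ← mul_assoc,
          ENNReal.inv_mul_cancel (by exact_mod_cast hk0.ne') (ENNReal.natCast_ne_top k), one_mul]

/-! ### Every step takes time -/

namespace Store

lemma time_le_find (σ : Store n) (x : Fin n) : σ.time ≤ (σ.find x).time := Nat.le_add_right _ _

lemma time_le_findAll (σ : Store n) (l : List (Fin n)) : σ.time ≤ (σ.findAll l).time := by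
  induction l generalizing σ with
  | nil => exact le_rfl
  | cons x l ih => exact (σ.time_le_find x).trans (ih (σ.find x))

lemma time_le_insertArc (σ : Store n) (v w : Fin n) : σ.time ≤ (σ.insertArc v w).time :=
  ((σ.time_le_find v).trans (Store.time_le_find _ w)).trans (Nat.le_add_right _ 1)

lemma time_le_foldl_unite (σ : Store n) (x : Fin n) (l : List (Fin n)) :
    σ.time ≤ (l.foldl (fun σ y => σ.unite x y) σ).time := by
  induction l generalizing σ with
  | nil => exact le_rfl
  | cons y l ih =>
    refine le_trans ?_ (ih _)
    exact ((σ.time_le_find x).trans (Store.time_le_find _ y)).trans (Nat.le_add_right _ 1)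

end Store

lemma time_le_forwardStep (u : Fin n) (σ : Store n) (S : Search n) :
    σ.time ≤ (forwardStep u σ S).1.time := by
  unfold forwardStep
  split
  · exact le_rfl
  · rename_i q g rest _
    have := σ.time_le_find g
    simp only
    split_ifs <;> exact this

lemma time_le_backwardStep (z : Fin n) (σ : Store n) (S : Search n) :
    σ.time ≤ (backwardStep z σ S).1.time := by
  unfold backwardStep
  split
  · exact le_rfl
  · rename_i h r rest _
    have := σ.time_le_find h
    simp only
    split_ifs <;> exact this

lemma time_lt_advance (u z : Fin n) (σ : Store n) (S : Search n) :
    σ.time < (advance u z σ S).1.time := by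
  unfold advance
  split_ifs
  · exact (Nat.lt_succ_self _).trans_le
      ((time_le_forwardStep u (σ.tick 1) S).trans (time_le_backwardStep z _ _))
  all_goals exact Nat.lt_succ_self _

lemma time_le_forwardChange {choose : List (Fin n) → PMF (Fin n)} {p : Store n × Search n}
    {q : Store n × Search n × List (Fin n)} (hq : q ∈ (forwardChange choose p).support) :
    p.1.time ≤ q.1.time := by
  unfold forwardChange at hq
  simp only at hq
  split_ifs at hq
  · rw [PMF.mem_support_pure_iff] at hq
    rw [hq]; exact Nat.le_add_right _ _
  · obtain ⟨s, -, rfl⟩ := (PMF.mem_support_map_iff _ _ _).1 hq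
    exact Nat.le_add_right _ _
  · rw [PMF.mem_support_pure_iff] at hq
    rw [hq]

lemma time_le_backwardChange {choose : List (Fin n) → PMF (Fin n)} {p : Store n × Search n}
    {q : Store n × Search n × List (Fin n)} (hq : q ∈ (backwardChange choose p).support) :
    p.1.time ≤ q.1.time := by
  unfold backwardChange at hq
  simp only at hq
  split_ifs at hq
  · rw [PMF.mem_support_pure_iff] at hq
    rw [hq]; exact Nat.le_add_right _ _
  · obtain ⟨s, -, rfl⟩ := (PMF.mem_support_map_iff _ _ _).1 hq
    exact Nat.le_add_right _ _
  · rw [PMF.mem_support_pure_iff] at hq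
    rw [hq]

lemma time_lt_finish (pol : Policy n) (c : Config n) (S : Search n) :
    c.store.time < (finish pol c S).time := by
  have h1 : c.store.time < (c.store.tick (1 + S.F.length + S.B.length)).time := by
    simp only [Store.tick]; omega
  have h2 := h1.trans_le (Store.time_le_findAll _ (subgraphEnds c.store S))
  refine h2.trans_le (le_trans ?_ (Store.time_le_insertArc _ S.v S.w))
  refine le_trans ?_ (Store.time_le_foldl_unite _ S.dst _)
  exact (Nat.le_add_right _ _).trans (Nat.le_add_right _ _)

lemma eq_or_time_lt_of_mem_step {pol : Policy n} {c c' : Config n}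
    (h : c' ∈ (step pol c).support) : (c.IsFinal ∧ c' = c) ∨ c.store.time < c'.store.time := by
  cases hs : c.search with
  | none =>
    cases ht : c.todo with
    | nil =>
      have e : step pol c = PMF.pure c := by unfold step; rw [hs, ht]
      rw [e, PMF.mem_support_pure_iff] at h
      exact Or.inl ⟨⟨ht, hs⟩, h⟩
    | cons a rest =>
      obtain ⟨v, w⟩ := a
      right
      unfold step at h
      rw [hs, ht] at h
      simp only at h
      have h1 : c.store.time < (((c.store.find v).find w).tick 1).time :=
        Nat.lt_succ_of_le ((Store.time_le_find _ v).trans (Store.time_le_find _ w))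
      split_ifs at h
      · rw [PMF.mem_support_pure_iff] at h
        rw [h]; exact h1
      · rw [PMF.mem_support_pure_iff] at h
        rw [h]; exact h1.trans_le (Store.time_le_insertArc _ v w)
  | some S =>
    right
    unfold step at h
    rw [hs] at h
    simp only at h
    split_ifs at h
    · rw [PMF.mem_support_pure_iff] at h
      rw [h]; exact time_lt_finish pol c S
    · unfold iteration at h
      obtain ⟨p, hp, hp'⟩ := (PMF.mem_support_bind_iff _ _ _).1 h
      obtain ⟨q, hq, rfl⟩ := (PMF.mem_support_map_iff _ _ _).1 hp'
      exact ((time_lt_advance _ _ _ S).trans_le (time_le_forwardChange hp)).trans_le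
        (time_le_backwardChange hq)

lemma isFinal_or_le_time {pol : Policy n} {arcs : List (Arc n)} (N : ℕ) :
    ∀ c ∈ (run pol arcs N).support, c.IsFinal ∨ N ≤ c.store.time := by
  induction N with
  | zero => exact fun c _ => Or.inr (Nat.zero_le _)
  | succ N ih =>
    intro c hc
    have : run pol arcs (N + 1) = (run pol arcs N).bind (step pol) := rfl
    rw [this] at hc
    obtain ⟨c₀, h0, h1⟩ := (PMF.mem_support_bind_iff _ _ _).1 hc
    rcases eq_or_time_lt_of_mem_step h1 with ⟨h2, rfl⟩ | h2
    · exact Or.inl h2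
    · rcases ih c₀ h0 with h3 | h3
      · have : step pol c₀ = PMF.pure c₀ := by unfold step; rw [h3.1, h3.2]
        rw [this, PMF.mem_support_pure_iff] at h1
        exact Or.inl (h1 ▸ h3)
      · exact Or.inr (by omega)

/-! ### Bounds -/

lemma consistent_and_time_le_of_mem_run {A : ℕ} {pol : Policy n} (hpol : pol.Valid)
    {arcs : List (Arc n)} (harcs : arcs.Nodup)
    (hfair : ∀ c : Config n, Fair worst A c.store (pol.threshold c)) {N : ℕ} {c : Config n}
    (hc : c ∈ (run pol arcs N).support) :
    c.Consistent arcs ∧ (c.store.time : ℝ) ≤ (start arcs).amortized A arcs := by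
  have h1 := run_drift averaging_worst hpol harcs (fun c _ _ => hfair c) N
  have h2 : c.value A arcs ≤ ENNReal.ofReal ((start arcs).amortized A arcs) :=
    (le_iSup₂ (f := fun c _ => Config.value A arcs c) c hc).trans h1
  have hcon : c.Consistent arcs := by
    by_contra h
    unfold Config.value at h2
    rw [if_neg h, top_le_iff] at h2
    exact ENNReal.ofReal_ne_top h2
  refine ⟨hcon, ?_⟩
  rw [hcon.value_eq] at h2
  have h3 : (0 : ℝ) ≤ (start arcs).amortized A arcs :=
    le_trans (Nat.cast_nonneg _) (consistent_start arcs).time_le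
  exact hcon.time_le.trans ((ENNReal.ofReal_le_ofReal_iff h3).1 h2)

lemma sq_le_four_mul_two_pow (k : ℕ) : k ^ 2 ≤ 4 * 2 ^ k := by
  rcases Nat.lt_or_ge k 3 with h | h
  · interval_cases k <;> norm_num
  · induction k, h using Nat.le_induction with
    | base => norm_num
    | succ k hk ih => rw [pow_succ 2 k]; nlinarith

lemma log_le_two_mul_sqrt {n : ℕ} (hn : n ≠ 0) : (Nat.log 2 n : ℝ) ≤ 2 * √n := by
  have h1 : Nat.log 2 n ^ 2 ≤ 4 * n :=
    (sq_le_four_mul_two_pow _).trans (Nat.mul_le_mul_left 4 (Nat.pow_log_le_self 2 hn))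
  have h2 : (Nat.log 2 n : ℝ) ^ 2 ≤ (2 * √n) ^ 2 := by
    rw [mul_pow, Real.sq_sqrt (Nat.cast_nonneg n)]
    exact_mod_cast h1
  exact le_of_sq_le_sq h2 (by positivity)

/-- Here `n * log₂ n ≤ 2 * n * √n` covers the potential of the disjoint set forest. -/
lemma amortized_start_le {κ : ℝ} (hκ : 0 < κ) (A : ℕ) (arcs : List (Arc n))
    (hn : (n : ℝ) ≤ κ * arcs.length) : (start arcs).amortized A arcs ≤
      (κ + 2 * κ * √κ + (12 * A + 240)) * (arcs.length : ℝ) ^ (3 / 2 : ℝ) := by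
  set m : ℝ := (arcs.length : ℝ) with hm
  have hm0 : 0 ≤ m := Nat.cast_nonneg _
  have hpow : m ^ (3 / 2 : ℝ) = m * √m := by
    rw [Real.sqrt_eq_rpow, show (3 / 2 : ℝ) = 1 + 1 / 2 by norm_num,
      Real.rpow_add_of_nonneg hm0 zero_le_one (by norm_num), Real.rpow_one]
  rw [hpow]
  have hcost : ((Store.init n).cost : ℝ) ≤ n + 2 * n * √n := by
    have h1 : (Store.init n).cost ≤ n + n * Nat.log 2 n := by
      have := Store.slack_init n
      have : (Store.init n).time = n := rfl
      unfold Store.cost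
      omega
    have h2 : ((Store.init n).cost : ℝ) ≤ n + n * (Nat.log 2 n : ℝ) := by exact_mod_cast h1
    rcases Nat.eq_zero_or_pos n with h0 | h0
    · subst h0; simpa using h2
    · have h3 := mul_le_mul_of_nonneg_left (log_le_two_mul_sqrt h0.ne') (Nat.cast_nonneg (α := ℝ) n)
      linarith
  have hstart : (start arcs).amortized A arcs =
      ((Store.init n).cost : ℝ) + reserve A arcs [] arcs := by
    have h1 : total (Store.init n).out + total (Store.init n).inn = 0 := by
      simp [total, Store.init]
    change ((_ + (A + 9) * (total (Store.init n).out + total (Store.init n).inn) : ℕ) : ℝ) + _ = _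
    rw [h1]
    rfl
  have hsqrt : √m * √m = m := Real.mul_self_sqrt hm0
  have hs0 := Real.sqrt_nonneg m
  have hone : m ≤ m * √m := by
    rcases Nat.eq_zero_or_pos arcs.length with h0 | h0
    · simp [hm, h0]
    · have h1 : 1 ≤ √m := Real.one_le_sqrt.2 (by rw [hm]; exact_mod_cast h0)
      exact le_mul_of_one_le_right hm0 h1
  have hA : (0 : ℝ) ≤ A := Nat.cast_nonneg A
  have hres : reserve A arcs [] arcs ≤ (12 * A + 240) * (m * √m) := by
    unfold reserve
    rw [← hm]
    have h1 : 2 * ((A : ℝ) + 25) / √m * (m ^ 2 - (related arcs []).card) ≤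
        2 * ((A : ℝ) + 25) / √m * m ^ 2 :=
      mul_le_mul_of_nonneg_left (sub_le_self _ (Nat.cast_nonneg _)) (by positivity)
    have h2 : 2 * ((A : ℝ) + 25) / √m * m ^ 2 = 2 * (A + 25) * (m * √m) := by
      rcases hs0.eq_or_lt with h0 | h0
      · rw [← h0] at hsqrt ⊢; simp
      · rw [div_mul_eq_mul_div, div_eq_iff h0.ne']
        linear_combination -(2 * ((A : ℝ) + 25) * m) * hsqrt
    nlinarith [mul_le_mul_of_nonneg_left hone hA]
  have h1 : (n : ℝ) * √n ≤ κ * m * (√κ * √m) := by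
    rw [← Real.sqrt_mul hκ.le]
    exact mul_le_mul hn (Real.sqrt_le_sqrt hn) (Real.sqrt_nonneg _) (by positivity)
  rw [hstart]
  nlinarith [mul_le_mul_of_nonneg_left hone hκ.le]

end StrongComp

theorem mainTheorem8 :
    (∀ (n : ℕ) (pol : StrongComp.Policy n) (arcs : List (StrongComp.Arc n)),
      pol.Valid → arcs.Nodup →
        (∃ N : ℕ, ∀ c ∈ (StrongComp.run pol arcs N).support, c.IsFinal) ∧
        ∀ N : ℕ, ∀ c ∈ (StrongComp.run pol arcs N).support,
          arcs = c.added ++ c.todo ∧ (c.search = none → c.store.Correct c.added)) ∧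
    (∀ κ ε : ℝ, 0 < κ → 0 < ε → ∃ C : ℝ,
      ∀ (n : ℕ) (pol : StrongComp.Policy n) (arcs : List (StrongComp.Arc n)),
        pol.Valid → arcs.Nodup → (n : ℝ) ≤ κ * arcs.length → pol.ApproxMedian ε →
          ∀ N : ℕ, ∀ c ∈ (StrongComp.run pol arcs N).support,
            (c.store.time : ℝ) ≤ C * (arcs.length : ℝ) ^ (3 / 2 : ℝ)) ∧
    (∀ κ : ℝ, 0 < κ → ∃ C : ℝ,
      ∀ (n : ℕ) (pol : StrongComp.Policy n) (arcs : List (StrongComp.Arc n)),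
        pol.Valid → arcs.Nodup → (n : ℝ) ≤ κ * arcs.length → pol.Uniform →
          ∀ N : ℕ, ∑' c, StrongComp.run pol arcs N c * (c.store.time : ℝ≥0∞) ≤
            ENNReal.ofReal (C * (arcs.length : ℝ) ^ (3 / 2 : ℝ))) := by
  refine ⟨fun n pol arcs hpol harcs => ⟨?_, fun N c hc => ?_⟩, fun κ ε hκ hε => ?_, fun κ hκ => ?_⟩
  · -- the time is bounded, and every step that does not start from a final state increases it
    obtain ⟨N, hN⟩ := exists_nat_gt ((StrongComp.start arcs).amortized (4 * n) arcs)
    refine ⟨N, fun c hc => (StrongComp.isFinal_or_le_time N c hc).resolve_right fun h => ?_⟩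
    have h1 := (StrongComp.consistent_and_time_le_of_mem_run hpol harcs hpol.fair_worst hc).2
    have h2 : (N : ℝ) ≤ c.store.time := by exact_mod_cast h
    linarith
  · obtain ⟨h, -⟩ := StrongComp.consistent_and_time_le_of_mem_run hpol harcs hpol.fair_worst hc
    exact ⟨h.arcs_eq, fun hs => (h.good hs).correct⟩
  · refine ⟨κ + 2 * κ * √κ + (12 * (⌈4 / ε⌉₊ : ℕ) + 240), fun n pol arcs hpol harcs hn hmed N c hc => ?_⟩
    exact (StrongComp.consistent_and_time_le_of_mem_run hpol harcs (hmed.fair_worst hε) hc).2.trans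
      (StrongComp.amortized_start_le hκ _ arcs hn)
  · refine ⟨κ + 2 * κ * √κ + (12 * (24 : ℕ) + 240), fun n pol arcs hpol harcs hn huni N => ?_⟩
    refine le_trans ?_ ((StrongComp.run_drift StrongComp.averaging_expected hpol harcs
      (fun c E hc => huni.fair_expected hc) N).trans
      (ENNReal.ofReal_le_ofReal (StrongComp.amortized_start_le hκ 24 arcs hn)))
    refine ENNReal.tsum_le_tsum fun c => mul_le_mul_right ?_ _
    by_cases h : c.Consistent arcs
    · rw [h.value_eq, ← ENNReal.ofReal_natCast]
      exact ENNReal.ofReal_le_ofReal h.time_le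
    · unfold StrongComp.Config.value
      rw [if_neg h]
      exact le_top
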